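/- A (three-dimensional) convex polyhedron is an intersection $P\subset\mathbb{R}^3$ of finitely many closed half-spaces that has non-empty interior; its faces are its two-dimensional faces. For $k\in\mathbb{N}$, a convex polyhedron $P$ is called $k$-equiprojective if, for every direction $u\in\mathbb{R}^3\setminus\{0\}$ that is not parallel to any face of $P$, the orthogonal projection of $P$ onto the plane perpendicular to $u$ is a convex $k$-gon, i.e. a two-dimensional convex polygon with exactly $k$ vertices. A triangular prism is the convex hull of a non-degenerate triangle $T\subset\mathbb{R}^3$ and a translate $t+T$, where the vector $t$ is not parallel to the plane of $T$ (the prism may be oblique; its three lateral faces are parallelograms). Theorem. (a) There is no $3$-equiprojective convex polyhedron. (b) There is no $4$-equiprojective convex polyhedron. (c) A set $P \subset \mathbb{R}^3$ is a $5$-equiprojective convex polyhedron if and only if it is a triangular prism. Consequently $5$ is the least $k$ for which a $k$-equiprojective convex polyhedron exists, and among all equiprojective polyhedra this minimum is attained exactly by the triangular prisms. -/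

import Mathlib

namespace Equiprojective

/-- Euclidean three-dimensional space. -/
abbrev E3 : Type := EuclideanSpace ℝ (Fin 3)

/-- A (three-dimensional) convex polyhedron: an intersection of finitely many closed half-spaces
`{x | ⟪a, x⟫ ≤ b}`, `a ≠ 0`, with non-empty interior. -/
def IsConvexPolyhedron (P : Set E3) : Prop :=
  (∃ H : Finset (E3 × ℝ), (∀ h ∈ H, h.1 ≠ 0) ∧ P = {x | ∀ h ∈ H, inner ℝ h.1 x ≤ h.2}) ∧
    (interior P).Nonempty

/-- `F` is a face (a two-dimensional face) of `P`: it is the intersection of `P` with a supporting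
plane, and it has affine dimension two. -/
def IsFace (P F : Set E3) : Prop :=
  IsExposed ℝ P F ∧ Module.finrank ℝ (vectorSpan ℝ F) = 2

/-- The shadow of `P` in the direction `u`: its orthogonal projection onto the plane through the
origin perpendicular to `u`. -/
noncomputable def shadow (u : E3) (P : Set E3) : Set E3 :=
  (ℝ ∙ u)ᗮ.starProjection '' P

/-- `Q` is a (planar, convex) `k`-gon: a two-dimensional convex hull of exactly `k` points, none
of which lies in the convex hull of the others. -/
def IsPolygon (k : ℕ) (Q : Set E3) : Prop :=
  ∃ V : Finset E3, V.card = k ∧ ConvexIndependent ℝ ((↑) : V → E3) ∧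
    Q = convexHull ℝ (V : Set E3) ∧ Module.finrank ℝ (vectorSpan ℝ Q) = 2

/-- `P` is a `k`-equiprojective polyhedron: a convex polyhedron whose shadow is a `k`-gon in every
direction that is not parallel to a face of `P`. -/
def IsEquiprojective (k : ℕ) (P : Set E3) : Prop :=
  IsConvexPolyhedron P ∧
    ∀ u : E3, u ≠ 0 → (∀ F : Set E3, IsFace P F → u ∉ vectorSpan ℝ F) →
      IsPolygon k (shadow u P)

/-- `P` is a (right or oblique) `k`-gonal prism: the solid spanned by a `k`-gon and its translate
by a vector not parallel to the plane of the `k`-gon; so corresponding edges of the two copies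
are joined by parallelograms. -/
def IsPrism (k : ℕ) (P : Set E3) : Prop :=
  ∃ (Q : Set E3) (t : E3), IsPolygon k Q ∧ t ∉ vectorSpan ℝ Q ∧
    P = convexHull ℝ (Q ∪ (fun x => t + x) '' Q)

end Equiprojective

/-!
The proof reads the shadows of a polyhedron off its half-spaces. A bounded polyhedron is written
as `poly H` for an irredundant system `H` of half-spaces, so that the elements of `H` are its
faces. In a direction `u` not parallel to a face, a vertex projects to a vertex of the shadow
exactly if it lies on two faces whose outer normals have inner products with `u` of opposite
signs. These vertices form the silhouette `sil H (dir u)`, and `k`-equiprojectivity means that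
the silhouette has `k` elements for all such `u` (`Irredundant.isEquiprojective`,
`IsEquiprojective.exists_irredundant`; boundedness follows from that of two shadows). The
silhouette depends only on the signs, and sign patterns of directions may be combined
lexicographically (`Realizable.lex`), which replaces perturbing a degenerate direction.

When `u` crosses the plane of a face `h`, only the vertices of `h` and of a face parallel to `h`
may enter or leave the silhouette. If no other face is parallel to `h`, the numbers of vertices of
`h` on the two sides agree (`card_up_eq_of_unpartnered`). If `h'` is parallel to `h`, the changes
on the two faces compensate (`card_sil_of_partnered`). Turning `u` in the plane of `h` past the direction of an
edge shows that an unpartnered face has a second edge parallel to each edge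
(`IsEdge.exists_parallel`).

*No parallel faces.* The faces parallel to a given edge are then linked by parallel edges. In a
direction close to the edge that separates its two faces, each of these edges contributes to the
silhouette, and this edge contributes both ends. This gives at least five silhouette vertices,
and at least six unless exactly three faces are linked in a cycle (`IsEdge.exists_isZone`). With
exactly five, every face is a parallelogram, and the shadow along an edge would be a triangle
containing two different parallel translates of one of its sides, which is impossible
(`exists_parallel_faces`).

*Two parallel faces `h` and `h'`.* Adding the silhouette counts on both sides of the plane of `h`
bounds `2 * k` below by the numbers of vertices of the two faces plus four, so `5 ≤ k`
(`IsParallelPair.five_le`). If `k = 5`, both faces are triangles and contain all vertices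
(`IsParallelPair.tight_of_mem_verts`). Passing the directions of edges shows that the triangles
are positively homothetic (`IsTriangle.exists_homothety`), and if one of them were smaller, the
silhouette along the line of their centroids would lie on the larger one, with only three vertices
(`IsTriangle.not_smaller`). So they are translates of each other, and the polyhedron is a prism
(`isPrism_of_constSil`).

Conversely, in barycentric coordinates along the base and the height, a triangular prism has six
vertices, exactly one of which is off the silhouette in each direction not parallel to a face
(`PrismFrame.constSil`).
-/

namespace Equiprojective

open scoped InnerProductSpace

/-! ### Orthogonality in three-dimensional space -/

theorem exists_ne_zero_orthogonal (a b : E3) :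
    ∃ r : E3, r ≠ 0 ∧ ⟪a, r⟫_ℝ = 0 ∧ ⟪b, r⟫_ℝ = 0 := by
  by_contra! hcon
  have hbot : (Submodule.span ℝ ({a, b} : Set E3))ᗮ = ⊥ := by
    rw [Submodule.eq_bot_iff]
    intro x hx
    by_contra hx0
    have ha := (Submodule.mem_orthogonal _ _).1 hx a (Submodule.subset_span (by simp))
    have hb := (Submodule.mem_orthogonal _ _).1 hx b (Submodule.subset_span (by simp))
    exact hcon x hx0 ha hb
  have htop := Submodule.orthogonal_eq_bot_iff.1 hbot
  have h1 := finrank_span_le_card (R := ℝ) ({a, b} : Set E3)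
  rw [htop, finrank_top, finrank_euclideanSpace_fin, Set.toFinset_card] at h1
  have h3 := Finset.card_le_two (a := a) (b := b)
  have h4 : Fintype.card ↑({a, b} : Set E3) ≤ 2 := by
    rw [← Set.toFinset_card]
    exact le_trans (Finset.card_le_card (by intro x; simp)) h3
  omega

theorem eq_zero_of_orthogonal_triple {a b c x : E3} (ha : a ≠ 0) (hb : b ≠ 0) (hc : c ≠ 0)
    (hab : ⟪a, b⟫_ℝ = 0) (hac : ⟪a, c⟫_ℝ = 0) (hbc : ⟪b, c⟫_ℝ = 0)
    (hxa : ⟪x, a⟫_ℝ = 0) (hxb : ⟪x, b⟫_ℝ = 0) (hxc : ⟪x, c⟫_ℝ = 0) : x = 0 := by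
  by_contra hx
  have hli : LinearIndependent ℝ ![a, b, c, x] := by
    apply linearIndependent_of_ne_zero_of_inner_eq_zero
    · intro i; fin_cases i <;> assumption
    · intro i j hij
      have h1 := real_inner_comm a b
      have h2 := real_inner_comm a c
      have h3 := real_inner_comm b c
      have h4 := real_inner_comm a x
      have h5 := real_inner_comm b x
      have h6 := real_inner_comm c x
      fin_cases i <;> fin_cases j <;> simp_all
  have := hli.fintype_card_le_finrank
  simp at this

theorem exists_smul_of_orthogonal {n p q a : E3} (hn : n ≠ 0) (hp : p ≠ 0) (hq : q ≠ 0)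
    (hnp : ⟪n, p⟫_ℝ = 0) (hnq : ⟪n, q⟫_ℝ = 0) (hpq : ⟪p, q⟫_ℝ = 0)
    (hap : ⟪a, p⟫_ℝ = 0) (haq : ⟪a, q⟫_ℝ = 0) : ∃ c : ℝ, a = c • n := by
  have hnn : ⟪n, n⟫_ℝ ≠ 0 := inner_self_ne_zero.2 hn
  refine ⟨⟪a, n⟫_ℝ / ⟪n, n⟫_ℝ, sub_eq_zero.1 ?_⟩
  apply eq_zero_of_orthogonal_triple hn hp hq hnp hnq hpq
  · rw [inner_sub_left, real_inner_smul_left, div_mul_cancel₀ _ hnn, sub_self]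
  · rw [inner_sub_left, real_inner_smul_left, hap, hnp, mul_zero, sub_self]
  · rw [inner_sub_left, real_inner_smul_left, haq, hnq, mul_zero, sub_self]

/-- In dimension three, the vectors orthogonal to two independent vectors form a line. -/
theorem exists_smul_of_orthogonal_pair {h g d x : E3} (hi : LinearIndependent ℝ ![h, g])
    (hd : d ≠ 0) (hd1 : ⟪h, d⟫_ℝ = 0) (hd2 : ⟪g, d⟫_ℝ = 0)
    (hx1 : ⟪h, x⟫_ℝ = 0) (hx2 : ⟪g, x⟫_ℝ = 0) : ∃ c : ℝ, x = c • d := by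
  set K := Submodule.span ℝ (Set.range ![h, g])
  have hK : Module.finrank ℝ K = 2 := by simpa using finrank_span_eq_card hi
  have hsum := K.finrank_add_finrank_orthogonal
  rw [hK, finrank_euclideanSpace_fin] at hsum
  have h1 : Module.finrank ℝ Kᗮ = 1 := by omega
  have hmem : ∀ y : E3, ⟪h, y⟫_ℝ = 0 → ⟪g, y⟫_ℝ = 0 → y ∈ Kᗮ := by
    intro y h1 h2
    rw [Submodule.mem_orthogonal]
    intro u hu
    induction hu using Submodule.span_induction with
    | mem z hz =>
      obtain ⟨i, rfl⟩ := hz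
      fin_cases i <;> simpa
    | zero => simp
    | add a b _ _ ha hb => rw [inner_add_left, ha, hb, add_zero]
    | smul c a _ ha => rw [inner_smul_left, ha, mul_zero]
  obtain ⟨c, hc⟩ := (finrank_eq_one_iff_of_nonzero' (⟨d, hmem d hd1 hd2⟩ : Kᗮ)
    (by simpa [Subtype.ext_iff] using hd)).1 h1 ⟨x, hmem x hx1 hx2⟩
  exact ⟨c, by simpa [Subtype.ext_iff] using hc.symm⟩

/-- In dimension three, two independent vectors orthogonal to `d` span all vectors orthogonal
to `d`. -/
theorem exists_combination_of_orthogonal {h g d f : E3} (hi : LinearIndependent ℝ ![h, g])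
    (hd : d ≠ 0) (hd1 : ⟪h, d⟫_ℝ = 0) (hd2 : ⟪g, d⟫_ℝ = 0) (hf : ⟪f, d⟫_ℝ = 0) :
    ∃ α β : ℝ, f = α • h + β • g := by
  set K := Submodule.span ℝ (Set.range ![h, g])
  have hK : Module.finrank ℝ K = 2 := by simpa using finrank_span_eq_card hi
  have hsum := (ℝ ∙ d).finrank_add_finrank_orthogonal
  rw [finrank_span_singleton hd, finrank_euclideanSpace_fin] at hsum
  have hle : K ≤ (ℝ ∙ d)ᗮ := by
    rw [Submodule.span_le]
    rintro _ ⟨i, rfl⟩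
    rw [SetLike.mem_coe, Submodule.mem_orthogonal_singleton_iff_inner_left]
    fin_cases i <;> simpa
  have heq := Submodule.eq_of_le_of_finrank_eq hle (by omega)
  have hfK : f ∈ K := by
    rw [heq, Submodule.mem_orthogonal_singleton_iff_inner_left]
    exact hf
  simp only [K, Matrix.range_cons, Matrix.range_empty, Set.union_empty, Set.singleton_union] at hfK
  obtain ⟨α, β, h⟩ := Submodule.mem_span_pair.1 hfK
  exact ⟨α, β, h.symm⟩

/-! ### Irredundant systems of half-spaces -/

/-- The intersection of the half-spaces `{x | ⟪h.1, x⟫ ≤ h.2}`, `h ∈ H`. -/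
def poly (H : Finset (E3 × ℝ)) : Set E3 := {x | ∀ h ∈ H, ⟪h.1, x⟫_ℝ ≤ h.2}

/-- The point `x` lies on the bounding plane of the half-space `h`. -/
def Tight (h : E3 × ℝ) (x : E3) : Prop := ⟪h.1, x⟫_ℝ = h.2

/-- `H` describes a bounded polyhedron with non-empty interior, and none of its half-spaces is
redundant: on each bounding plane there is a point that is interior to all other half-spaces.
The half-spaces then correspond to the faces of the polyhedron. -/
structure Irredundant (H : Finset (E3 × ℝ)) : Prop where
  bounded : Bornology.IsBounded (poly H)
  strict : ∃ x, ∀ h ∈ H, ⟪h.1, x⟫_ℝ < h.2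
  facet : ∀ h ∈ H, ∃ x, Tight h x ∧ ∀ g ∈ H, g ≠ h → ⟪g.1, x⟫_ℝ < g.2

variable {H : Finset (E3 × ℝ)}

theorem convex_poly : Convex ℝ (poly H) := by
  have : poly H = ⋂ h ∈ H, {x | ⟪h.1, x⟫_ℝ ≤ h.2} := by ext; simp [poly]
  rw [this]
  refine convex_iInter₂ fun h _ => ?_
  exact convex_halfSpace_le (f := fun x => ⟪h.1, x⟫_ℝ)
    ⟨fun x y => inner_add_right _ _ _, fun c x => by simp [inner_smul_right]⟩ _

theorem isClosed_poly : IsClosed (poly H) := by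
  have : poly H = ⋂ h ∈ H, {x | ⟪h.1, x⟫_ℝ ≤ h.2} := by ext; simp [poly]
  rw [this]
  exact isClosed_biInter fun h _ => isClosed_le (by fun_prop) continuous_const

theorem Irredundant.isCompact (hH : Irredundant H) : IsCompact (poly H) :=
  Metric.isCompact_of_isClosed_isBounded isClosed_poly hH.bounded

theorem inner_add_smul (a x u : E3) (t : ℝ) : ⟪a, x + t • u⟫_ℝ = ⟪a, x⟫_ℝ + t * ⟪a, u⟫_ℝ := by
  rw [inner_add_right, inner_smul_right]

theorem exists_small_of_forall {ι : Type*} (s : Finset ι) {p : ι → ℝ → Prop}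
    (h : ∀ i ∈ s, ∃ δ > 0, ∀ t : ℝ, |t| ≤ δ → p i t) :
    ∃ δ > 0, ∀ i ∈ s, ∀ t : ℝ, |t| ≤ δ → p i t := by
  classical
  induction s using Finset.induction_on with
  | empty => exact ⟨1, one_pos, by simp⟩
  | insert a s ha ih =>
    obtain ⟨δ, hδ, h1⟩ := ih fun i hi => h i (Finset.mem_insert_of_mem hi)
    obtain ⟨ε, hε, h2⟩ := h a (Finset.mem_insert_self _ _)
    refine ⟨min δ ε, lt_min hδ hε, fun i hi t ht => ?_⟩
    rcases Finset.mem_insert.1 hi with rfl | hi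
    · exact h2 t (ht.trans (min_le_right _ _))
    · exact h1 i hi t (ht.trans (min_le_left _ _))

theorem exists_small_add_mul_pos {a b : ℝ} (ha : 0 < a) :
    ∃ δ > 0, ∀ t : ℝ, |t| ≤ δ → 0 < a + t * b := by
  refine ⟨a / (2 * (|b| + 1)), by positivity, fun t ht => ?_⟩
  have h1 : |t * b| ≤ a / (2 * (|b| + 1)) * (|b| + 1) := by
    rw [abs_mul]
    exact mul_le_mul ht (by linarith) (abs_nonneg _) (by positivity)
  have h2 : a / (2 * (|b| + 1)) * (|b| + 1) = a / 2 := by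
    field_simp
  have := neg_abs_le (t * b)
  linarith

/-- A point of a polyhedron may be moved a little in a direction in which none of the tight
constraints increases. -/
theorem exists_pos_add_smul_mem {x u : E3} (hx : x ∈ poly H)
    (hu : ∀ g ∈ H, Tight g x → ⟪g.1, u⟫_ℝ ≤ 0) : ∃ t > (0 : ℝ), x + t • u ∈ poly H := by
  obtain ⟨δ, hδ, h⟩ := exists_small_of_forall H
    (p := fun g t => 0 ≤ t → ⟪g.1, x + t • u⟫_ℝ ≤ g.2) (by
      intro g hg
      rcases (hx g hg).lt_or_eq with hlt | heq
      · obtain ⟨δ, hδ, h⟩ := exists_small_add_mul_pos (b := -⟪g.1, u⟫_ℝ) (sub_pos.2 hlt)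
        refine ⟨δ, hδ, fun t ht _ => ?_⟩
        have := h t ht
        rw [inner_add_smul]
        linarith
      · refine ⟨1, one_pos, fun t _ ht => ?_⟩
        rw [inner_add_smul, heq]
        have := mul_nonpos_of_nonneg_of_nonpos ht (hu g hg heq)
        linarith)
  exact ⟨δ, hδ, fun g hg => h g hg δ (abs_of_pos hδ).le hδ.le⟩

theorem inner_nonpos_of_tight {x u : E3} {t : ℝ} {g : E3 × ℝ} (ht : 0 < t)
    (hg : g ∈ H) (hgx : Tight g x) (hxu : x + t • u ∈ poly H) : ⟪g.1, u⟫_ℝ ≤ 0 := by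
  have := hxu g hg
  rw [inner_add_smul, hgx] at this
  by_contra! hcon
  have := mul_pos ht hcon
  linarith

theorem inner_sub_nonpos_of_tight {x y : E3} {g : E3 × ℝ}
    (hg : g ∈ H) (hgx : Tight g x) (hy : y ∈ poly H) : ⟪g.1, y - x⟫_ℝ ≤ 0 := by
  have := hy g hg
  rw [inner_sub_right, hgx]
  linarith

theorem inner_sub_neg_of_tight {x y : E3} {g : E3 × ℝ}
    (hg : g ∈ H) (hgx : Tight g x) (hy : y ∈ poly H) (hgy : ¬ Tight g y) :
    ⟪g.1, y - x⟫_ℝ < 0 := by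
  have := lt_of_le_of_ne (hy g hg) hgy
  rw [inner_sub_right, hgx]
  linarith

theorem Tight.inner_sub {g : E3 × ℝ} {x y : E3} (hx : Tight g x) (hy : Tight g y) :
    ⟪g.1, y - x⟫_ℝ = 0 := by
  rw [inner_sub_right, hx, hy, sub_self]

theorem Tight.add {g : E3 × ℝ} {x u : E3} (hx : Tight g x) (hu : ⟪g.1, u⟫_ℝ = 0) :
    Tight g (x + u) := by
  rw [Tight, inner_add_right, hx, hu, add_zero]

theorem Tight.of_inner_sub {g : E3 × ℝ} {x y : E3} (hx : Tight g x)
    (hy : ⟪g.1, y - x⟫_ℝ = 0) : Tight g y := by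
  have := hx.add hy
  rwa [add_sub_cancel] at this

/-- A constraint that is tight at an inner point of a segment is tight at both ends. -/
theorem Tight.of_mem_openSegment {g : E3 × ℝ} {x y z : E3} (hg : g ∈ H) (hx : x ∈ poly H)
    (hy : y ∈ poly H) (hz : z ∈ openSegment ℝ x y) (h : Tight g z) : Tight g x ∧ Tight g y := by
  obtain ⟨a, b, ha, hb, hab, rfl⟩ := hz
  have h1 := hx g hg
  have h2 := hy g hg
  rw [Tight, inner_add_right, inner_smul_right, inner_smul_right] at h
  have hb' : b = 1 - a := by linarith
  subst hb'
  constructor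
  · refine le_antisymm h1 ?_
    nlinarith
  · refine le_antisymm h2 ?_
    nlinarith

/-! ### Vertices -/

theorem eq_of_mem_extremePoints {v x : E3} (hv : v ∈ (poly H).extremePoints ℝ)
    (hx : x ∈ poly H) (h : ∀ g ∈ H, Tight g v → Tight g x) : x = v := by
  obtain ⟨t, ht, hmem⟩ := exists_pos_add_smul_mem (u := v - x) hv.1 (by
    intro g hg hgv
    rw [(h g hg hgv).inner_sub hgv])
  refine hv.2 hx hmem ?_
  refine ⟨t / (1 + t), 1 / (1 + t), by positivity, by positivity, by field_simp; ring, ?_⟩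
  rw [← sub_eq_zero]
  match_scalars <;> field_simp <;> ring

theorem mem_extremePoints_of_tight {v : E3} (hv : v ∈ poly H)
    (h : ∀ x ∈ poly H, (∀ g ∈ H, Tight g v → Tight g x) → x = v) :
    v ∈ (poly H).extremePoints ℝ :=
  ⟨hv, fun x hx _ hy hxy => h x hx fun _ hg hgv => (hgv.of_mem_openSegment hg hx hy hxy).1⟩

theorem finite_extremePoints_poly (H : Finset (E3 × ℝ)) : ((poly H).extremePoints ℝ).Finite := by
  classical
  refine Set.Finite.of_finite_image (f := fun x => H.filter (fun g => Tight g x))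
    ((H.powerset : Set (Finset (E3 × ℝ))).toFinite.subset ?_) ?_
  · rintro _ ⟨x, -, rfl⟩
    exact Finset.mem_powerset.2 (Finset.filter_subset _ _)
  · intro x hx _ hy hxy
    refine eq_of_mem_extremePoints hy hx.1 fun g hg hgy => ?_
    have : g ∈ H.filter (fun g => Tight g _) := Finset.mem_filter.2 ⟨hg, hgy⟩
    rw [← show _ = H.filter (fun g => Tight g _) from hxy] at this
    exact (Finset.mem_filter.1 this).2

/-- The vertices of a polyhedron. -/
noncomputable def verts (H : Finset (E3 × ℝ)) : Finset E3 :=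
  (finite_extremePoints_poly H).toFinset

theorem mem_verts {v : E3} : v ∈ verts H ↔ v ∈ (poly H).extremePoints ℝ := by simp [verts]

theorem mem_poly_of_mem_verts {v : E3} (hv : v ∈ verts H) : v ∈ poly H := (mem_verts.1 hv).1

theorem eq_of_mem_verts {v x : E3} (hv : v ∈ verts H) (hx : x ∈ poly H)
    (h : ∀ g ∈ H, Tight g v → Tight g x) : x = v :=
  eq_of_mem_extremePoints (mem_verts.1 hv) hx h

/-- On each face of the polyhedron, given by a set `G` of tight constraints, a linear functional
attains its maximum at a vertex. -/
theorem Irredundant.exists_vertex_max (hH : Irredundant H) (G : Set (E3 × ℝ))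
    (hG : ∀ g ∈ G, g ∈ H) (w : E3) (hne : ∃ x ∈ poly H, ∀ g ∈ G, Tight g x) :
    ∃ v ∈ verts H, (∀ g ∈ G, Tight g v) ∧
      ∀ x ∈ poly H, (∀ g ∈ G, Tight g x) → ⟪w, x⟫_ℝ ≤ ⟪w, v⟫_ℝ := by
  set F : Set E3 := {x | x ∈ poly H ∧ ∀ g ∈ G, Tight g x} with hF
  have hFc : IsCompact F := by
    have : F = poly H ∩ ⋂ g ∈ G, {x | Tight g x} := by ext; simp [hF]
    rw [this]
    refine hH.isCompact.inter_right (isClosed_biInter fun g _ => ?_)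
    exact isClosed_eq (by fun_prop) continuous_const
  have hFe : IsExtreme ℝ (poly H) F := by
    refine ⟨fun x hx => hx.1, ?_⟩
    intro x hx y hy z hz hzs
    exact ⟨hx, fun g hg => ((hz.2 g hg).of_mem_openSegment (hG g hg) hx hy hzs).1⟩
  obtain ⟨m, hm, hmax⟩ := hFc.exists_isMaxOn (f := fun x => ⟪w, x⟫_ℝ) hne (by fun_prop)
  set K : Set E3 := {x | x ∈ F ∧ ∀ y ∈ F, ⟪w, y⟫_ℝ ≤ ⟪w, x⟫_ℝ} with hK
  have hKexp : IsExposed ℝ F K := fun _ => ⟨innerSL ℝ w, by simp [hK]⟩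
  have hKc : IsCompact K := hKexp.isCompact hFc
  obtain ⟨v, hv⟩ := hKc.extremePoints_nonempty ⟨m, hm, fun y hy => hmax hy⟩
  refine ⟨v, mem_verts.2 ((hFe.trans hKexp.isExtreme).extremePoints_subset_extremePoints hv),
    hv.1.1.2, fun x hx hxG => hv.1.2 x ⟨hx, hxG⟩⟩

theorem Irredundant.poly_eq_convexHull (hH : Irredundant H) :
    poly H = convexHull ℝ (verts H : Set E3) := by
  have h := closure_convexHull_extremePoints hH.isCompact convex_poly
  have h2 : ((verts H : Set E3)) = (poly H).extremePoints ℝ := by ext; simp [mem_verts]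
  rw [((finite_extremePoints_poly H).isClosed_convexHull ℝ).closure_eq] at h
  rw [h2, h]

/-! ### Shadows and silhouettes -/

open scoped Classical in
/-- The silhouette of a polyhedron with respect to a sign pattern `σ` on its half-spaces: the
vertices that lie on two faces of opposite signs. For `σ g = ⟪g.1, u⟫` these are the vertices
that project to vertices of the shadow in the direction `u`. -/
noncomputable def sil (H : Finset (E3 × ℝ)) (σ : E3 × ℝ → ℝ) : Finset E3 :=
  (verts H).filter fun v =>
    (∃ g ∈ H, Tight g v ∧ 0 < σ g) ∧ ∃ g ∈ H, Tight g v ∧ σ g < 0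

/-- The sign pattern of a direction. -/
noncomputable def dir (u : E3) (g : E3 × ℝ) : ℝ := ⟪g.1, u⟫_ℝ

theorem mem_sil {σ : E3 × ℝ → ℝ} {v : E3} : v ∈ sil H σ ↔ v ∈ verts H ∧
    (∃ g ∈ H, Tight g v ∧ 0 < σ g) ∧ ∃ g ∈ H, Tight g v ∧ σ g < 0 := by
  simp [sil]

theorem mem_sil_dir_iff {u v : E3} : v ∈ sil H (dir u) ↔
    v ∈ verts H ∧ ∀ t : ℝ, v + t • u ∈ poly H → t = 0 := by
  rw [mem_sil]
  refine and_congr_right fun hv => ⟨?_, fun h => ⟨?_, ?_⟩⟩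
  · rintro ⟨⟨g, hg, hgv, hpos⟩, f, hf, hfv, hneg⟩ t ht
    rcases lt_trichotomy t 0 with h | h | h
    · have := inner_nonpos_of_tight (u := -u) (neg_pos.2 h) hf hfv (by simpa using ht)
      rw [inner_neg_right] at this
      exact absurd hneg (not_lt.2 (neg_nonpos.1 this))
    · exact h
    · exact absurd hpos (not_lt.2 (inner_nonpos_of_tight h hg hgv ht))
  · by_contra! hcon
    obtain ⟨t, ht, hmem⟩ := exists_pos_add_smul_mem (mem_poly_of_mem_verts hv) hcon
    exact ht.ne' (h t hmem)
  · by_contra! hcon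
    obtain ⟨t, ht, hmem⟩ := exists_pos_add_smul_mem (u := -u) (mem_poly_of_mem_verts hv)
      fun g hg hgv => by
        rw [inner_neg_right]
        exact neg_nonpos.2 (hcon g hg hgv)
    have := h (-t) (by simpa using hmem)
    linarith

theorem starProjection_eq_iff {u x y : E3} :
    (ℝ ∙ u)ᗮ.starProjection x = (ℝ ∙ u)ᗮ.starProjection y ↔ ∃ t : ℝ, y = x + t • u := by
  rw [eq_comm, ← sub_eq_zero, ← map_sub, Submodule.starProjection_apply_eq_zero_iff,
    Submodule.orthogonal_orthogonal, Submodule.mem_span_singleton]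
  constructor
  · rintro ⟨t, ht⟩
    exact ⟨t, by rw [ht]; abel⟩
  · rintro ⟨t, rfl⟩
    exact ⟨t, by abel⟩

theorem exists_pos_add_smul_mem_of_strict {m : E3} (hm : ∀ g ∈ H, ⟪g.1, m⟫_ℝ < g.2) (w : E3) :
    ∃ t > (0 : ℝ), m + t • w ∈ poly H :=
  exists_pos_add_smul_mem (fun g hg => (hm g hg).le) fun g hg hgm => absurd hgm (hm g hg).ne

theorem exists_tight_of_segment {x u : E3} {t : ℝ} {g : E3 × ℝ} (ht : 0 < t)
    (hg : g ∈ H) (hx : x ∈ poly H) (hxt : x + t • u ∈ poly H)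
    (hm : Tight g (x + (t / 2) • u)) : Tight g x ∧ ⟪g.1, u⟫_ℝ = 0 := by
  have h1 := hx g hg
  have h2 := hxt g hg
  rw [Tight, inner_add_smul] at hm
  rw [inner_add_smul] at h2
  have h3 : Tight g x := le_antisymm h1 (by linarith)
  refine ⟨h3, ?_⟩
  have h4 : t * ⟪g.1, u⟫_ℝ = 0 := by
    rw [Tight] at h3
    linarith
  exact (mul_eq_zero.1 h4).resolve_left ht.ne'

theorem convex_openSegment_mem {x y z : E3} (hx : x ∈ poly H) (hy : y ∈ poly H)
    (hz : z ∈ openSegment ℝ x y) : z ∈ poly H :=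
  convex_poly.openSegment_subset hx hy hz

/-- In a direction that is not parallel to a face, the vertices of the shadow are the images of
the silhouette vertices. -/
theorem Irredundant.extremePoints_shadow (hH : Irredundant H) {u : E3}
    (hu : ∀ g ∈ H, ⟪g.1, u⟫_ℝ ≠ 0) :
    (shadow u (poly H)).extremePoints ℝ = (ℝ ∙ u)ᗮ.starProjection '' (sil H (dir u)) := by
  set π := (ℝ ∙ u)ᗮ.starProjection with hπ
  apply Set.Subset.antisymm
  · rintro q hq
    set K : Set E3 := {x | x ∈ poly H ∧ π x = q} with hK
    have hKe : IsExtreme ℝ (poly H) K := by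
      refine ⟨fun x hx => hx.1, ?_⟩
      rintro x hx y hy z ⟨-, hz⟩ hzs
      refine ⟨hx, hq.2 ⟨x, hx, rfl⟩ ⟨y, hy, rfl⟩ ?_⟩
      rw [← hz]
      exact image_openSegment ℝ π.toLinearMap.toAffineMap x y ▸ ⟨z, hzs, rfl⟩
    have hKc : IsCompact K := by
      have : K = poly H ∩ π ⁻¹' {q} := by ext; simp [hK]
      rw [this]
      exact hH.isCompact.inter_right (isClosed_singleton.preimage π.continuous)
    obtain ⟨x, hx, hxq⟩ := hq.1
    obtain ⟨v, hv⟩ := hKc.extremePoints_nonempty ⟨x, hx, hxq⟩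
    have hvV : v ∈ verts H := mem_verts.2 (hKe.extremePoints_subset_extremePoints hv)
    refine ⟨v, ?_, hv.1.2⟩
    have key : ∀ (u' : E3) (t : ℝ), (∀ g ∈ H, ⟪g.1, u'⟫_ℝ ≠ 0) →
        (∀ t : ℝ, π (v + t • u') = q) → 0 < t → v + t • u' ∉ poly H := by
      intro u' t hu' hq' ht hmem
      have hs : ∀ g ∈ H, ⟪g.1, v + (t / 2) • u'⟫_ℝ < g.2 := by
        intro g hg
        refine lt_of_le_of_ne ?_ fun h =>
          hu' g hg (exists_tight_of_segment ht hg hv.1.1 hmem h).2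
        have h1 := hv.1.1 g hg
        have h2 := hmem g hg
        rw [inner_add_smul] at h2 ⊢
        linarith
      obtain ⟨w, hw0, hw, -⟩ := exists_ne_zero_orthogonal u 0
      obtain ⟨s, hs0, hsm⟩ := exists_pos_add_smul_mem_of_strict hs w
      obtain ⟨r, hr0, hrm⟩ := exists_pos_add_smul_mem_of_strict hs (-w)
      have hπw : π w = w := by
        rw [hπ, Submodule.starProjection_eq_self_iff,
          Submodule.mem_orthogonal_singleton_iff_inner_right]
        exact hw
      have := hq.2 ⟨_, hsm, rfl⟩ ⟨_, hrm, rfl⟩ (by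
        refine ⟨r / (r + s), s / (r + s), by positivity, by positivity, by field_simp, ?_⟩
        change (r / (r + s)) • π _ + (s / (r + s)) • π _ = q
        rw [map_add, map_add π _ (r • -w), hq', map_smul, map_smul, map_neg, hπw]
        match_scalars
        · field_simp
        · field_simp
          ring)
      change π _ = q at this
      rw [map_add, hq', map_smul, hπw, add_eq_left, smul_eq_zero] at this
      exact this.elim hs0.ne' hw0
    have hπu : ∀ t : ℝ, π (v + t • u) = q := fun t => by
      rw [← hv.1.2]
      exact (starProjection_eq_iff.2 ⟨t, rfl⟩).symm
    refine mem_sil_dir_iff.2 ⟨hvV, fun t ht => ?_⟩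
    rcases lt_trichotomy t 0 with h | h | h
    · refine absurd ?_ (key (-u) (-t) (by simpa using hu) (fun t => ?_) (neg_pos.2 h))
      · simpa using ht
      · simpa using hπu (-t)
    · exact h
    · exact absurd ht (key u t hu hπu h)
  · rintro _ ⟨v, hv, rfl⟩
    obtain ⟨hvV, hv⟩ := mem_sil_dir_iff.1 hv
    refine ⟨⟨v, mem_poly_of_mem_verts hvV, rfl⟩, ?_⟩
    rintro _ ⟨x, hx, rfl⟩ _ ⟨y, hy, rfl⟩ hxy
    have h2 : π v ∈ π '' openSegment ℝ x y := by
      have := image_openSegment ℝ π.toLinearMap.toAffineMap x y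
      exact this ▸ hxy
    obtain ⟨z, hz, hzv⟩ := h2
    obtain ⟨t, rfl⟩ := starProjection_eq_iff.1 hzv.symm
    have ht := hv t (convex_openSegment_mem hx hy hz)
    rw [ht, zero_smul, add_zero] at hz
    exact congrArg π ((mem_verts.1 hvV).2 hx hy hz)

theorem injOn_sil (u : E3) : Set.InjOn (ℝ ∙ u)ᗮ.starProjection (sil H (dir u) : Set E3) := by
  intro v hv w hw h
  obtain ⟨t, rfl⟩ := starProjection_eq_iff.1 h
  obtain ⟨-, h⟩ := mem_sil_dir_iff.1 hv
  rw [h t (mem_poly_of_mem_verts (mem_sil_dir_iff.1 hw).1)]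
  simp

/-- A convexly independent finite set is the set of extreme points of its convex hull. -/
theorem extremePoints_convexHull_of_convexIndependent {V : Finset E3}
    (hV : ConvexIndependent ℝ ((↑) : V → E3)) :
    (convexHull ℝ (V : Set E3)).extremePoints ℝ = V := by
  have hcl := V.finite_toSet.isCompact_convexHull ℝ
  have hsub : (convexHull ℝ (V : Set E3)).extremePoints ℝ ⊆ V := extremePoints_convexHull_subset
  refine hsub.antisymm fun p hp => ?_
  by_contra hpe
  have hkm := closure_convexHull_extremePoints hcl (convex_convexHull ℝ _)
  rw [((V.finite_toSet.subset hsub).isClosed_convexHull ℝ).closure_eq] at hkm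
  refine convexIndependent_set_iff_notMem_convexHull_sdiff.1 hV p hp ?_
  have : p ∈ convexHull ℝ (V : Set E3) := subset_convexHull ℝ _ hp
  rw [← hkm] at this
  have hsub' : (convexHull ℝ (V : Set E3)).extremePoints ℝ ⊆ (V : Set E3) \ {p} :=
    fun x hx => ⟨hsub hx, fun hxp => hpe (Set.mem_singleton_iff.1 hxp ▸ hx)⟩
  exact convexHull_mono hsub' this

theorem vectorSpan_eq_top_of_interior {P : Set E3} (hP : (interior P).Nonempty) :
    vectorSpan ℝ P = ⊤ := by
  rw [← direction_affineSpan, affineSpan_eq_top_of_nonempty_interior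
    (hP.mono (interior_mono (subset_convexHull ℝ P))), AffineSubspace.direction_top]

theorem Irredundant.interior_nonempty (hH : Irredundant H) : (interior (poly H)).Nonempty := by
  obtain ⟨x, hx⟩ := hH.strict
  refine ⟨x, mem_interior.2 ⟨⋂ g ∈ H, {y : E3 | ⟪g.1, y⟫_ℝ < g.2}, ?_, ?_, ?_⟩⟩
  · intro y hy g hg
    exact (Set.mem_iInter₂.1 hy g hg).le
  · exact isOpen_biInter_finset fun g _ => isOpen_lt (by fun_prop) continuous_const
  · exact Set.mem_iInter₂.2 hx

theorem finrank_vectorSpan_shadow {P : Set E3} (hP : (interior P).Nonempty) {u : E3}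
    (hu : u ≠ 0) : Module.finrank ℝ (vectorSpan ℝ (shadow u P)) = 2 := by
  have h1 : vectorSpan ℝ (shadow u P) = (ℝ ∙ u)ᗮ := by
    have := ((ℝ ∙ u)ᗮ.starProjection.toLinearMap.toAffineMap).map_vectorSpan
      (s := P)
    rw [vectorSpan_eq_top_of_interior hP] at this
    refine this.symm.trans ?_
    simp
  have h2 := (ℝ ∙ u).finrank_add_finrank_orthogonal
  rw [finrank_span_singleton hu, finrank_euclideanSpace_fin] at h2
  rw [h1]
  omega

theorem Irredundant.isPolygon_shadow_iff (hH : Irredundant H) {u : E3} (hu0 : u ≠ 0)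
    (hu : ∀ g ∈ H, ⟪g.1, u⟫_ℝ ≠ 0) {k : ℕ} :
    IsPolygon k (shadow u (poly H)) ↔ (sil H (dir u)).card = k := by
  classical
  have hext := hH.extremePoints_shadow hu
  have hinj := injOn_sil (H := H) u
  constructor
  · rintro ⟨V, hk, hV, hQ, -⟩
    have h := extremePoints_convexHull_of_convexIndependent hV
    rw [← hQ, hext, ← Finset.coe_image, Finset.coe_inj] at h
    rw [← hk, ← h, Finset.card_image_of_injOn hinj]
  · intro hk
    refine ⟨(sil H (dir u)).image (ℝ ∙ u)ᗮ.starProjection, ?_, ?_, ?_,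
      finrank_vectorSpan_shadow hH.interior_nonempty hu0⟩
    · rw [Finset.card_image_of_injOn hinj, hk]
    · have hconv : Convex ℝ (shadow u (poly H)) :=
        convex_poly.linear_image (ℝ ∙ u)ᗮ.starProjection.toLinearMap
      have := hconv.convexIndependent_extremePoints
      rw [hext, ← Finset.coe_image] at this
      exact this
    · rw [Finset.coe_image, ← hext]
      have hcpt : IsCompact (shadow u (poly H)) :=
        hH.isCompact.image (ℝ ∙ u)ᗮ.starProjection.continuous
      have hconv : Convex ℝ (shadow u (poly H)) :=
        convex_poly.linear_image (ℝ ∙ u)ᗮ.starProjection.toLinearMap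
      have h := closure_convexHull_extremePoints hcpt hconv
      rw [IsClosed.closure_eq] at h
      · exact h.symm
      · rw [hext, ← Finset.coe_image]
        exact (Finset.finite_toSet _).isClosed_convexHull ℝ

/-! ### Realizable sign patterns -/

/-- A sign pattern on the half-spaces that is induced by some direction. -/
def Realizable (H : Finset (E3 × ℝ)) (σ : E3 × ℝ → ℝ) : Prop :=
  ∃ u : E3, ∀ g ∈ H, SignType.sign (σ g) = SignType.sign ⟪g.1, u⟫_ℝ

/-- The lexicographic combination of two sign patterns: `τ` decides where `σ` vanishes. -/
noncomputable def lex (σ τ : E3 × ℝ → ℝ) (g : E3 × ℝ) : ℝ := if σ g = 0 then τ g else σ g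

theorem lex_of_eq {σ τ : E3 × ℝ → ℝ} {g : E3 × ℝ} (h : σ g = 0) : lex σ τ g = τ g := if_pos h

theorem lex_of_ne {σ τ : E3 × ℝ → ℝ} {g : E3 × ℝ} (h : σ g ≠ 0) : lex σ τ g = σ g := if_neg h

theorem realizable_dir (u : E3) : Realizable H (dir u) := ⟨u, fun _ _ => rfl⟩

theorem exists_perturb (H : Finset (E3 × ℝ)) (u z : E3) : ∃ δ > (0 : ℝ), ∀ g ∈ H,
    (0 < ⟪g.1, u⟫_ℝ → 0 < ⟪g.1, u + δ • z⟫_ℝ) ∧ (⟪g.1, u⟫_ℝ < 0 → ⟪g.1, u + δ • z⟫_ℝ < 0) := by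
  obtain ⟨δ, hδ, h⟩ := exists_small_of_forall H
    (p := fun g t => (0 < ⟪g.1, u⟫_ℝ → 0 < ⟪g.1, u + t • z⟫_ℝ) ∧
      (⟪g.1, u⟫_ℝ < 0 → ⟪g.1, u + t • z⟫_ℝ < 0)) (by
    intro g _
    rcases lt_trichotomy ⟪g.1, u⟫_ℝ 0 with hlt | heq | hgt
    · obtain ⟨δ, hδ, h⟩ := exists_small_add_mul_pos (b := -⟪g.1, z⟫_ℝ) (neg_pos.2 hlt)
      refine ⟨δ, hδ, fun t ht => ⟨fun h0 => absurd h0 hlt.not_gt, fun _ => ?_⟩⟩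
      have := h t ht
      rw [inner_add_smul]
      linarith
    · exact ⟨1, one_pos, fun t _ => ⟨fun h0 => absurd heq h0.ne', fun h0 => absurd heq h0.ne⟩⟩
    · obtain ⟨δ, hδ, h⟩ := exists_small_add_mul_pos (b := ⟪g.1, z⟫_ℝ) hgt
      refine ⟨δ, hδ, fun t ht => ⟨fun _ => ?_, fun h0 => absurd h0 hgt.not_gt⟩⟩
      rw [inner_add_smul]
      exact h t ht)
  exact ⟨δ, hδ, fun g hg => h g hg δ (abs_of_pos hδ).le⟩

/-- Lexicographic combinations are realized by small perturbations. -/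
theorem Realizable.lex {σ τ : E3 × ℝ → ℝ} (hσ : Realizable H σ) (hτ : Realizable H τ) :
    Realizable H (lex σ τ) := by
  obtain ⟨u, hu⟩ := hσ
  obtain ⟨z, hz⟩ := hτ
  obtain ⟨δ, hδ, h⟩ := exists_perturb H u z
  refine ⟨u + δ • z, fun g hg => ?_⟩
  have hg1 := h g hg
  have hs := hu g hg
  rcases lt_trichotomy ⟪g.1, u⟫_ℝ 0 with hlt | heq | hgt
  · rw [sign_neg hlt, sign_eq_neg_one_iff] at hs
    rw [lex_of_ne hs.ne, sign_neg hs, sign_neg (hg1.2 hlt)]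
  · rw [heq, sign_zero, sign_eq_zero_iff] at hs
    rw [lex_of_eq hs, hz g hg, inner_add_smul, heq, zero_add, sign_mul, sign_pos hδ, one_mul]
  · rw [sign_pos hgt, sign_eq_one_iff] at hs
    rw [lex_of_ne hs.ne', sign_pos hs, sign_pos (hg1.1 hgt)]

theorem sil_congr {σ τ : E3 × ℝ → ℝ}
    (h : ∀ g ∈ H, SignType.sign (σ g) = SignType.sign (τ g)) : sil H σ = sil H τ := by
  have hp : ∀ g ∈ H, (0 < σ g ↔ 0 < τ g) := fun g hg => by
    rw [← sign_eq_one_iff, h g hg, sign_eq_one_iff]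
  have hn : ∀ g ∈ H, (σ g < 0 ↔ τ g < 0) := fun g hg => by
    rw [← sign_eq_neg_one_iff, h g hg, sign_eq_neg_one_iff]
  ext v
  rw [mem_sil, mem_sil]
  refine and_congr_right fun _ => and_congr ?_ ?_
  · exact exists_congr fun g => and_congr_right fun hg => and_congr_right fun _ => hp g hg
  · exact exists_congr fun g => and_congr_right fun hg => and_congr_right fun _ => hn g hg

/-- The number of silhouette vertices is `k` in every direction that is not parallel to one of
the bounding planes. -/
def ConstSil (k : ℕ) (H : Finset (E3 × ℝ)) : Prop :=
  ∀ u : E3, (∀ g ∈ H, ⟪g.1, u⟫_ℝ ≠ 0) → (sil H (dir u)).card = k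

theorem ConstSil.card_eq {k : ℕ} (hk : ConstSil k H) {σ : E3 × ℝ → ℝ} (hσ : Realizable H σ)
    (h0 : ∀ g ∈ H, σ g ≠ 0) : (sil H σ).card = k := by
  obtain ⟨u, hu⟩ := hσ
  rw [sil_congr (τ := dir u) hu]
  refine hk u fun g hg h => h0 g hg ?_
  rw [← sign_eq_zero_iff, hu g hg, h, sign_zero]

theorem exists_generic {n : E3} (hn : n ≠ 0) : ∃ u : E3, ⟪n, u⟫_ℝ = 0 ∧
    ∀ g ∈ H, (∀ c : ℝ, g.1 ≠ c • n) → ⟪g.1, u⟫_ℝ ≠ 0 := by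
  obtain ⟨p, hp, hnp, -⟩ := exists_ne_zero_orthogonal n 0
  obtain ⟨q, hq, hnq, hpq⟩ := exists_ne_zero_orthogonal n p
  have key : ∃ δ > 0, ∀ g ∈ H, ∀ t : ℝ, |t| ≤ δ → t ≠ 0 →
      (∀ c : ℝ, g.1 ≠ c • n) → ⟪g.1, p + t • q⟫_ℝ ≠ 0 := by
    refine exists_small_of_forall H (p := fun g t => t ≠ 0 →
      (∀ c : ℝ, g.1 ≠ c • n) → ⟪g.1, p + t • q⟫_ℝ ≠ 0) ?_
    intro g _
    rcases eq_or_ne ⟪g.1, p⟫_ℝ 0 with h0 | h0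
    · refine ⟨1, one_pos, fun t _ ht hc hz => ?_⟩
      rw [inner_add_smul, h0, zero_add] at hz
      have hgq := (mul_eq_zero.1 hz).resolve_left ht
      obtain ⟨c, hgc⟩ := exists_smul_of_orthogonal hn hp hq hnp hnq hpq h0 hgq
      exact hc c hgc
    · obtain ⟨δ, hδ, h⟩ := exists_small_add_mul_pos
        (b := ⟪g.1, p⟫_ℝ * ⟪g.1, q⟫_ℝ) (mul_self_pos.2 h0)
      refine ⟨δ, hδ, fun t ht _ _ hz => ?_⟩
      have := h t ht
      rw [inner_add_smul] at hz
      have h2 : ⟪g.1, p⟫_ℝ * (⟪g.1, p⟫_ℝ + t * ⟪g.1, q⟫_ℝ) = 0 := by rw [hz, mul_zero]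
      linarith
  obtain ⟨δ, hδ, h⟩ := key
  refine ⟨p + δ • q, ?_, fun g hg => h g hg δ (abs_of_pos hδ).le hδ.ne'⟩
  rw [inner_add_smul, hnp, hnq, mul_zero, add_zero]

/-! ### Equiprojectivity in terms of silhouettes -/

theorem Irredundant.ne_zero (hH : Irredundant H) {h : E3 × ℝ} (hh : h ∈ H) : h.1 ≠ 0 := by
  intro h0
  obtain ⟨x, hx⟩ := hH.strict
  obtain ⟨y, hy, -⟩ := hH.facet h hh
  have h1 := hx h hh
  rw [Tight] at hy
  rw [h0, inner_zero_left] at h1 hy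
  linarith

theorem Irredundant.nonempty (hH : Irredundant H) : H.Nonempty := by
  rw [Finset.nonempty_iff_ne_empty]
  rintro rfl
  have h : poly ∅ = Set.univ := by simp [poly]
  exact NormedSpace.unbounded_univ ℝ E3 (h ▸ hH.bounded)

theorem mem_poly_of_facet {h : E3 × ℝ} {x : E3} (hx : Tight h x)
    (hs : ∀ g ∈ H, g ≠ h → ⟪g.1, x⟫_ℝ < g.2) : x ∈ poly H := fun g hg => by
  rcases eq_or_ne g h with rfl | hne
  · exact hx.le
  · exact (hs g hg hne).le

/-- The part of the polyhedron on a bounding plane is a face, parallel to that plane. -/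
theorem Irredundant.isFace (hH : Irredundant H) {h : E3 × ℝ} (hh : h ∈ H) :
    IsFace (poly H) {x | x ∈ poly H ∧ Tight h x} ∧
      vectorSpan ℝ {x | x ∈ poly H ∧ Tight h x} = (ℝ ∙ h.1)ᗮ := by
  obtain ⟨x, hx, hxs⟩ := hH.facet h hh
  have hxP := mem_poly_of_facet hx hxs
  have hspan : vectorSpan ℝ {x | x ∈ poly H ∧ Tight h x} = (ℝ ∙ h.1)ᗮ := by
    apply le_antisymm
    · rw [vectorSpan_def, Submodule.span_le]
      rintro _ ⟨y, hy, z, hz, rfl⟩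
      rw [SetLike.mem_coe, Submodule.mem_orthogonal_singleton_iff_inner_right]
      exact hz.2.inner_sub hy.2
    · intro u hu
      rw [Submodule.mem_orthogonal_singleton_iff_inner_right] at hu
      obtain ⟨t, ht, hmem⟩ := exists_pos_add_smul_mem (u := u) hxP (by
        intro g hg hgx
        rcases eq_or_ne g h with rfl | hne
        · exact hu.le
        · exact absurd hgx (hxs g hg hne).ne)
      have hmem2 : Tight h (x + t • u) := hx.add (by rw [inner_smul_right, hu, mul_zero])
      have := vsub_mem_vectorSpan ℝ
        (show x + t • u ∈ {x | x ∈ poly H ∧ Tight h x} from ⟨hmem, hmem2⟩)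
        (show x ∈ {x | x ∈ poly H ∧ Tight h x} from ⟨hxP, hx⟩)
      rw [vsub_eq_sub, add_sub_cancel_left] at this
      exact (Submodule.smul_mem_iff _ ht.ne').1 this
  refine ⟨⟨fun _ => ⟨innerSL ℝ h.1, ?_⟩, ?_⟩, hspan⟩
  · ext y
    refine and_congr_right fun hy => ⟨fun hty z hz => ?_, fun hmax => ?_⟩
    · exact (hz h hh).trans hty.ge
    · exact le_antisymm (hy h hh) (hx.ge.trans (hmax x hxP))
  · have h2 := (ℝ ∙ h.1).finrank_add_finrank_orthogonal
    rw [finrank_span_singleton (hH.ne_zero hh), finrank_euclideanSpace_fin] at h2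
    rw [hspan]
    omega

theorem exists_tight_of_isFace {F : Set E3} (hint : (interior (poly H)).Nonempty)
    (hF : IsFace (poly H) F) :
    ∃ h ∈ H, ∀ x ∈ F, Tight h x := by
  classical
  obtain ⟨hexp, hdim⟩ := hF
  have hne : F.Nonempty := by
    rw [Set.nonempty_iff_ne_empty]
    rintro rfl
    rw [vectorSpan_empty, finrank_bot] at hdim
    omega
  have hFP : F ⊆ poly H := hexp.subset
  have hFc : Convex ℝ F := hexp.convex convex_poly
  by_contra! hcon
  have key : ∀ S : Finset (E3 × ℝ), S ⊆ H → ∃ m ∈ F, ∀ h ∈ S, ¬ Tight h m := by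
    intro S
    induction S using Finset.induction_on with
    | empty =>
      intro _
      exact ⟨hne.some, hne.some_mem, by simp⟩
    | insert a S ha ih =>
      intro hS
      obtain ⟨m, hm, hmS⟩ := ih fun x hx => hS (Finset.mem_insert_of_mem hx)
      obtain ⟨x, hx, hxa⟩ := hcon a (hS (Finset.mem_insert_self _ _))
      have hz : (1 / 2 : ℝ) • m + (1 / 2 : ℝ) • x ∈ openSegment ℝ m x :=
        ⟨1 / 2, 1 / 2, by norm_num, by norm_num, by norm_num, rfl⟩
      refine ⟨_, hFc.openSegment_subset hm hx hz, fun g hg hgt => ?_⟩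
      have h2 := hgt.of_mem_openSegment (hS hg) (hFP hm) (hFP hx) hz
      rcases Finset.mem_insert.1 hg with rfl | hgS
      · exact hxa h2.2
      · exact hmS g hgS h2.1
  obtain ⟨m, hm, hmH⟩ := key H subset_rfl
  have hms : ∀ g ∈ H, ⟪g.1, m⟫_ℝ < g.2 := fun g hg => lt_of_le_of_ne (hFP hm g hg) (hmH g hg)
  obtain ⟨l, hl⟩ := hexp hne
  have hl0 : ∀ w, l w ≤ 0 := by
    intro w
    obtain ⟨t, ht, hmem⟩ := exists_pos_add_smul_mem_of_strict hms w
    rw [hl] at hm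
    have := hm.2 _ hmem
    rw [map_add, map_smul, smul_eq_mul] at this
    by_contra! hw
    have := mul_pos ht hw
    linarith
  have hFeq : F = poly H := by
    rw [hl]
    ext x
    refine ⟨fun hx => hx.1, fun hx => ⟨hx, fun y _ => ?_⟩⟩
    have h1 := hl0 (y - x)
    rw [map_sub] at h1
    linarith
  rw [hFeq, vectorSpan_eq_top_of_interior hint, finrank_top, finrank_euclideanSpace_fin] at hdim
  omega

theorem notMem_vectorSpan_of_isFace {F : Set E3} (hint : (interior (poly H)).Nonempty)
    (hF : IsFace (poly H) F) {u : E3} (hu : ∀ g ∈ H, ⟪g.1, u⟫_ℝ ≠ 0) :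
    u ∉ vectorSpan ℝ F := by
  obtain ⟨h, hh, ht⟩ := exists_tight_of_isFace hint hF
  intro hmem
  have : vectorSpan ℝ F ≤ (ℝ ∙ h.1)ᗮ := by
    rw [vectorSpan_def, Submodule.span_le]
    rintro _ ⟨y, hy, z, hz, rfl⟩
    rw [SetLike.mem_coe, Submodule.mem_orthogonal_singleton_iff_inner_right]
    exact (ht z hz).inner_sub (ht y hy)
  exact hu h hh (Submodule.mem_orthogonal_singleton_iff_inner_right.1 (this hmem))

theorem Irredundant.isEquiprojective (hH : Irredundant H) {k : ℕ} (hk : ConstSil k H) :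
    IsEquiprojective k (poly H) := by
  refine ⟨⟨⟨H, fun h hh => hH.ne_zero hh, rfl⟩, hH.interior_nonempty⟩, fun u hu0 hu => ?_⟩
  have hgen : ∀ g ∈ H, ⟪g.1, u⟫_ℝ ≠ 0 := by
    intro g hg h0
    obtain ⟨hF, hspan⟩ := hH.isFace hg
    refine hu _ hF ?_
    rw [hspan, Submodule.mem_orthogonal_singleton_iff_inner_right]
    exact h0
  exact (hH.isPolygon_shadow_iff hu0 hgen).2 (hk u hgen)

theorem exists_strict (hne : ∀ h ∈ H, h.1 ≠ 0) (hint : (interior (poly H)).Nonempty) :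
    ∃ x, ∀ h ∈ H, ⟪h.1, x⟫_ℝ < h.2 := by
  obtain ⟨x, hx⟩ := hint
  refine ⟨x, fun h hh => ?_⟩
  obtain ⟨ε, hε, hball⟩ := Metric.mem_nhds_iff.1 (mem_interior_iff_mem_nhds.1 hx)
  have hpos : 0 < ‖h.1‖ := norm_pos_iff.2 (hne h hh)
  have hmem : x + (ε / (2 * ‖h.1‖)) • h.1 ∈ poly H := by
    apply hball
    rw [Metric.mem_ball, dist_self_add_left, norm_smul, Real.norm_of_nonneg (by positivity)]
    field_simp
    linarith
  have := hmem h hh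
  rw [inner_add_smul, real_inner_self_eq_norm_sq] at this
  have h2 : 0 < ε / (2 * ‖h.1‖) * ‖h.1‖ ^ 2 := by positivity
  linarith

/-- A polyhedron that has a bounded shadow in every direction not parallel to a face is bounded. -/
theorem isBounded_of_shadow (hne : ∀ h ∈ H, h.1 ≠ 0)
    (hb : ∀ u : E3, u ≠ 0 → (∀ g ∈ H, ⟪g.1, u⟫_ℝ ≠ 0) →
      Bornology.IsBounded (shadow u (poly H))) : Bornology.IsBounded (poly H) := by
  obtain ⟨e, he, -⟩ := exists_ne_zero_orthogonal 0 0
  obtain ⟨u₀, hu₀e, hu₀⟩ := exists_generic (H := H) he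
  obtain ⟨u, hu⟩ : Realizable H (lex (dir u₀) (dir e)) :=
    (realizable_dir u₀).lex (realizable_dir e)
  have hgen : ∀ g ∈ H, ⟪g.1, u⟫_ℝ ≠ 0 := by
    intro g hg h0
    have h1 := hu g hg
    rw [h0, sign_zero, sign_eq_zero_iff] at h1
    by_cases h2 : dir u₀ g = 0
    · rw [lex_of_eq h2] at h1
      refine hu₀ g hg (fun c hc => ?_) h2
      rw [dir, hc, real_inner_smul_left] at h1
      rcases mul_eq_zero.1 h1 with rfl | h3
      · exact hne g hg (by simpa using hc)
      · exact he (inner_self_eq_zero.1 h3)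
    · exact h2 (by rwa [lex_of_ne h2] at h1)
  rcases H.eq_empty_or_nonempty with rfl | ⟨f, hf⟩
  · -- without constraints the shadow in the direction `e` is a whole plane
    exfalso
    obtain ⟨r, hr, her, -⟩ := exists_ne_zero_orthogonal e 0
    have hb' := hb e he (by simp)
    obtain ⟨R, hR⟩ := isBounded_iff_forall_norm_le.1 hb'
    have hmem : ((R + 1) / ‖r‖) • r ∈ shadow e (poly ∅) := by
      refine ⟨((R + 1) / ‖r‖) • r, by simp [poly], ?_⟩
      rw [Submodule.starProjection_eq_self_iff,
        Submodule.mem_orthogonal_singleton_iff_inner_right, inner_smul_right, her, mul_zero]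
    have h1 := hR _ hmem
    have hpos : 0 < ‖r‖ := norm_pos_iff.2 hr
    rw [norm_smul, norm_div, norm_norm, div_mul_cancel₀ _ hpos.ne', Real.norm_eq_abs] at h1
    linarith [le_abs_self (R + 1)]
  have hu0 : u ≠ 0 := fun h0 => hgen f hf (by rw [h0, inner_zero_right])
  obtain ⟨z, hz0, huz, -⟩ := exists_ne_zero_orthogonal u 0
  obtain ⟨δ, hδ, hδH⟩ := exists_perturb H u z
  have hgen2 : ∀ g ∈ H, ⟪g.1, u + δ • z⟫_ℝ ≠ 0 := by
    intro g hg
    rcases lt_or_gt_of_ne (hgen g hg) with h | h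
    · exact ((hδH g hg).2 h).ne
    · exact ((hδH g hg).1 h).ne'
  have hu20 : u + δ • z ≠ 0 := fun h0 => hgen2 f hf (by rw [h0, inner_zero_right])
  -- the pair of projections along two independent directions is injective
  set L : E3 →ₗ[ℝ] E3 × E3 := (ℝ ∙ u)ᗮ.starProjection.toLinearMap.prod
    (ℝ ∙ (u + δ • z))ᗮ.starProjection.toLinearMap with hL
  have hker : LinearMap.ker L = ⊥ := by
    rw [LinearMap.ker_eq_bot']
    intro x hx
    obtain ⟨h1, h2⟩ := Prod.mk.inj hx
    have h1' : (ℝ ∙ u)ᗮ.starProjection 0 = (ℝ ∙ u)ᗮ.starProjection x :=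
      (map_zero _).trans h1.symm
    have h2' : (ℝ ∙ (u + δ • z))ᗮ.starProjection 0 = (ℝ ∙ (u + δ • z))ᗮ.starProjection x :=
      (map_zero _).trans h2.symm
    obtain ⟨s, hs⟩ := starProjection_eq_iff.1 h1'
    obtain ⟨t, ht⟩ := starProjection_eq_iff.1 h2'
    rw [zero_add] at hs ht
    have h3 : ⟪z, x⟫_ℝ = 0 := by rw [hs, inner_smul_right, real_inner_comm, huz, mul_zero]
    rw [ht, inner_smul_right, inner_add_smul, real_inner_comm, huz, zero_add] at h3
    have h4 : ⟪z, z⟫_ℝ ≠ 0 := inner_self_ne_zero.2 hz0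
    have h5 : t = 0 := (mul_eq_zero.1 h3).resolve_right (mul_ne_zero hδ.ne' h4)
    rw [ht, h5, zero_smul]
  obtain ⟨K, -, hK⟩ := L.exists_antilipschitzWith hker
  refine (hK.isBounded_preimage ((hb u hu0 hgen).prod (hb _ hu20 hgen2))).subset ?_
  intro x hx
  exact ⟨⟨x, hx, rfl⟩, ⟨x, hx, rfl⟩⟩

theorem IsPolygon.isBounded {k : ℕ} {Q : Set E3} (hQ : IsPolygon k Q) :
    Bornology.IsBounded Q := by
  obtain ⟨V, -, -, rfl, -⟩ := hQ
  exact (V.finite_toSet.isCompact_convexHull ℝ).isBounded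

/-- An equiprojective polyhedron is described by an irredundant system of half-spaces with a
constant number of silhouette vertices. -/
theorem IsEquiprojective.exists_irredundant {k : ℕ} {P : Set E3} (hP : IsEquiprojective k P) :
    ∃ H : Finset (E3 × ℝ), Irredundant H ∧ P = poly H ∧ ConstSil k H := by
  classical
  obtain ⟨⟨hex, hint⟩, hk⟩ := hP
  obtain ⟨H, ⟨hne, hPH⟩, hmin⟩ : ∃ H : Finset (E3 × ℝ), ((∀ h ∈ H, h.1 ≠ 0) ∧ P = poly H) ∧
      ∀ K : Finset (E3 × ℝ), ((∀ h ∈ K, h.1 ≠ 0) ∧ P = poly K) → H.card ≤ K.card := by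
    obtain ⟨H, hH, hmin⟩ := (measure Finset.card).wf.has_min
      {H : Finset (E3 × ℝ) | (∀ h ∈ H, h.1 ≠ 0) ∧ P = poly H} hex
    exact ⟨H, hH, fun K hK => not_lt.1 (hmin K hK)⟩
  subst hPH
  have hstrict := exists_strict hne hint
  have hpoly : ∀ u : E3, u ≠ 0 → (∀ g ∈ H, ⟪g.1, u⟫_ℝ ≠ 0) → IsPolygon k (shadow u (poly H)) :=
    fun u hu0 hu => hk u hu0 fun F hF => notMem_vectorSpan_of_isFace hint hF hu
  have hH : Irredundant H := by
    refine ⟨isBounded_of_shadow hne fun u hu0 hu => (hpoly u hu0 hu).isBounded, hstrict, ?_⟩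
    intro h hh
    obtain ⟨y, hy, hyh⟩ : ∃ y ∈ poly (H.erase h), y ∉ poly H := by
      by_contra! hcon
      have heq : poly H = poly (H.erase h) :=
        Set.Subset.antisymm (fun x hx g hg => hx g (Finset.mem_of_mem_erase hg)) hcon
      have := hmin (H.erase h) ⟨fun g hg => hne g (Finset.mem_of_mem_erase hg), heq⟩
      exact absurd (Finset.card_erase_lt_of_mem hh) (not_lt.2 this)
    have hyh' : h.2 < ⟪h.1, y⟫_ℝ := by
      by_contra! hcon
      refine hyh fun g hg => ?_
      rcases eq_or_ne g h with rfl | hgh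
      · exact hcon
      · exact hy g (Finset.mem_erase.2 ⟨hgh, hg⟩)
    obtain ⟨z, hz⟩ := hstrict
    have hzh := hz h hh
    set D := ⟪h.1, y⟫_ℝ - ⟪h.1, z⟫_ℝ with hD
    have hDpos : 0 < D := by linarith
    -- the point of the segment from `z` to `y` on the bounding plane of `h`
    refine ⟨z + ((h.2 - ⟪h.1, z⟫_ℝ) / D) • (y - z), ?_, fun g hg hgh => ?_⟩
    · rw [Tight, inner_add_smul, inner_sub_right, ← hD, div_mul_cancel₀ _ hDpos.ne']
      ring
    · have h1 := hz g hg
      have h2 := hy g (Finset.mem_erase.2 ⟨hgh, hg⟩)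
      have ht0 : 0 ≤ (h.2 - ⟪h.1, z⟫_ℝ) / D := by
        apply div_nonneg <;> linarith
      have ht1 : (h.2 - ⟪h.1, z⟫_ℝ) / D < 1 := by
        rw [div_lt_one hDpos]
        linarith
      rw [inner_add_smul, inner_sub_right]
      nlinarith
  refine ⟨H, hH, rfl, fun u hu => ?_⟩
  obtain ⟨f, hf⟩ := hH.nonempty
  have hu0 : u ≠ 0 := fun h0 => hu f hf (by rw [h0, inner_zero_right])
  exact (hH.isPolygon_shadow_iff hu0 hu).1 (hpoly u hu0 hu)

/-! ### Edges -/

/-- Two half-spaces whose bounding planes are not parallel. -/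
def NonParallel (h g : E3 × ℝ) : Prop := ∀ c : ℝ, g.1 ≠ c • h.1

/-- Distinct faces with parallel planes lie on opposite sides. -/
theorem Irredundant.neg_of_parallel (hH : Irredundant H) {h g : E3 × ℝ} (hh : h ∈ H) (hg : g ∈ H)
    (hne : g ≠ h) {c : ℝ} (hc : g.1 = c • h.1) : c < 0 := by
  by_contra! hcon
  obtain ⟨x, hx, hxs⟩ := hH.facet h hh
  obtain ⟨y, hy, hys⟩ := hH.facet g hg
  have h1 := hxs g hg hne
  have h2 := hys h hh hne.symm
  rw [Tight] at hx hy
  rw [hc, real_inner_smul_left] at h1 hy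
  nlinarith

theorem Irredundant.nonParallel (hH : Irredundant H) {h g : E3 × ℝ} (hh : h ∈ H) (hg : g ∈ H)
    (hne : g ≠ h) {x : E3} (hx : Tight h x) (hgx : Tight g x) : NonParallel h g := by
  intro c hc
  have hneg := hH.neg_of_parallel hh hg hne hc
  obtain ⟨z, hz⟩ := hH.strict
  have h1 := hz h hh
  have h2 := hz g hg
  rw [Tight] at hx hgx
  rw [hc, real_inner_smul_left] at h2 hgx
  nlinarith

theorem Irredundant.linearIndependent (hH : Irredundant H) {h g : E3 × ℝ} (hh : h ∈ H)
    (hp : NonParallel h g) : LinearIndependent ℝ ![h.1, g.1] :=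
  (LinearIndependent.pair_iff' (hH.ne_zero hh)).2 fun c hc => hp c hc.symm

/-- `p` and `q` are the ends of the edge between the faces `h` and `g`. -/
structure IsEdge (H : Finset (E3 × ℝ)) (h g : E3 × ℝ) (p q : E3) : Prop where
  left_mem : h ∈ H
  right_mem : g ∈ H
  ne : g ≠ h
  fst_mem : p ∈ verts H
  snd_mem : q ∈ verts H
  fst_ne : p ≠ q
  left_fst : Tight h p
  left_snd : Tight h q
  right_fst : Tight g p
  right_snd : Tight g q

namespace IsEdge
variable {h g : E3 × ℝ} {p q : E3}

theorem symm (e : IsEdge H h g p q) : IsEdge H g h p q :=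
  ⟨e.right_mem, e.left_mem, e.ne.symm, e.fst_mem, e.snd_mem, e.fst_ne, e.right_fst, e.right_snd,
    e.left_fst, e.left_snd⟩

theorem rev (e : IsEdge H h g p q) : IsEdge H h g q p :=
  ⟨e.left_mem, e.right_mem, e.ne, e.snd_mem, e.fst_mem, e.fst_ne.symm, e.left_snd, e.left_fst,
    e.right_snd, e.right_fst⟩

theorem linearIndependent (e : IsEdge H h g p q) (hH : Irredundant H) :
    LinearIndependent ℝ ![h.1, g.1] :=
  hH.linearIndependent e.left_mem
    (hH.nonParallel e.left_mem e.right_mem e.ne e.left_fst e.right_fst)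

theorem sub_ne_zero (e : IsEdge H h g p q) : q - p ≠ 0 := _root_.sub_ne_zero.2 e.fst_ne.symm

theorem exists_smul (e : IsEdge H h g p q) (hH : Irredundant H) {x : E3}
    (h1 : ⟪h.1, x⟫_ℝ = 0) (h2 : ⟪g.1, x⟫_ℝ = 0) : ∃ c : ℝ, x = c • (q - p) :=
  exists_smul_of_orthogonal_pair (e.linearIndependent hH) e.sub_ne_zero
    (e.left_fst.inner_sub e.left_snd) (e.right_fst.inner_sub e.right_snd) h1 h2

/-- An edge lies on exactly two faces. -/
theorem eq_or_eq (e : IsEdge H h g p q) (hH : Irredundant H) {f : E3 × ℝ} (hf : f ∈ H)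
    (hfp : Tight f p) (hfq : Tight f q) : f = h ∨ f = g := by
  by_contra! hcon
  obtain ⟨hfh, hfg⟩ := hcon
  obtain ⟨α, β, hαβ⟩ := exists_combination_of_orthogonal (e.linearIndependent hH) e.sub_ne_zero
    (e.left_fst.inner_sub e.left_snd) (e.right_fst.inner_sub e.right_snd) (hfp.inner_sub hfq)
  have hval : f.2 = α * h.2 + β * g.2 := by
    have h1 := hfp
    have h2 := e.left_fst
    have h3 := e.right_fst
    rw [Tight] at h1 h2 h3
    rw [← h1, hαβ, inner_add_left, real_inner_smul_left, real_inner_smul_left, h2, h3]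
  -- the slack of `f` is the same combination of the slacks of `h` and `g`
  have hsl : ∀ x : E3, f.2 - ⟪f.1, x⟫_ℝ = α * (h.2 - ⟪h.1, x⟫_ℝ) + β * (g.2 - ⟪g.1, x⟫_ℝ) := by
    intro x
    rw [hval, hαβ, inner_add_left, real_inner_smul_left, real_inner_smul_left]
    ring
  obtain ⟨x, hx, hxs⟩ := hH.facet f hf
  obtain ⟨y, hy, hys⟩ := hH.facet h e.left_mem
  obtain ⟨z, hz, hzs⟩ := hH.facet g e.right_mem
  have h1 := hsl x
  have h2 := hsl y
  have h3 := hsl z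
  have hxh := hxs h e.left_mem hfh.symm
  have hxg := hxs g e.right_mem hfg.symm
  have hyf := hys f hf hfh
  have hyg := hys g e.right_mem e.ne
  have hzf := hzs f hf hfg
  have hzh := hzs h e.left_mem e.ne.symm
  rw [Tight] at hx hy hz
  rw [hx, sub_self] at h1
  rw [hy, sub_self, mul_zero, zero_add] at h2
  rw [hz, sub_self, mul_zero, add_zero] at h3
  have hβ : 0 < β := by
    by_contra! hb
    nlinarith
  have hα : 0 < α := by
    by_contra! ha
    nlinarith
  nlinarith [mul_pos hα (sub_pos.2 hxh), mul_pos hβ (sub_pos.2 hxg)]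

theorem eq_or_eq_of_inner (e : IsEdge H h g p q) (hH : Irredundant H) {f : E3 × ℝ} (hf : f ∈ H)
    (hfp : Tight f p) (hfq : ⟪f.1, q - p⟫_ℝ = 0) : f = h ∨ f = g :=
  e.eq_or_eq hH hf hfp (hfp.of_inner_sub hfq)

end IsEdge

theorem not_collinear_verts {p q v : E3} (hp : p ∈ verts H) (hq : q ∈ verts H) (hv : v ∈ verts H)
    (hpq : p ≠ q) {c : ℝ} (hc : v - p = c • (q - p)) : v = p ∨ v = q := by
  have hv' : v = p + c • (q - p) := by rw [← hc]; abel
  have hpP := mem_poly_of_mem_verts hp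
  have hqP := mem_poly_of_mem_verts hq
  have hvP := mem_poly_of_mem_verts hv
  rcases lt_trichotomy c 0 with h | h | h
  · left
    refine (mem_verts.1 hp).2 hvP hqP
      ⟨1 / (1 - c), -c / (1 - c), ?_, ?_, ?_, ?_⟩
    · apply div_pos <;> linarith
    · apply div_pos <;> linarith
    · have : 1 - c ≠ 0 := by linarith
      field_simp
      ring
    · have : 1 - c ≠ 0 := by linarith
      rw [hv']
      match_scalars <;> field_simp <;> ring
  · left
    rw [hv', h, zero_smul, add_zero]
  · rcases lt_trichotomy c 1 with h1 | h1 | h1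
    · exfalso
      have e1 := (mem_verts.1 hv).2 hpP hqP ⟨1 - c, c, by linarith, h, by ring, by
        rw [hv']; match_scalars <;> ring⟩
      rw [e1, sub_self] at hc
      rcases smul_eq_zero.1 hc.symm with h2 | h2
      · exact h.ne' h2
      · exact hpq (e1.trans (sub_eq_zero.1 h2).symm)
    · right
      rw [hv', h1, one_smul, add_sub_cancel]
    · exfalso
      refine hpq ((mem_verts.1 hq).2 hpP hvP ⟨(c - 1) / c, 1 / c, ?_, ?_, ?_, ?_⟩)
      · apply div_pos <;> linarith
      · positivity
      · field_simp
        ring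
      · rw [hv']
        match_scalars
        · field_simp
          ring
        · field_simp

theorem IsEdge.eq_of_tight {h g : E3 × ℝ} {p q : E3} (e : IsEdge H h g p q) (hH : Irredundant H)
    {v : E3} (hv : v ∈ verts H) (h1 : Tight h v) (h2 : Tight g v) : v = p ∨ v = q := by
  obtain ⟨c, hc⟩ := e.exists_smul hH (e.left_fst.inner_sub h1) (e.right_fst.inner_sub h2)
  exact not_collinear_verts e.fst_mem e.snd_mem hv e.fst_ne hc

/-- A point at which a non-constant functional is maximal on a face lies on another face. -/
theorem exists_tight_of_max {h : E3 × ℝ} {x w : E3} (hx : x ∈ poly H)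
    (hhx : Tight h x) (hw0 : w ≠ 0) (hw : ⟪h.1, w⟫_ℝ = 0)
    (hmax : ∀ y ∈ poly H, Tight h y → ⟪w, y⟫_ℝ ≤ ⟪w, x⟫_ℝ) :
    ∃ g ∈ H, g ≠ h ∧ Tight g x := by
  by_contra! hcon
  obtain ⟨t, ht, hmem⟩ := exists_pos_add_smul_mem (u := w) hx (by
    intro g hg hgx
    rcases eq_or_ne g h with rfl | hne
    · exact hw.le
    · exact absurd hgx (hcon g hg hne))
  have := hmax _ hmem (hhx.add (by rw [inner_smul_right, hw, mul_zero]))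
  rw [inner_add_smul] at this
  have h2 : 0 < ⟪w, w⟫_ℝ := real_inner_self_pos.2 hw0
  have := mul_pos ht h2
  linarith

/-- Two different common points of two faces span an edge. -/
theorem Irredundant.exists_isEdge (hH : Irredundant H) {h g : E3 × ℝ} (hh : h ∈ H) (hg : g ∈ H)
    (hne : g ≠ h) {x y : E3} (hx : x ∈ poly H) (hy : y ∈ poly H) (hxy : x ≠ y)
    (hhx : Tight h x) (hhy : Tight h y) (hgx : Tight g x) (hgy : Tight g y) :
    ∃ p q, ∃ c > (0 : ℝ), IsEdge H h g p q ∧ q - p = c • (y - x) := by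
  have hG : ∀ f ∈ ({h, g} : Set (E3 × ℝ)), f ∈ H := by
    rintro f (rfl | rfl) <;> assumption
  have hTx : ∀ f ∈ ({h, g} : Set (E3 × ℝ)), Tight f x := by
    rintro f (rfl | rfl) <;> assumption
  have hTy : ∀ f ∈ ({h, g} : Set (E3 × ℝ)), Tight f y := by
    rintro f (rfl | rfl) <;> assumption
  obtain ⟨q, hq, hqT, hqm⟩ := hH.exists_vertex_max _ hG (y - x) ⟨x, hx, hTx⟩
  obtain ⟨p, hp, hpT, hpm⟩ := hH.exists_vertex_max _ hG (-(y - x)) ⟨x, hx, hTx⟩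
  have h1 := hqm y hy hTy
  have h2 := hpm x hx hTx
  rw [inner_neg_left, inner_neg_left] at h2
  have h3 : 0 < ⟪y - x, y - x⟫_ℝ := real_inner_self_pos.2 (sub_ne_zero.2 hxy.symm)
  have h4 : 0 < ⟪y - x, q - p⟫_ℝ := by
    rw [inner_sub_right] at h3 ⊢
    linarith
  have hi := hH.linearIndependent hh (hH.nonParallel hh hg hne hhx hgx)
  obtain ⟨c, hc⟩ := exists_smul_of_orthogonal_pair hi (sub_ne_zero.2 hxy.symm)
    (hhx.inner_sub hhy) (hgx.inner_sub hgy)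
    ((hpT h (by simp)).inner_sub (hqT h (by simp))) ((hpT g (by simp)).inner_sub (hqT g (by simp)))
  have hcpos : 0 < c := by
    rw [hc, inner_smul_right] at h4
    exact pos_of_mul_pos_left h4 h3.le
  refine ⟨p, q, c, hcpos, ⟨hh, hg, hne, hp, hq, ?_, hpT h (by simp), hqT h (by simp),
    hpT g (by simp), hqT g (by simp)⟩, hc⟩
  rintro rfl
  rw [sub_self, inner_zero_right] at h4
  exact h4.false

/-! ### The vertices of a face -/

theorem Irredundant.exists_inner_lt (hH : Irredundant H) {h : E3 × ℝ} (hh : h ∈ H) {w : E3}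
    (hw0 : w ≠ 0) (hw : ⟪h.1, w⟫_ℝ = 0) :
    ∃ p ∈ verts H, ∃ q ∈ verts H, Tight h p ∧ Tight h q ∧ ⟪w, p⟫_ℝ < ⟪w, q⟫_ℝ ∧
      (∀ y ∈ poly H, Tight h y → ⟪-w, y⟫_ℝ ≤ ⟪-w, p⟫_ℝ) ∧
      ∀ y ∈ poly H, Tight h y → ⟪w, y⟫_ℝ ≤ ⟪w, q⟫_ℝ := by
  obtain ⟨x, hx, hxs⟩ := hH.facet h hh
  have hxP := mem_poly_of_facet hx hxs
  have hG : ∀ f ∈ ({h} : Set (E3 × ℝ)), f ∈ H := by rintro f rfl; exact hh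
  obtain ⟨q, hq, hqT, hqm⟩ := hH.exists_vertex_max {h} hG w ⟨x, hxP, by simpa using hx⟩
  obtain ⟨p, hp, hpT, hpm⟩ := hH.exists_vertex_max {h} hG (-w) ⟨x, hxP, by simpa using hx⟩
  simp only [Set.mem_singleton_iff, forall_eq] at hqT hqm hpT hpm
  refine ⟨p, hp, q, hq, hpT, hqT, ?_, hpm, hqm⟩
  by_contra! hcon
  -- otherwise the functional is constant on the face, which contains a point on no other face
  obtain ⟨g, hg, hgh, hgx⟩ := exists_tight_of_max hxP hx hw0 hw (by
    intro y hy hhy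
    have h1 := hqm y hy hhy
    have h2 := hpm x hxP hx
    rw [inner_neg_left, inner_neg_left] at h2
    linarith)
  exact (hxs g hg hgh).ne hgx

open scoped Classical in
/-- The vertices of the face `h`. -/
noncomputable def faceVerts (H : Finset (E3 × ℝ)) (h : E3 × ℝ) : Finset E3 :=
  (verts H).filter (Tight h)

theorem mem_faceVerts {h : E3 × ℝ} {v : E3} :
    v ∈ faceVerts H h ↔ v ∈ verts H ∧ Tight h v := by
  simp [faceVerts]

theorem Irredundant.exists_inner_ne (hH : Irredundant H) {h : E3 × ℝ} (hh : h ∈ H) (p q : E3) :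
    ∃ v ∈ faceVerts H h, v ≠ p ∧ v ≠ q := by
  obtain ⟨w, hw0, hw, hwpq⟩ := exists_ne_zero_orthogonal h.1 (q - p)
  obtain ⟨a, ha, b, hb, hha, hhb, hlt, -, -⟩ := hH.exists_inner_lt hh hw0 hw
  rw [real_inner_comm, inner_sub_right] at hwpq
  by_contra! hcon
  have h1 : ∀ v ∈ faceVerts H h, ⟪w, v⟫_ℝ = ⟪w, p⟫_ℝ := by
    intro v hv
    rcases eq_or_ne v p with rfl | hvp
    · rfl
    · rw [hcon v hv hvp]
      linarith
  rw [h1 a (mem_faceVerts.2 ⟨ha, hha⟩), h1 b (mem_faceVerts.2 ⟨hb, hhb⟩)] at hlt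
  exact hlt.false

theorem Irredundant.three_le_card_faceVerts (hH : Irredundant H) {h : E3 × ℝ} (hh : h ∈ H) :
    3 ≤ (faceVerts H h).card := by
  classical
  obtain ⟨w, hw0, hw, -⟩ := exists_ne_zero_orthogonal h.1 0
  obtain ⟨a, ha, b, hb, hha, hhb, hlt, -, -⟩ := hH.exists_inner_lt hh hw0 hw
  have hab : a ≠ b := by rintro rfl; exact hlt.false
  have ha' := mem_faceVerts.2 ⟨ha, hha⟩
  have hb' := mem_faceVerts.2 ⟨hb, hhb⟩
  obtain ⟨v, hv, hva, hvb⟩ := hH.exists_inner_ne hh a b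
  rw [← Finset.card_eq_three.2 ⟨a, b, v, hab, hva.symm, hvb.symm, rfl⟩]
  refine Finset.card_le_card ?_
  intro x hx
  simp only [Finset.mem_insert, Finset.mem_singleton] at hx
  rcases hx with rfl | rfl | rfl <;> assumption

open scoped Classical in
/-- The vertices of the face `h` that lie on another face on which `σ` is positive. For a
direction `u` in the plane of `h`, these are the vertices at which `u` points out of the face. -/
noncomputable def up (H : Finset (E3 × ℝ)) (h : E3 × ℝ) (σ : E3 × ℝ → ℝ) : Finset E3 :=
  (faceVerts H h).filter fun v => ∃ g ∈ H, g ≠ h ∧ Tight g v ∧ 0 < σ g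

theorem mem_up {h : E3 × ℝ} {σ : E3 × ℝ → ℝ} {v : E3} : v ∈ up H h σ ↔
    v ∈ faceVerts H h ∧ ∃ g ∈ H, g ≠ h ∧ Tight g v ∧ 0 < σ g := by
  simp [up]

theorem mem_up_of_max (hH : Irredundant H) {h : E3 × ℝ} (hh : h ∈ H) {u w v : E3}
    (hu : ⟪h.1, u⟫_ℝ = 0) (hgen : ∀ g ∈ H, NonParallel h g → ⟪g.1, u⟫_ℝ ≠ 0)
    (hw0 : w ≠ 0) (hw : ⟪h.1, w⟫_ℝ = 0) (hwu : ⟪u, w⟫_ℝ = 0) (hv : v ∈ faceVerts H h)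
    (hmax : ∀ y ∈ poly H, Tight h y → ⟪w, y⟫_ℝ ≤ ⟪w, v⟫_ℝ) : v ∈ up H h (dir u) := by
  refine mem_up.2 ⟨hv, ?_⟩
  obtain ⟨hvV, hhv⟩ := mem_faceVerts.1 hv
  by_contra! hcon
  obtain ⟨t, ht, hmem⟩ := exists_pos_add_smul_mem (u := u) (mem_poly_of_mem_verts hvV) (by
    intro g hg hgv
    rcases eq_or_ne g h with rfl | hgh
    · exact hu.le
    · exact hcon g hg hgh hgv)
  have hm : v + (t / 2) • u ∈ poly H := by
    intro g hg
    have h1 := mem_poly_of_mem_verts hvV g hg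
    have h2 := hmem g hg
    rw [inner_add_smul] at h2 ⊢
    linarith
  obtain ⟨g, hg, hgh, hgm⟩ := exists_tight_of_max hm
    (hhv.add (by rw [inner_smul_right, hu, mul_zero])) hw0 hw (by
      intro y hy hhy
      rw [inner_add_smul, real_inner_comm u w, hwu, mul_zero, add_zero]
      exact hmax y hy hhy)
  obtain ⟨hgv, hgu⟩ := exists_tight_of_segment ht hg (mem_poly_of_mem_verts hvV) hmem hgm
  exact hgen g hg (hH.nonParallel hh hg hgh hhv hgv) hgu

theorem dir_neg (u : E3) : dir (-u) = -dir u := by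
  funext g
  exact inner_neg_right _ _

/-- In a generic direction of its plane, a face has two vertices at which the line in that
direction leaves the face both ways. -/
theorem Irredundant.exists_two_mem_up (hH : Irredundant H) {h : E3 × ℝ} (hh : h ∈ H) {u : E3}
    (hu : ⟪h.1, u⟫_ℝ = 0) (hgen : ∀ g ∈ H, NonParallel h g → ⟪g.1, u⟫_ℝ ≠ 0) :
    ∃ p ∈ faceVerts H h, ∃ q ∈ faceVerts H h, p ≠ q ∧ p ∈ up H h (dir u) ∧ p ∈ up H h (-dir u) ∧
      q ∈ up H h (dir u) ∧ q ∈ up H h (-dir u) := by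
  obtain ⟨w, hw0, hw, hwu⟩ := exists_ne_zero_orthogonal h.1 u
  obtain ⟨p, hp, q, hq, hhp, hhq, hlt, hpm, hqm⟩ := hH.exists_inner_lt hh hw0 hw
  have hp' := mem_faceVerts.2 ⟨hp, hhp⟩
  have hq' := mem_faceVerts.2 ⟨hq, hhq⟩
  have hu' : ⟪h.1, -u⟫_ℝ = 0 := by rw [inner_neg_right, hu, neg_zero]
  have hgen' : ∀ g ∈ H, NonParallel h g → ⟪g.1, -u⟫_ℝ ≠ 0 := fun g hg hp => by
    rw [inner_neg_right]
    exact neg_ne_zero.2 (hgen g hg hp)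
  have hw' : ⟪h.1, -w⟫_ℝ = 0 := by rw [inner_neg_right, hw, neg_zero]
  refine ⟨p, hp', q, hq', by rintro rfl; exact hlt.false, ?_, ?_, ?_, ?_⟩
  · exact mem_up_of_max hH hh hu hgen (neg_ne_zero.2 hw0) hw' (by simp [hwu]) hp' hpm
  · rw [← dir_neg]
    exact mem_up_of_max hH hh hu' hgen' (neg_ne_zero.2 hw0) hw' (by simp [hwu]) hp' hpm
  · exact mem_up_of_max hH hh hu hgen hw0 hw hwu hq' hqm
  · rw [← dir_neg]
    exact mem_up_of_max hH hh hu' hgen' hw0 hw (by simp [hwu]) hq' hqm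

/-! ### Passing through the plane of a face -/

theorem neg_lex (σ τ : E3 × ℝ → ℝ) : -lex σ τ = lex (-σ) (-τ) := by
  funext g
  by_cases h : σ g = 0
  · rw [Pi.neg_apply, lex_of_eq h, lex_of_eq (by simpa using h), Pi.neg_apply]
  · rw [Pi.neg_apply, lex_of_ne h, lex_of_ne (by simpa using h), Pi.neg_apply]

theorem sil_neg (σ : E3 × ℝ → ℝ) : sil H (-σ) = sil H σ := by
  ext v
  simp only [mem_sil, Pi.neg_apply, neg_pos, neg_lt_zero]
  tauto

theorem mem_sil_lex_iff {σ τ : E3 × ℝ → ℝ} {v : E3} (hv : ∀ g ∈ H, Tight g v → σ g ≠ 0) :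
    v ∈ sil H (lex σ τ) ↔ v ∈ sil H σ := by
  rw [mem_sil, mem_sil]
  refine and_congr_right fun _ => and_congr ?_ ?_ <;>
  · refine exists_congr fun g => and_congr_right fun hg => and_congr_right fun hgv => ?_
    rw [lex_of_ne (hv g hg hgv)]

open scoped Classical in
theorem filter_tight_sil {σ : E3 × ℝ → ℝ} {h : E3 × ℝ} (hh : h ∈ H) (hσ : 0 < σ h) :
    (sil H σ).filter (Tight h) = up H h (-σ) := by
  ext v
  rw [Finset.mem_filter, mem_sil, mem_up, mem_faceVerts]
  constructor
  · rintro ⟨⟨hv, -, g, hg, hgv, hneg⟩, hhv⟩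
    refine ⟨⟨hv, hhv⟩, g, hg, ?_, hgv, neg_pos.2 hneg⟩
    rintro rfl
    exact lt_asymm hσ hneg
  · rintro ⟨⟨hv, hhv⟩, g, hg, -, hgv, hneg⟩
    exact ⟨⟨hv, ⟨h, hh, hhv, hσ⟩, g, hg, hgv, neg_pos.1 hneg⟩, hhv⟩

theorem up_lex (hH : Irredundant H) {σ τ : E3 × ℝ → ℝ} {h : E3 × ℝ} (hh : h ∈ H)
    (hgen : ∀ g ∈ H, NonParallel h g → σ g ≠ 0) : up H h (lex σ τ) = up H h σ := by
  ext v
  rw [mem_up, mem_up, mem_faceVerts]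
  refine and_congr_right fun hv => exists_congr fun g => and_congr_right fun hg =>
    and_congr_right fun hgh => and_congr_right fun hgv => ?_
  rw [lex_of_ne (hgen g hg (hH.nonParallel hh hg hgh hv.2 hgv))]

theorem lex_dir_ne_zero (hH : Irredundant H) {σ : E3 × ℝ → ℝ} {h : E3 × ℝ} (hh : h ∈ H)
    (hgen : ∀ g ∈ H, NonParallel h g → σ g ≠ 0) : ∀ g ∈ H, lex σ (dir h.1) g ≠ 0 := by
  intro g hg
  by_cases h0 : σ g = 0
  · rw [lex_of_eq h0]
    have : ¬ NonParallel h g := fun hp => hgen g hg hp h0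
    rw [NonParallel] at this
    push Not at this
    obtain ⟨c, hc⟩ := this
    have hc0 : c ≠ 0 := by
      rintro rfl
      exact hH.ne_zero hg (by simpa using hc)
    rw [dir, hc, real_inner_smul_left]
    exact mul_ne_zero hc0 (inner_self_ne_zero.2 (hH.ne_zero hh))
  · rwa [lex_of_ne h0]

theorem card_sil_lex_dir {k : ℕ} (hH : Irredundant H) (hk : ConstSil k H) {σ : E3 × ℝ → ℝ}
    (hσ : Realizable H σ) {h : E3 × ℝ} (hh : h ∈ H)
    (hgen : ∀ g ∈ H, NonParallel h g → σ g ≠ 0) : (sil H (lex σ (dir h.1))).card = k :=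
  hk.card_eq (hσ.lex (realizable_dir _)) (lex_dir_ne_zero hH hh hgen)

theorem Realizable.neg {σ : E3 × ℝ → ℝ} (hσ : Realizable H σ) : Realizable H (-σ) := by
  obtain ⟨u, hu⟩ := hσ
  refine ⟨-u, fun g hg => ?_⟩
  rw [Pi.neg_apply, inner_neg_right, Left.sign_neg, Left.sign_neg, hu g hg]

/-- When the direction passes through the plane of a face without a parallel face, the numbers of
silhouette vertices on this face before and after agree. -/
theorem card_up_eq_of_unpartnered {k : ℕ} (hH : Irredundant H) (hk : ConstSil k H)
    {σ : E3 × ℝ → ℝ} (hσ : Realizable H σ) {h : E3 × ℝ} (hh : h ∈ H) (hσh : σ h = 0)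
    (hgen : ∀ g ∈ H, NonParallel h g → σ g ≠ 0) (hU : ∀ g ∈ H, g ≠ h → NonParallel h g) :
    (up H h σ).card = (up H h (-σ)).card := by
  classical
  have hpos : 0 < dir h.1 h := real_inner_self_pos.2 (hH.ne_zero hh)
  have key : ∀ σ : E3 × ℝ → ℝ, Realizable H σ → σ h = 0 →
      (∀ g ∈ H, NonParallel h g → σ g ≠ 0) →
      k = (up H h (-σ)).card + ((sil H σ).filter fun v => ¬ Tight h v).card := by
    intro σ hσ hσh hgen
    have hgen' : ∀ g ∈ H, NonParallel h g → (-σ) g ≠ 0 := fun g hg hp => neg_ne_zero.2 (hgen g hg hp)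
    rw [← card_sil_lex_dir hH hk hσ hh hgen,
      ← Finset.card_filter_add_card_filter_not (s := sil H (lex σ (dir h.1))) (Tight h),
      filter_tight_sil hh (by rwa [lex_of_eq hσh]), neg_lex, up_lex hH hh hgen']
    congr 2
    ext v
    rw [Finset.mem_filter, Finset.mem_filter]
    refine and_congr_left fun hv => mem_sil_lex_iff fun g hg hgv => hgen g hg (hU g hg ?_)
    rintro rfl
    exact hv hgv
  have h1 := key σ hσ hσh hgen
  have h2 := key (-σ) hσ.neg (by simpa using hσh) fun g hg hp => neg_ne_zero.2 (hgen g hg hp)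
  rw [sil_neg, neg_neg] at h2
  omega

open scoped Classical in
/-- Let `σ` be a direction in the common plane direction of two parallel faces `h` and `h'`. After
a small turn towards the outer normal of `h`, the silhouette contains the vertices of `h` on a
negative face, the vertices of `h'` on a positive face, and the silhouette vertices for `σ` off
the two faces. -/
theorem card_sil_of_partnered {k : ℕ} (hH : Irredundant H) (hk : ConstSil k H)
    {σ : E3 × ℝ → ℝ} (hσ : Realizable H σ) {h h' : E3 × ℝ} (hh : h ∈ H) (hh' : h' ∈ H)
    (hne : h' ≠ h) {c : ℝ} (hc : h'.1 = c • h.1) (hσh : σ h = 0)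
    (hgen : ∀ g ∈ H, NonParallel h g → σ g ≠ 0) :
    k = (up H h (-σ)).card + (up H h' σ).card +
      ((sil H σ).filter fun v => ¬ Tight h v ∧ ¬ Tight h' v).card := by
  classical
  have hcneg := hH.neg_of_parallel hh hh' hne hc
  have hpos : 0 < ⟪h.1, h.1⟫_ℝ := real_inner_self_pos.2 (hH.ne_zero hh)
  have hdir' : dir h.1 h' < 0 := by
    rw [dir, hc, real_inner_smul_left]
    exact mul_neg_of_neg_of_pos hcneg hpos
  have hpar : ∀ g ∈ H, g ≠ h → g ≠ h' → NonParallel h g := by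
    intro g hg hgh hgh' b hb
    have hb0 := hH.neg_of_parallel hh hg hgh hb
    have hlt := hH.neg_of_parallel hh' hg hgh' (c := b / c) (by
      rw [hb, hc, smul_smul, div_mul_cancel₀ _ hcneg.ne])
    exact lt_asymm hlt (div_pos_of_neg_of_neg hb0 hcneg)
  have hσh' : σ h' = 0 := by
    obtain ⟨u, hu⟩ := hσ
    have h1 := hu h hh
    rw [hσh, sign_zero, eq_comm, sign_eq_zero_iff] at h1
    rw [← sign_eq_zero_iff, hu h' hh', hc, real_inner_smul_left, h1, mul_zero, sign_zero]
  have hgen2 : ∀ g ∈ H, NonParallel h' g → σ g ≠ 0 := by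
    intro g hg hp
    have hgh : g ≠ h := by
      rintro rfl
      exact hp c⁻¹ (by rw [hc, smul_smul, inv_mul_cancel₀ hcneg.ne, one_smul])
    have hgh' : g ≠ h' := by
      rintro rfl
      exact hp 1 (by rw [one_smul])
    exact hgen g hg (hpar g hg hgh hgh')
  have hgen' : ∀ g ∈ H, NonParallel h g → (-σ) g ≠ 0 := fun g hg hp => neg_ne_zero.2 (hgen g hg hp)
  have hdisj : ∀ v, Tight h v → ¬ Tight h' v := fun v h1 h2 =>
    hH.nonParallel hh hh' hne h1 h2 c hc
  set S := sil H (lex σ (dir h.1)) with hS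
  have e1 : S.card = k := card_sil_lex_dir hH hk hσ hh hgen
  have e2 := Finset.card_filter_add_card_filter_not (s := S) (Tight h)
  have e3 := Finset.card_filter_add_card_filter_not
    (s := S.filter fun v => ¬ Tight h v) (Tight h')
  have e4 : S.filter (Tight h) = up H h (-σ) := by
    rw [hS, filter_tight_sil hh (by rwa [lex_of_eq hσh]), neg_lex, up_lex hH hh hgen']
  have e5 : (S.filter fun v => ¬ Tight h v).filter (Tight h') = up H h' σ := by
    have : (S.filter fun v => ¬ Tight h v).filter (Tight h') = S.filter (Tight h') := by
      ext v
      simp only [Finset.mem_filter]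
      exact ⟨fun h => ⟨h.1.1, h.2⟩, fun h => ⟨⟨h.1, fun h1 => hdisj v h1 h.2⟩, h.2⟩⟩
    rw [this, hS, ← sil_neg, filter_tight_sil hh' (by
      rw [Pi.neg_apply, lex_of_eq hσh']
      exact neg_pos.2 hdir'), neg_neg, up_lex hH hh' hgen2]
  have e6 : (S.filter fun v => ¬ Tight h v).filter (fun v => ¬ Tight h' v) =
      (sil H σ).filter fun v => ¬ Tight h v ∧ ¬ Tight h' v := by
    ext v
    simp only [Finset.mem_filter, and_assoc]
    refine and_congr_left fun hv => mem_sil_lex_iff fun g hg hgv => hgen g hg (hpar g hg ?_ ?_)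
    · rintro rfl
      exact hv.1 hgv
    · rintro rfl
      exact hv.2 hgv
  rw [e4] at e2
  rw [e5, e6] at e3
  omega

/-! ### Passing through the direction of an edge -/

theorem mem_up_lex_of_no_edge (hH : Irredundant H) {h : E3 × ℝ} (hh : h ∈ H) {d v : E3}
    (hd0 : d ≠ 0) (hd : ⟪h.1, d⟫_ℝ = 0) (hv : ∀ g q, IsEdge H h g v q → ⟪g.1, d⟫_ℝ ≠ 0)
    {τ : E3 × ℝ → ℝ} (τ' : E3 × ℝ → ℝ) (hup : v ∈ up H h (lex (dir d) τ)) :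
    v ∈ up H h (lex (dir d) τ') := by
  obtain ⟨hvF, g, hg, hgh, hgv, hpos⟩ := mem_up.1 hup
  obtain ⟨hvV, hhv⟩ := mem_faceVerts.1 hvF
  refine mem_up.2 ⟨hvF, ?_⟩
  by_cases h0 : dir d g = 0
  · -- the line in direction `d` supports the face at `v`, so it leaves the polyhedron there
    obtain ⟨f, hf, hfv, hfd⟩ : ∃ f ∈ H, Tight f v ∧ 0 < ⟪f.1, d⟫_ℝ := by
      by_contra! hcon
      obtain ⟨t, ht, hmem⟩ := exists_pos_add_smul_mem (mem_poly_of_mem_verts hvV) hcon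
      have htd : t • d ≠ 0 := smul_ne_zero ht.ne' hd0
      have hin : ∀ f : E3 × ℝ, ⟪f.1, d⟫_ℝ = 0 → ⟪f.1, t • d⟫_ℝ = 0 := fun f hf => by
        rw [inner_smul_right, hf, mul_zero]
      obtain ⟨p, q, c, -, e, -⟩ := hH.exists_isEdge hh hg hgh
        (mem_poly_of_mem_verts hvV) hmem (by simpa using htd) hhv (hhv.add (hin h hd)) hgv
        (hgv.add (hin g h0))
      rcases e.eq_of_tight hH hvV hhv hgv with rfl | rfl
      · exact hv g q e h0
      · exact hv g p e.rev h0
    refine ⟨f, hf, ?_, hfv, ?_⟩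
    · rintro rfl
      exact hfd.ne' hd
    · rwa [lex_of_ne (show dir d f ≠ 0 from hfd.ne')]
  · exact ⟨g, hg, hgh, hgv, by rw [lex_of_ne h0] at hpos ⊢; exact hpos⟩

namespace IsEdge
variable {h G : E3 × ℝ} {p q : E3}

theorem inner_right (e : IsEdge H h G p q) : dir (q - p) G = 0 := e.right_fst.inner_sub e.right_snd

theorem inner_left (e : IsEdge H h G p q) : dir (q - p) h = 0 := e.left_fst.inner_sub e.left_snd

theorem fst_mem_up_iff (e : IsEdge H h G p q) (hH : Irredundant H) {τ : E3 × ℝ → ℝ} :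
    p ∈ up H h (lex (dir (q - p)) τ) ↔ 0 < τ G := by
  rw [mem_up]
  constructor
  · rintro ⟨-, g, hg, hgh, hgp, hpos⟩
    have hle := inner_sub_nonpos_of_tight hg hgp (mem_poly_of_mem_verts e.snd_mem)
    rcases hle.lt_or_eq with hlt | heq
    · rw [lex_of_ne (show dir (q - p) g ≠ 0 from hlt.ne)] at hpos
      exact absurd hpos hlt.not_gt
    · rw [lex_of_eq (show dir (q - p) g = 0 from heq)] at hpos
      rcases e.eq_or_eq_of_inner hH hg hgp heq with rfl | rfl
      · exact absurd rfl hgh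
      · exact hpos
  · intro hpos
    exact ⟨mem_faceVerts.2 ⟨e.fst_mem, e.left_fst⟩, G, e.right_mem, e.ne, e.right_fst, by
      rwa [lex_of_eq e.inner_right]⟩

/-- At the end of an edge there is a face through which the edge leaves the polyhedron. -/
theorem exists_pos (e : IsEdge H h G p q) :
    ∃ g ∈ H, Tight g q ∧ 0 < ⟪g.1, q - p⟫_ℝ := by
  by_contra! hcon
  refine e.fst_ne (eq_of_mem_verts e.snd_mem (mem_poly_of_mem_verts e.fst_mem) fun g hg hgq => ?_)
  have h1 := hcon g hg hgq
  have h2 := mem_poly_of_mem_verts e.fst_mem g hg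
  refine le_antisymm h2 ?_
  rw [inner_sub_right, hgq] at h1
  linarith

theorem snd_mem_up (e : IsEdge H h G p q) {τ : E3 × ℝ → ℝ} :
    q ∈ up H h (lex (dir (q - p)) τ) := by
  obtain ⟨g, hg, hgq, hpos⟩ := e.exists_pos
  refine mem_up.2 ⟨mem_faceVerts.2 ⟨e.snd_mem, e.left_snd⟩, g, hg, ?_, hgq, ?_⟩
  · rintro rfl
    exact hpos.ne' e.inner_left
  · rwa [lex_of_ne (show dir (q - p) g ≠ 0 from hpos.ne')]

/-- If `[p, q]` is the only edge of the face `h` in its direction, then turning the direction past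
that of the edge makes `p` appear. -/
theorem card_up_eq_add_one (e : IsEdge H h G p q) (hH : Irredundant H)
    (huniq : ∀ g p' q', IsEdge H h g p' q' → ⟪g.1, q - p⟫_ℝ = 0 → g = G)
    {τ τ' : E3 × ℝ → ℝ} (hτ : 0 < τ G) (hτ' : τ' G ≤ 0) :
    (up H h (lex (dir (q - p)) τ)).card = (up H h (lex (dir (q - p)) τ')).card + 1 := by
  classical
  have hp : p ∉ up H h (lex (dir (q - p)) τ') := by
    rw [e.fst_mem_up_iff hH]
    exact hτ'.not_gt
  have hother : ∀ v, v ≠ p → ∀ τ τ' : E3 × ℝ → ℝ, v ∈ up H h (lex (dir (q - p)) τ) →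
      v ∈ up H h (lex (dir (q - p)) τ') := by
    intro v hvp τ τ' hv
    rcases eq_or_ne v q with rfl | hvq
    · exact e.snd_mem_up
    · refine mem_up_lex_of_no_edge hH e.left_mem e.sub_ne_zero e.inner_left ?_ τ' hv
      intro g w e' h0
      obtain rfl := huniq g v w e' h0
      rcases e.eq_of_tight hH e'.fst_mem e'.left_fst e'.right_fst with h | h
      · exact hvp h
      · exact hvq h
  rw [← Finset.card_insert_of_notMem hp]
  congr 1
  ext v
  rw [Finset.mem_insert]
  rcases eq_or_ne v p with rfl | hvp
  · simp [e.fst_mem_up_iff hH, hτ]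
  · simp only [hvp, false_or]
    exact ⟨hother v hvp τ τ', hother v hvp τ' τ⟩

/-- The imbalance between the two sides of a face changes by two at a direction in which it has
exactly one edge. -/
theorem imbalance (e : IsEdge H h G p q) (hH : Irredundant H)
    (huniq : ∀ g p' q', IsEdge H h g p' q' → ⟪g.1, q - p⟫_ℝ = 0 → g = G)
    {r : E3} (hr : 0 < ⟪G.1, r⟫_ℝ) :
    (up H h (lex (dir (q - p)) (dir r))).card =
      (up H h (lex (dir (q - p)) (-dir r))).card + 1 ∧
    (up H h (-lex (dir (q - p)) (-dir r))).card =
      (up H h (-lex (dir (q - p)) (dir r))).card + 1 := by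
  refine ⟨e.card_up_eq_add_one hH huniq hr (neg_nonpos.2 hr.le), ?_⟩
  rw [neg_lex, neg_lex, ← dir_neg, neg_sub, neg_neg]
  refine e.rev.card_up_eq_add_one hH ?_ hr (neg_nonpos.2 hr.le)
  intro g p' q' e' h0
  refine huniq g p' q' e' ?_
  rw [← neg_sub, inner_neg_right, h0, neg_zero]

end IsEdge

theorem up_lex_eq_of_no_edge (hH : Irredundant H) {h : E3 × ℝ} (hh : h ∈ H) {d : E3}
    (hd0 : d ≠ 0) (hd : ⟪h.1, d⟫_ℝ = 0) (hno : ∀ g p q, IsEdge H h g p q → ⟪g.1, d⟫_ℝ ≠ 0)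
    (τ τ' : E3 × ℝ → ℝ) : up H h (lex (dir d) τ) = up H h (lex (dir d) τ') := by
  ext v
  exact ⟨mem_up_lex_of_no_edge hH hh hd0 hd (fun g q => hno g v q) τ',
    mem_up_lex_of_no_edge hH hh hd0 hd (fun g q => hno g v q) τ⟩

theorem lex_dir_dir_ne_zero {h g : E3 × ℝ} {d r : E3} (hh : h.1 ≠ 0) (hd0 : d ≠ 0) (hr0 : r ≠ 0)
    (hd : ⟪h.1, d⟫_ℝ = 0) (hr : ⟪h.1, r⟫_ℝ = 0) (hdr : ⟪d, r⟫_ℝ = 0) (hp : NonParallel h g) :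
    lex (dir d) (dir r) g ≠ 0 := by
  intro h0
  by_cases h1 : dir d g = 0
  · rw [lex_of_eq h1] at h0
    obtain ⟨c, hc⟩ := exists_smul_of_orthogonal hh hd0 hr0 hd hr hdr h1 h0
    exact hp c hc
  · rw [lex_of_ne h1] at h0
    exact h1 h0

/-- A vector in the plane of `h` that is orthogonal to the edge `[p, q]` and points out of it. -/
theorem IsEdge.exists_normal {h G : E3 × ℝ} {p q : E3} (e : IsEdge H h G p q)
    (hH : Irredundant H) : ∃ r : E3, r ≠ 0 ∧ ⟪h.1, r⟫_ℝ = 0 ∧ ⟪q - p, r⟫_ℝ = 0 ∧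
      0 < ⟪G.1, r⟫_ℝ := by
  obtain ⟨r, hr0, hr, hdr⟩ := exists_ne_zero_orthogonal h.1 (q - p)
  have hG : ⟪G.1, r⟫_ℝ ≠ 0 := fun h0 => by
    obtain ⟨c, hc⟩ := exists_smul_of_orthogonal (hH.ne_zero e.left_mem) e.sub_ne_zero hr0
      e.inner_left hr hdr e.inner_right h0
    exact hH.nonParallel e.left_mem e.right_mem e.ne e.left_fst e.right_fst c hc
  rcases lt_or_gt_of_ne hG with hlt | hgt
  · exact ⟨-r, neg_ne_zero.2 hr0, by simp [hr], by rw [inner_neg_right, hdr, neg_zero],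
      by rw [inner_neg_right]; exact neg_pos.2 hlt⟩
  · exact ⟨r, hr0, hr, hdr, hgt⟩

/-- A face without a parallel face has, along with each edge, another parallel edge. -/
theorem IsEdge.exists_parallel {k : ℕ} {h G : E3 × ℝ} {p q : E3} (e : IsEdge H h G p q)
    (hH : Irredundant H) (hk : ConstSil k H) (hU : ∀ g ∈ H, g ≠ h → NonParallel h g) :
    ∃ g p' q', g ≠ G ∧ IsEdge H h g p' q' ∧ ⟪g.1, q - p⟫_ℝ = 0 := by
  by_contra! hcon
  have huniq : ∀ g p' q', IsEdge H h g p' q' → ⟪g.1, q - p⟫_ℝ = 0 → g = G := by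
    intro g p' q' e' h0
    by_contra hgG
    exact hcon g p' q' hgG e' h0
  obtain ⟨r, hr0, hr, hdr, hGr⟩ := e.exists_normal hH
  have hh := e.left_mem
  have bal : ∀ r : E3, r ≠ 0 → ⟪h.1, r⟫_ℝ = 0 → ⟪q - p, r⟫_ℝ = 0 →
      (up H h (lex (dir (q - p)) (dir r))).card = (up H h (-lex (dir (q - p)) (dir r))).card := by
    intro r hr0 hr hdr
    refine card_up_eq_of_unpartnered hH hk ((realizable_dir _).lex (realizable_dir _)) hh ?_
      (fun g hg hp => lex_dir_dir_ne_zero (hH.ne_zero hh) e.sub_ne_zero hr0 e.inner_left hr hdr hp)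
      hU
    rw [lex_of_eq e.inner_left]
    exact hr
  have b1 := bal r hr0 hr hdr
  have b2 := bal (-r) (neg_ne_zero.2 hr0) (by simp [hr]) (by rw [inner_neg_right, hdr, neg_zero])
  rw [dir_neg] at b2
  obtain ⟨i1, i2⟩ := e.imbalance hH huniq hGr
  omega

/-! ### Existence of edges -/

/-- Two vertices of a face at which a non-constant functional is maximal are joined by an edge. -/
theorem Irredundant.exists_isEdge_of_max (hH : Irredundant H) {h : E3 × ℝ} (hh : h ∈ H) {w p q : E3}
    (hw0 : w ≠ 0) (hw : ⟪h.1, w⟫_ℝ = 0) (hp : p ∈ faceVerts H h) (hq : q ∈ faceVerts H h)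
    (hpq : p ≠ q) (hmax : ∀ v ∈ faceVerts H h, ⟪w, v⟫_ℝ ≤ ⟪w, p⟫_ℝ)
    (heq : ⟪w, q⟫_ℝ = ⟪w, p⟫_ℝ) : ∃ g, IsEdge H h g p q := by
  obtain ⟨hpV, hhp⟩ := mem_faceVerts.1 hp
  obtain ⟨hqV, hhq⟩ := mem_faceVerts.1 hq
  have hpP := mem_poly_of_mem_verts hpV
  have hqP := mem_poly_of_mem_verts hqV
  have hz : (1 / 2 : ℝ) • p + (1 / 2 : ℝ) • q ∈ openSegment ℝ p q :=
    ⟨1 / 2, 1 / 2, by norm_num, by norm_num, by norm_num, rfl⟩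
  obtain ⟨v, hv, hhv, hvm⟩ := hH.exists_vertex_max {h} (by rintro f rfl; exact hh) w
    ⟨p, hpP, by simpa using hhp⟩
  simp only [Set.mem_singleton_iff, forall_eq] at hhv hvm
  have hhz : Tight h ((1 / 2 : ℝ) • p + (1 / 2 : ℝ) • q) := by
    rw [Tight] at hhp hhq ⊢
    rw [inner_add_right, inner_smul_right, inner_smul_right, hhp, hhq]
    ring
  obtain ⟨g, hg, hgh, hgz⟩ := exists_tight_of_max (convex_openSegment_mem hpP hqP hz) hhz hw0 hw (by
    intro y hy hhy
    have h1 := hvm y hy hhy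
    have h2 := hmax v (mem_faceVerts.2 ⟨hv, hhv⟩)
    rw [inner_add_right, inner_smul_right, inner_smul_right, heq]
    linarith)
  obtain ⟨hgp, hgq⟩ := hgz.of_mem_openSegment hg hpP hqP hz
  exact ⟨g, hh, hg, hgh, hpV, hqV, hpq, hhp, hhq, hgp, hgq⟩

/-- Every face has an edge: turn a supporting line at a vertex until it meets a second vertex. -/
theorem Irredundant.exists_isEdge_of_face (hH : Irredundant H) {h : E3 × ℝ} (hh : h ∈ H) :
    ∃ g p q, IsEdge H h g p q := by
  classical
  obtain ⟨w, hw0, hw, -⟩ := exists_ne_zero_orthogonal h.1 0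
  obtain ⟨-, -, p, hp, -, hhp, -, -, hpm⟩ := hH.exists_inner_lt hh hw0 hw
  have hpF := mem_faceVerts.2 ⟨hp, hhp⟩
  have hpm' : ∀ v ∈ faceVerts H h, ⟪w, v⟫_ℝ ≤ ⟪w, p⟫_ℝ := fun v hv =>
    hpm v (mem_poly_of_mem_verts (mem_faceVerts.1 hv).1) (mem_faceVerts.1 hv).2
  by_cases hex : ∃ q ∈ faceVerts H h, p ≠ q ∧ ⟪w, q⟫_ℝ = ⟪w, p⟫_ℝ
  · obtain ⟨q, hq, hpq, heq⟩ := hex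
    obtain ⟨g, e⟩ := hH.exists_isEdge_of_max hh hw0 hw hpF hq hpq hpm' heq
    exact ⟨g, p, q, e⟩
  push Not at hex
  obtain ⟨w', hw'0, hw', hww'⟩ : ∃ w' : E3, w' ≠ 0 ∧ ⟪h.1, w'⟫_ℝ = 0 ∧ ⟪w, w'⟫_ℝ = 0 ∧
      ∃ v ∈ faceVerts H h, ⟪w', p⟫_ℝ < ⟪w', v⟫_ℝ := by
    obtain ⟨w', hw'0, hw', hww'⟩ := exists_ne_zero_orthogonal h.1 w
    obtain ⟨a, ha, b, hb, hha, hhb, hlt, -, -⟩ := hH.exists_inner_lt hh hw'0 hw'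
    by_cases hbp : ⟪w', p⟫_ℝ < ⟪w', b⟫_ℝ
    · exact ⟨w', hw'0, hw', hww', b, mem_faceVerts.2 ⟨hb, hhb⟩, hbp⟩
    · refine ⟨-w', neg_ne_zero.2 hw'0, by simp [hw'], by simp [hww'], a,
        mem_faceVerts.2 ⟨ha, hha⟩, ?_⟩
      rw [inner_neg_left, inner_neg_left]
      linarith
  obtain ⟨hww', hne⟩ := hww'
  -- the angle at which the turned functional first reaches another vertex
  set T := (faceVerts H h).filter fun v => ⟪w', p⟫_ℝ < ⟪w', v⟫_ℝ
  have hTne : T.Nonempty := by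
    obtain ⟨v, hv, hlt⟩ := hne
    exact ⟨v, Finset.mem_filter.2 ⟨hv, hlt⟩⟩
  obtain ⟨q, hq, hqmin⟩ := T.exists_min_image
    (fun v => (⟪w, p⟫_ℝ - ⟪w, v⟫_ℝ) / (⟪w', v⟫_ℝ - ⟪w', p⟫_ℝ)) hTne
  obtain ⟨hqF, hqlt⟩ := Finset.mem_filter.1 hq
  set θ := (⟪w, p⟫_ℝ - ⟪w, q⟫_ℝ) / (⟪w', q⟫_ℝ - ⟪w', p⟫_ℝ)
  have hpq : p ≠ q := by rintro rfl; exact hqlt.false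
  have hθ0 : 0 ≤ θ := div_nonneg (sub_nonneg.2 (hpm' q hqF)) (sub_pos.2 hqlt).le
  have hin : ∀ v, ⟪w + θ • w', v⟫_ℝ = ⟪w, v⟫_ℝ + θ * ⟪w', v⟫_ℝ := fun v => by
    rw [inner_add_left, real_inner_smul_left]
  have hθq : θ * (⟪w', q⟫_ℝ - ⟪w', p⟫_ℝ) = ⟪w, p⟫_ℝ - ⟪w, q⟫_ℝ :=
    div_mul_cancel₀ _ (sub_pos.2 hqlt).ne'
  obtain ⟨g, e⟩ := hH.exists_isEdge_of_max (w := w + θ • w') hh (by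
      intro h0
      have h1 : ⟪w + θ • w', w⟫_ℝ = 0 := by rw [h0, inner_zero_left]
      rw [hin, real_inner_comm w w', hww', mul_zero, add_zero] at h1
      exact hw0 (inner_self_eq_zero.1 h1)) (by rw [inner_add_smul, hw, hw', mul_zero, add_zero])
    hpF hqF hpq (by
      intro v hv
      rw [hin, hin]
      by_cases hvT : ⟪w', p⟫_ℝ < ⟪w', v⟫_ℝ
      · have := hqmin v (Finset.mem_filter.2 ⟨hv, hvT⟩)
        rw [le_div_iff₀ (sub_pos.2 hvT)] at this
        linarith
      · have h1 := hpm' v hv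
        have := mul_nonneg hθ0 (sub_nonneg.2 (not_lt.1 hvT))
        linarith) (by
      rw [hin, hin]
      linarith)
  exact ⟨g, p, q, e⟩

/-! ### Edges in a common direction -/

namespace IsEdge
variable {h g G : E3 × ℝ} {p q d : E3}

/-- An edge parallel to `d` can be oriented in the direction `d`. -/
theorem exists_oriented (e : IsEdge H h g p q) (hH : Irredundant H)
    (hd0 : d ≠ 0) (hh : ⟪h.1, d⟫_ℝ = 0) (hg : ⟪g.1, d⟫_ℝ = 0) :
    ∃ p' q', ∃ c > (0 : ℝ), IsEdge H h g p' q' ∧ q' - p' = c • d := by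
  obtain ⟨c, hc⟩ := e.exists_smul hH hh hg
  have hc0 : c ≠ 0 := by
    rintro rfl
    rw [zero_smul] at hc
    exact hd0 hc
  have hc' : q - p = c⁻¹ • d := by rw [hc, smul_smul, inv_mul_cancel₀ hc0, one_smul]
  rcases lt_or_gt_of_ne hc0 with hlt | hgt
  · refine ⟨q, p, -c⁻¹, neg_pos.2 (inv_lt_zero.2 hlt), e.rev, ?_⟩
    rw [neg_smul, ← hc', neg_sub]
  · exact ⟨p, q, c⁻¹, inv_pos.2 hgt, e, hc'⟩

theorem exists_parallel_oriented {k : ℕ} (e : IsEdge H h G p q)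
    (hH : Irredundant H) (hk : ConstSil k H) (hU : ∀ g ∈ H, g ≠ h → NonParallel h g) :
    ∃ g p' q', ∃ c > (0 : ℝ), g ≠ G ∧ IsEdge H h g p' q' ∧ q' - p' = c • (q - p) := by
  obtain ⟨g, a, b, hgG, e', h0⟩ := e.exists_parallel hH hk hU
  obtain ⟨p', q', c, hc, e'', hc'⟩ := e'.exists_oriented hH e.sub_ne_zero e.inner_left h0
  exact ⟨g, p', q', c, hc, hgG, e'', hc'⟩

theorem inner_eq_zero_of_smul (e : IsEdge H h g p q) {c : ℝ} (hc : 0 < c) (hd : q - p = c • d) :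
    ⟪h.1, d⟫_ℝ = 0 ∧ ⟪g.1, d⟫_ℝ = 0 := by
  have h1 := e.inner_left
  have h2 := e.inner_right
  rw [dir, hd, inner_smul_right] at h1 h2
  exact ⟨(mul_eq_zero.1 h1).resolve_left hc.ne', (mul_eq_zero.1 h2).resolve_left hc.ne'⟩

end IsEdge

open scoped Classical in
/-- The faces parallel to `d` that contain `v`. At an end of an edge in direction `d` these are the
two faces at the edge, so the label tells which edge in direction `d` a vertex belongs to. -/
noncomputable def label (H : Finset (E3 × ℝ)) (d v : E3) : Finset (E3 × ℝ) :=
  H.filter fun f => Tight f v ∧ ⟪f.1, d⟫_ℝ = 0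

theorem mem_label {d v : E3} {f : E3 × ℝ} :
    f ∈ label H d v ↔ f ∈ H ∧ Tight f v ∧ ⟪f.1, d⟫_ℝ = 0 := by
  simp [label]

open scoped Classical in
theorem IsEdge.label_fst {h g : E3 × ℝ} {p q d : E3} (e : IsEdge H h g p q) (hH : Irredundant H)
    {c : ℝ} (hc : c ≠ 0) (hd : q - p = c • d) : label H d p = {h, g} := by
  have key : ∀ f : E3 × ℝ, ⟪f.1, d⟫_ℝ = 0 ↔ ⟪f.1, q - p⟫_ℝ = 0 := fun f => by
    rw [hd, inner_smul_right, mul_eq_zero, or_iff_right hc]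
  ext f
  rw [mem_label, key, Finset.mem_insert, Finset.mem_singleton]
  constructor
  · rintro ⟨hf, hfp, h0⟩
    exact e.eq_or_eq_of_inner hH hf hfp h0
  · rintro (rfl | rfl)
    · exact ⟨e.left_mem, e.left_fst, e.inner_left⟩
    · exact ⟨e.right_mem, e.right_fst, e.inner_right⟩

open scoped Classical in
theorem IsEdge.label_snd {h g : E3 × ℝ} {p q d : E3} (e : IsEdge H h g p q) (hH : Irredundant H)
    {c : ℝ} (hc : c ≠ 0) (hd : q - p = c • d) : label H d q = {h, g} :=
  e.rev.label_fst hH (neg_ne_zero.2 hc) (by rw [neg_smul, ← hd, neg_sub])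

namespace IsEdge
variable {h g : E3 × ℝ} {p q d : E3} {c : ℝ} {τ : E3 × ℝ → ℝ}

theorem fst_mem_sil (e : IsEdge H h g p q) (hc : 0 < c) (hd : q - p = c • d)
    (hτ : 0 < τ h ∨ 0 < τ g) : p ∈ sil H (lex (dir d) τ) := by
  obtain ⟨hhd, hgd⟩ := e.inner_eq_zero_of_smul hc hd
  refine mem_sil.2 ⟨e.fst_mem, ?_, ?_⟩
  · rcases hτ with hτ | hτ
    · exact ⟨h, e.left_mem, e.left_fst, by rwa [lex_of_eq hhd]⟩
    · exact ⟨g, e.right_mem, e.right_fst, by rwa [lex_of_eq hgd]⟩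
  · obtain ⟨f, hf, hfp, hpos⟩ := e.rev.exists_pos
    have hneg : ⟪f.1, d⟫_ℝ < 0 := by
      rw [← neg_sub, hd, inner_neg_right, inner_smul_right] at hpos
      by_contra! hcon
      have := mul_nonneg hc.le hcon
      linarith
    exact ⟨f, hf, hfp, by rwa [lex_of_ne (show dir d f ≠ 0 from hneg.ne)]⟩

theorem snd_mem_sil (e : IsEdge H h g p q) (hc : 0 < c) (hd : q - p = c • d)
    (hτ : τ h < 0 ∨ τ g < 0) : q ∈ sil H (lex (dir d) τ) := by
  rw [← sil_neg, neg_lex, ← dir_neg]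
  refine e.rev.fst_mem_sil hc (by rw [smul_neg, ← hd, neg_sub]) ?_
  simpa only [Pi.neg_apply, neg_pos] using hτ

open scoped Classical in
/-- Every edge in direction `d` contains a silhouette vertex for directions close to `d`. -/
theorem one_le_card_filter (e : IsEdge H h g p q) (hH : Irredundant H) (hc : 0 < c)
    (hd : q - p = c • d) (hτ : τ h ≠ 0) :
    1 ≤ ((sil H (lex (dir d) τ)).filter fun v => label H d v = {h, g}).card := by
  rw [Nat.one_le_iff_ne_zero, ← Nat.pos_iff_ne_zero, Finset.card_pos]
  rcases lt_or_gt_of_ne hτ with hlt | hgt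
  · exact ⟨q, Finset.mem_filter.2 ⟨e.snd_mem_sil hc hd (Or.inl hlt), e.label_snd hH hc.ne' hd⟩⟩
  · exact ⟨p, Finset.mem_filter.2 ⟨e.fst_mem_sil hc hd (Or.inl hgt), e.label_fst hH hc.ne' hd⟩⟩

open scoped Classical in
/-- An edge in direction `d` between faces of opposite signs contributes both of its ends to the
silhouette for directions close to `d`. -/
theorem two_le_card_filter (e : IsEdge H h g p q) (hH : Irredundant H) (hc : 0 < c)
    (hd : q - p = c • d) (hτ : τ h * τ g < 0) :
    2 ≤ ((sil H (lex (dir d) τ)).filter fun v => label H d v = {h, g}).card := by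
  have h1 : (0 < τ h ∨ 0 < τ g) ∧ (τ h < 0 ∨ τ g < 0) := by
    rcases mul_neg_iff.1 hτ with ⟨h1, h2⟩ | ⟨h1, h2⟩
    · exact ⟨Or.inl h1, Or.inr h2⟩
    · exact ⟨Or.inr h2, Or.inl h1⟩
  refine Finset.one_lt_card.2 ⟨p, ?_, q, ?_, e.fst_ne⟩
  · exact Finset.mem_filter.2 ⟨e.fst_mem_sil hc hd h1.1, e.label_fst hH hc.ne' hd⟩
  · exact Finset.mem_filter.2 ⟨e.snd_mem_sil hc hd h1.2, e.label_snd hH hc.ne' hd⟩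

/-- Near the direction of an edge there is a generic direction that separates the two faces at
the edge. -/
theorem exists_separating (e : IsEdge H h g p q) (hH : Irredundant H) :
    ∃ τ : E3 × ℝ → ℝ, Realizable H τ ∧ 0 < τ h ∧ τ g < 0 ∧
      ∀ f ∈ H, ⟪f.1, q - p⟫_ℝ = 0 → τ f ≠ 0 := by
  obtain ⟨r, -, hr, -, hgr⟩ := e.exists_normal hH
  obtain ⟨s, -, hs, -, hhs⟩ := e.symm.exists_normal hH
  have h1 : dir (s - r) h = ⟪h.1, s⟫_ℝ := by rw [dir, inner_sub_right, hr, sub_zero]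
  have h2 : dir (s - r) g = -⟪g.1, r⟫_ℝ := by rw [dir, inner_sub_right, hs, zero_sub]
  have h1' : 0 < dir (s - r) h := by rwa [h1]
  have h2' : dir (s - r) g < 0 := by rw [h2]; exact neg_lt_zero.2 hgr
  refine ⟨lex (dir (s - r)) (dir r), (realizable_dir _).lex (realizable_dir _),
    by rwa [lex_of_ne h1'.ne'], by rwa [lex_of_ne h2'.ne], fun f hf hfd h0 => ?_⟩
  obtain ⟨α, β, hαβ⟩ := exists_combination_of_orthogonal (e.linearIndependent hH) e.sub_ne_zero
    e.inner_left e.inner_right hfd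
  have hval : ∀ x, ⟪f.1, x⟫_ℝ = α * ⟪h.1, x⟫_ℝ + β * ⟪g.1, x⟫_ℝ := fun x => by
    rw [hαβ, inner_add_left, real_inner_smul_left, real_inner_smul_left]
  by_cases hf0 : dir (s - r) f = 0
  · rw [lex_of_eq hf0, dir, hval, hr, mul_zero, zero_add] at h0
    have hβ : β = 0 := (mul_eq_zero.1 h0).resolve_right hgr.ne'
    rw [dir, hval, hβ, zero_mul, add_zero] at hf0
    have hα : α = 0 := (mul_eq_zero.1 hf0).resolve_right h1'.ne'
    refine hH.ne_zero hf ?_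
    rw [hαβ, hα, hβ, zero_smul, zero_smul, add_zero]
  · rw [lex_of_ne hf0] at h0
    exact hf0 h0

end IsEdge

/-! ### Polyhedra without parallel faces -/

theorem sum_card_filter_le {α β : Type*} [DecidableEq β] (s : Finset α) (f : α → β)
    (t : Finset β) : ∑ b ∈ t, (s.filter fun a => f a = b).card ≤ s.card := by
  have h := Finset.card_eq_sum_card_fiberwise (f := f) (s := s.filter fun a => f a ∈ t) (t := t)
    fun a ha => (Finset.mem_filter.1 ha).2
  refine le_trans (le_of_eq ?_) (Finset.card_filter_le s fun a => f a ∈ t)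
  rw [h]
  refine Finset.sum_congr rfl fun b hb => congrArg _ ?_
  ext a
  simp only [Finset.mem_filter]
  exact ⟨fun h => ⟨⟨h.1, h.2 ▸ hb⟩, h.2⟩, fun h => ⟨h.1.1, h.2⟩⟩

/-- Three parallel edges `[p, q]`, `[p₁, q₁]` and `[p₂, q₂]` pairwise joining the faces `h`, `G` and
`g`, oriented alike; `c₁` and `c₂` are the ratios of their lengths to that of `[p, q]`. -/
structure IsZone (H : Finset (E3 × ℝ)) (h G g : E3 × ℝ) (p q p₁ q₁ p₂ q₂ : E3) (c₁ c₂ : ℝ) :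
    Prop where
  ne_left : g ≠ h
  ne_right : g ≠ G
  edge : IsEdge H h G p q
  edge₁ : IsEdge H h g p₁ q₁
  edge₂ : IsEdge H G g p₂ q₂
  pos₁ : 0 < c₁
  pos₂ : 0 < c₂
  sub₁ : q₁ - p₁ = c₁ • (q - p)
  sub₂ : q₂ - p₂ = c₂ • (q - p)

namespace IsZone
variable {h G g : E3 × ℝ} {p q p₁ q₁ p₂ q₂ : E3} {c₁ c₂ : ℝ}

theorem symm (z : IsZone H h G g p q p₁ q₁ p₂ q₂ c₁ c₂) :
    IsZone H G h g p q p₂ q₂ p₁ q₁ c₂ c₁ :=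
  ⟨z.ne_right, z.ne_left, z.edge.symm, z.edge₂, z.edge₁, z.pos₂, z.pos₁, z.sub₂, z.sub₁⟩

open scoped Classical in
theorem pairwise_ne (z : IsZone H h G g p q p₁ q₁ p₂ q₂ c₁ c₂) :
    ({h, G} : Finset (E3 × ℝ)) ≠ {h, g} ∧ ({h, G} : Finset (E3 × ℝ)) ≠ {G, g} ∧
      ({h, g} : Finset (E3 × ℝ)) ≠ {G, g} := by
  have h1 := z.ne_left
  have h2 := z.ne_right
  have h3 := z.edge.ne
  refine ⟨fun h0 => ?_, fun h0 => ?_, fun h0 => ?_⟩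
  · have := h0 ▸ Finset.mem_insert_of_mem (Finset.mem_singleton_self G)
    simp only [Finset.mem_insert, Finset.mem_singleton] at this
    exact this.elim h3 h2.symm
  · have := h0 ▸ Finset.mem_insert_self h {G}
    simp only [Finset.mem_insert, Finset.mem_singleton] at this
    exact this.elim h3.symm h1.symm
  · have := h0 ▸ Finset.mem_insert_self h {g}
    simp only [Finset.mem_insert, Finset.mem_singleton] at this
    exact this.elim h3.symm h1.symm

open scoped Classical in
/-- Near the direction of the three edges, their ends contribute at least five silhouette
vertices. -/
theorem five_le (z : IsZone H h G g p q p₁ q₁ p₂ q₂ c₁ c₂) (hH : Irredundant H)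
    {τ : E3 × ℝ → ℝ} (hτ : τ h * τ G < 0) (hg : τ g ≠ 0) :
    5 ≤ ∑ ℓ ∈ ({{h, G}, {h, g}, {G, g}} : Finset (Finset (E3 × ℝ))),
      ((sil H (lex (dir (q - p)) τ)).filter fun v => label H (q - p) v = ℓ).card := by
  obtain ⟨n1, n2, n3⟩ := z.pairwise_ne
  rw [Finset.sum_insert (by simp [n1, n2]), Finset.sum_insert (by simp [n3]), Finset.sum_singleton]
  have hh0 : τ h ≠ 0 := left_ne_zero_of_mul hτ.ne
  have hG0 : τ G ≠ 0 := right_ne_zero_of_mul hτ.ne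
  have e0 := z.edge.two_le_card_filter hH one_pos (one_smul ℝ (q - p)).symm hτ
  have e1 := z.edge₁.one_le_card_filter hH z.pos₁ z.sub₁ hh0
  have e2 := z.edge₂.one_le_card_filter hH z.pos₂ z.sub₂ hG0
  have hor : τ h * τ g < 0 ∨ τ G * τ g < 0 := by
    rcases mul_neg_iff.1 hτ with ⟨a, b⟩ | ⟨a, b⟩ <;> rcases lt_or_gt_of_ne hg with hlt | hgt
    · exact Or.inl (mul_neg_of_pos_of_neg a hlt)
    · exact Or.inr (mul_neg_of_neg_of_pos b hgt)
    · exact Or.inr (mul_neg_of_pos_of_neg b hlt)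
    · exact Or.inl (mul_neg_of_neg_of_pos a hgt)
  rcases hor with hlt | hlt
  · have e3 := z.edge₁.two_le_card_filter hH z.pos₁ z.sub₁ hlt
    omega
  · have e3 := z.edge₂.two_le_card_filter hH z.pos₂ z.sub₂ hlt
    omega

end IsZone

theorem lex_ne_zero {σ τ : E3 × ℝ → ℝ} (h : ∀ g ∈ H, σ g = 0 → τ g ≠ 0) :
    ∀ g ∈ H, lex σ τ g ≠ 0 := by
  intro g hg
  by_cases h0 : σ g = 0
  · rw [lex_of_eq h0]
    exact h g hg h0
  · rwa [lex_of_ne h0]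

/-- In a polyhedron without parallel faces, the faces parallel to an edge form a zone with three
edges, or there are at least six silhouette vertices. -/
theorem IsEdge.exists_isZone {k : ℕ} {h G : E3 × ℝ} {p q : E3} (e : IsEdge H h G p q)
    (hH : Irredundant H) (hk : ConstSil k H)
    (hU : ∀ h ∈ H, ∀ g ∈ H, g ≠ h → NonParallel h g) :
    (∃ g p₁ q₁ p₂ q₂ c₁ c₂, IsZone H h G g p q p₁ q₁ p₂ q₂ c₁ c₂) ∨ 6 ≤ k := by
  classical
  obtain ⟨g₁, p₁, q₁, c₁, hc₁, hne₁, e₁, hs₁⟩ :=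
    e.exists_parallel_oriented hH hk (hU h e.left_mem)
  obtain ⟨g₂, p₂, q₂, c₂, hc₂, hne₂, e₂, hs₂⟩ :=
    e.symm.exists_parallel_oriented hH hk (hU G e.right_mem)
  by_cases h12 : g₁ = g₂
  · subst h12
    exact Or.inl ⟨g₁, p₁, q₁, p₂, q₂, c₁, c₂, ⟨e₁.ne, hne₁, e, e₁, e₂, hc₁, hc₂, hs₁, hs₂⟩⟩
  right
  -- otherwise the chain `g₁, h, G, g₂` of faces goes on at both ends
  obtain ⟨g₃, p₃, q₃, c₃, hc₃, hne₃, e₃, hs₃⟩ :=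
    e₁.symm.exists_parallel_oriented hH hk (hU g₁ e₁.right_mem)
  obtain ⟨g₄, p₄, q₄, c₄, hc₄, hne₄, e₄, hs₄⟩ :=
    e₂.symm.exists_parallel_oriented hH hk (hU g₂ e₂.right_mem)
  rw [hs₁, smul_smul] at hs₃
  rw [hs₂, smul_smul] at hs₄
  obtain ⟨τ, hτ, hτh, hτG, hτ0⟩ := e.exists_separating hH
  have hcard := hk.card_eq ((realizable_dir (q - p)).lex hτ) (lex_ne_zero hτ0)
  have z1 := hτ0 g₁ e₁.right_mem (e₁.inner_eq_zero_of_smul hc₁ hs₁).2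
  have z2 := hτ0 g₂ e₂.right_mem (e₂.inner_eq_zero_of_smul hc₂ hs₂).2
  have f0 := e.two_le_card_filter hH one_pos (one_smul ℝ (q - p)).symm
    (mul_neg_of_pos_of_neg hτh hτG)
  have f1 := e₁.one_le_card_filter hH hc₁ hs₁ hτh.ne'
  have f2 := e₂.one_le_card_filter hH hc₂ hs₂ hτG.ne
  have f3 := e₃.one_le_card_filter hH (mul_pos hc₃ hc₁) hs₃ z1
  have f4 := e₄.one_le_card_filter hH (mul_pos hc₄ hc₂) hs₄ z2
  have n0 := e.ne
  have n1 := e₁.ne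
  have n2 := e₂.ne
  have n3 := e₃.ne
  have n4 := e₄.ne
  have pair : ∀ {a b c d : E3 × ℝ}, ({a, b} : Finset (E3 × ℝ)) = {c, d} →
      (a = c ∨ a = d) ∧ (b = c ∨ b = d) ∧ (c = a ∨ c = b) ∧ (d = a ∨ d = b) := by
    intro a b c d h
    have h1 : a ∈ ({c, d} : Finset (E3 × ℝ)) := h ▸ by simp
    have h2 : b ∈ ({c, d} : Finset (E3 × ℝ)) := h ▸ by simp
    have h3 : c ∈ ({a, b} : Finset (E3 × ℝ)) := h ▸ by simp
    have h4 : d ∈ ({a, b} : Finset (E3 × ℝ)) := h ▸ by simp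
    simpa using And.intro h1 (And.intro h2 (And.intro h3 h4))
  have m01 : ({h, G} : Finset (E3 × ℝ)) ≠ {h, g₁} := fun h0 => by
    obtain ⟨-, -, -, h | h⟩ := pair h0
    exacts [n1 h, hne₁ h]
  have m02 : ({h, G} : Finset (E3 × ℝ)) ≠ {G, g₂} := fun h0 => by
    obtain ⟨-, -, -, h | h⟩ := pair h0
    exacts [hne₂ h, n2 h]
  have m03 : ({h, G} : Finset (E3 × ℝ)) ≠ {g₁, g₃} := fun h0 => by
    obtain ⟨-, -, h | h, -⟩ := pair h0
    exacts [n1 h, hne₁ h]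
  have m12 : ({h, g₁} : Finset (E3 × ℝ)) ≠ {G, g₂} := fun h0 => by
    obtain ⟨-, h | h, -, -⟩ := pair h0
    exacts [hne₁ h, h12 h]
  have m13 : ({h, g₁} : Finset (E3 × ℝ)) ≠ {g₁, g₃} := fun h0 => by
    obtain ⟨h | h, -, -, -⟩ := pair h0
    exacts [n1 h.symm, hne₃ h.symm]
  have m23 : ({G, g₂} : Finset (E3 × ℝ)) ≠ {g₁, g₃} := fun h0 => by
    obtain ⟨-, -, h | h, -⟩ := pair h0
    exacts [hne₁ h, h12 h]
  rw [← hcard]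
  by_cases h34 : ({g₁, g₃} : Finset (E3 × ℝ)) = {g₂, g₄}
  · -- four faces in a cycle: besides the edge of `h` and `G`, another edge separates signs
    have h32 : g₃ = g₂ := by
      obtain ⟨-, -, h | h, -⟩ := pair h34
      exacts [absurd h.symm h12, h.symm]
    subst h32
    have hle := sum_card_filter_le (sil H (lex (dir (q - p)) τ)) (label H (q - p))
      {{h, G}, {h, g₁}, {G, g₃}, {g₁, g₃}}
    rw [Finset.sum_insert (by simp [m01, m02, m03]), Finset.sum_insert (by simp [m12, m13]),
      Finset.sum_insert (by simp [m23]), Finset.sum_singleton] at hle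
    refine le_trans ?_ hle
    rcases lt_or_gt_of_ne z1 with l1 | l1
    · have := e₁.two_le_card_filter hH hc₁ hs₁ (mul_neg_of_pos_of_neg hτh l1)
      omega
    · rcases lt_or_gt_of_ne z2 with l2 | l2
      · have := e₃.two_le_card_filter hH (mul_pos hc₃ hc₁) hs₃ (mul_neg_of_pos_of_neg l1 l2)
        omega
      · have := e₂.two_le_card_filter hH hc₂ hs₂ (mul_neg_of_neg_of_pos hτG l2)
        omega
  · -- five different edges, of which the edge of `h` and `G` separates signs
    have m04 : ({h, G} : Finset (E3 × ℝ)) ≠ {g₂, g₄} := fun h0 => by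
      obtain ⟨-, -, h | h, -⟩ := pair h0
      exacts [hne₂ h, n2 h]
    have m14 : ({h, g₁} : Finset (E3 × ℝ)) ≠ {g₂, g₄} := fun h0 => by
      obtain ⟨-, -, h | h, -⟩ := pair h0
      exacts [hne₂ h, h12 h.symm]
    have m24 : ({G, g₂} : Finset (E3 × ℝ)) ≠ {g₂, g₄} := fun h0 => by
      obtain ⟨h | h, -, -, -⟩ := pair h0
      exacts [n2 h.symm, hne₄ h.symm]
    have hle := sum_card_filter_le (sil H (lex (dir (q - p)) τ)) (label H (q - p))
      {{h, G}, {h, g₁}, {G, g₂}, {g₁, g₃}, {g₂, g₄}}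
    rw [Finset.sum_insert (by simp [m01, m02, m03, m04]),
      Finset.sum_insert (by simp [m12, m13, m14]),
      Finset.sum_insert (by simp [m23, m24]), Finset.sum_insert (by simp [h34]),
      Finset.sum_singleton] at hle
    omega

theorem IsZone.five_le_of_constSil {k : ℕ} {h G g : E3 × ℝ} {p q p₁ q₁ p₂ q₂ : E3} {c₁ c₂ : ℝ}
    (z : IsZone H h G g p q p₁ q₁ p₂ q₂ c₁ c₂) (hH : Irredundant H) (hk : ConstSil k H) :
    5 ≤ k := by
  classical
  obtain ⟨τ, hτ, hτh, hτG, hτ0⟩ := z.edge.exists_separating hH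
  have hcard := hk.card_eq ((realizable_dir (q - p)).lex hτ) (lex_ne_zero hτ0)
  rw [← hcard]
  exact (z.five_le hH (mul_neg_of_pos_of_neg hτh hτG)
    (hτ0 g z.edge₁.right_mem (z.edge₁.inner_eq_zero_of_smul z.pos₁ z.sub₁).2)).trans
    (sum_card_filter_le _ _ _)

theorem exists_tight_inner_ne_zero {v d : E3} (hv : v ∈ verts H) (hd : d ≠ 0) :
    ∃ f ∈ H, Tight f v ∧ ⟪f.1, d⟫_ℝ ≠ 0 := by
  by_contra! hcon
  obtain ⟨t, ht, hmem⟩ := exists_pos_add_smul_mem (mem_poly_of_mem_verts hv)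
    fun g hg hgv => (hcon g hg hgv).le
  have := eq_of_mem_verts hv hmem fun g hg hgv =>
    hgv.add (by rw [inner_smul_right, hcon g hg hgv, mul_zero])
  rw [add_eq_left, smul_eq_zero] at this
  exact this.elim ht.ne' hd

/-- If there are only five silhouette vertices, then the faces of a zone have no vertices besides
the ends of the edges of the zone. -/
theorem IsZone.eq_of_mem_faceVerts {h G g : E3 × ℝ} {p q p₁ q₁ p₂ q₂ : E3} {c₁ c₂ : ℝ}
    (z : IsZone H h G g p q p₁ q₁ p₂ q₂ c₁ c₂) (hH : Irredundant H) (hk : ConstSil 5 H) {v : E3}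
    (hv : v ∈ faceVerts H h) : v = p ∨ v = q ∨ v = p₁ ∨ v = q₁ := by
  classical
  obtain ⟨hvV, hhv⟩ := mem_faceVerts.1 hv
  have hgd := (z.edge₁.inner_eq_zero_of_smul z.pos₁ z.sub₁).2
  have hmem : label H (q - p) v ∈
      ({{h, G}, {h, g}, {G, g}} : Finset (Finset (E3 × ℝ))) := by
    by_contra hnot
    -- a sign pattern for which `v` is a sixth silhouette vertex
    obtain ⟨τ, hτ, hτhG, hτ0, hvs⟩ : ∃ τ : E3 × ℝ → ℝ, Realizable H τ ∧ τ h * τ G < 0 ∧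
        (∀ f ∈ H, ⟪f.1, q - p⟫_ℝ = 0 → τ f ≠ 0) ∧ v ∈ sil H (lex (dir (q - p)) τ) := by
      obtain ⟨τ, hτ, hτh, hτG, hτ0⟩ := z.edge.exists_separating hH
      obtain ⟨f, hf, hfv, hfd⟩ := exists_tight_inner_ne_zero hvV z.edge.sub_ne_zero
      have hlex : ∀ τ : E3 × ℝ → ℝ, lex (dir (q - p)) τ f = ⟪f.1, q - p⟫_ℝ :=
        fun τ => lex_of_ne hfd
      have hlexh : ∀ τ : E3 × ℝ → ℝ, lex (dir (q - p)) τ h = τ h :=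
        fun τ => lex_of_eq z.edge.inner_left
      rcases lt_or_gt_of_ne hfd with hlt | hgt
      · refine ⟨τ, hτ, mul_neg_of_pos_of_neg hτh hτG, hτ0, mem_sil.2 ⟨hvV, ?_, ?_⟩⟩
        · exact ⟨h, z.edge.left_mem, hhv, by rwa [hlexh]⟩
        · exact ⟨f, hf, hfv, by rwa [hlex]⟩
      · refine ⟨-τ, hτ.neg, ?_, fun f hf h0 => neg_ne_zero.2 (hτ0 f hf h0),
          mem_sil.2 ⟨hvV, ?_, ?_⟩⟩
        · rw [Pi.neg_apply, Pi.neg_apply, neg_mul_neg]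
          exact mul_neg_of_pos_of_neg hτh hτG
        · exact ⟨f, hf, hfv, by rwa [hlex]⟩
        · exact ⟨h, z.edge.left_mem, hhv, by rw [hlexh]; exact neg_neg_of_pos hτh⟩
    have hcard := hk.card_eq ((realizable_dir (q - p)).lex hτ) (lex_ne_zero hτ0)
    have hle := sum_card_filter_le (sil H (lex (dir (q - p)) τ)) (label H (q - p))
      (insert (label H (q - p) v) {{h, G}, {h, g}, {G, g}})
    rw [Finset.sum_insert hnot, hcard] at hle
    have h5 := z.five_le hH hτhG (hτ0 g z.edge₁.right_mem hgd)
    have h1 : 0 < ((sil H (lex (dir (q - p)) τ)).filter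
        fun w => label H (q - p) w = label H (q - p) v).card :=
      Finset.card_pos.2 ⟨v, Finset.mem_filter.2 ⟨hvs, rfl⟩⟩
    omega
  have hhl : h ∈ label H (q - p) v := mem_label.2 ⟨z.edge.left_mem, hhv, z.edge.inner_left⟩
  rw [Finset.mem_insert, Finset.mem_insert, Finset.mem_singleton] at hmem
  rcases hmem with h0 | h0 | h0
  · have : G ∈ label H (q - p) v := by rw [h0]; simp
    rcases z.edge.eq_of_tight hH hvV hhv (mem_label.1 this).2.1 with h | h
    · exact Or.inl h
    · exact Or.inr (Or.inl h)
  · have : g ∈ label H (q - p) v := by rw [h0]; simp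
    rcases z.edge₁.eq_of_tight hH hvV hhv (mem_label.1 this).2.1 with h | h
    · exact Or.inr (Or.inr (Or.inl h))
    · exact Or.inr (Or.inr (Or.inr h))
  · rw [h0, Finset.mem_insert, Finset.mem_singleton] at hhl
    exact absurd hhl (not_or.2 ⟨z.edge.ne.symm, z.ne_left.symm⟩)

namespace IsZone
variable {h G g : E3 × ℝ} {p q p₁ q₁ p₂ q₂ : E3} {c₁ c₂ : ℝ}

theorem not_tight_of_face (z : IsZone H h G g p q p₁ q₁ p₂ q₂ c₁ c₂) (hH : Irredundant H) :
    ¬ Tight G p₁ ∧ ¬ Tight g p ∧ ¬ Tight h p₂ := by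
  have hgd := (z.edge₁.inner_eq_zero_of_smul z.pos₁ z.sub₁).2
  refine ⟨fun h0 => ?_, fun h0 => ?_, fun h0 => ?_⟩
  · have h1 : ⟪G.1, q₁ - p₁⟫_ℝ = 0 := by
      rw [z.sub₁, inner_smul_right]
      exact mul_eq_zero_of_right _ z.edge.inner_right
    rcases z.edge₁.eq_or_eq_of_inner hH z.edge.right_mem h0 h1 with h | h
    exacts [z.edge.ne h, z.ne_right h.symm]
  · rcases z.edge.eq_or_eq_of_inner hH z.edge₁.right_mem h0 hgd with h | h
    exacts [z.ne_left h, z.ne_right h]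
  · have h1 : ⟪h.1, q₂ - p₂⟫_ℝ = 0 := by
      rw [z.sub₂, inner_smul_right]
      exact mul_eq_zero_of_right _ z.edge.inner_left
    rcases z.edge₂.eq_or_eq_of_inner hH z.edge.left_mem h0 h1 with h | h
    exacts [z.edge.ne h.symm, z.ne_left h.symm]

/-- If there are only five silhouette vertices, the first ends of the edges `[p, q]`
and `[p₁, q₁]` of the face `h` are joined by an edge. -/
theorem exists_isEdge_fst (z : IsZone H h G g p q p₁ q₁ p₂ q₂ c₁ c₂) (hH : Irredundant H)
    (hk : ConstSil 5 H) : ∃ f, IsEdge H h f p p₁ := by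
  have hnt := (z.not_tight_of_face hH).1
  have hpp : p ≠ p₁ := by
    rintro rfl
    exact hnt z.edge.right_fst
  have hpar : ∀ c : ℝ, q - p ≠ c • (p₁ - p) := by
    intro c hc
    have hc0 : c ≠ 0 := by
      rintro rfl
      exact z.edge.sub_ne_zero (by rw [hc, zero_smul])
    refine hnt (z.edge.right_fst.of_inner_sub ?_)
    have := z.edge.inner_right
    rw [dir, hc, inner_smul_right] at this
    exact (mul_eq_zero.1 this).resolve_left hc0
  obtain ⟨w, hw0, hw, hwx, hwd⟩ : ∃ w : E3, w ≠ 0 ∧ ⟪h.1, w⟫_ℝ = 0 ∧ ⟪w, p₁ - p⟫_ℝ = 0 ∧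
      ⟪w, q - p⟫_ℝ < 0 := by
    obtain ⟨w, hw0, hw, hwx⟩ := exists_ne_zero_orthogonal h.1 (p₁ - p)
    have hne : ⟪w, q - p⟫_ℝ ≠ 0 := by
      intro h0
      obtain ⟨c, hc⟩ := exists_smul_of_orthogonal (sub_ne_zero.2 hpp.symm)
        (hH.ne_zero z.edge.left_mem) hw0
        ((real_inner_comm _ _).trans (z.edge.left_fst.inner_sub z.edge₁.left_fst)) hwx hw
        ((real_inner_comm _ _).trans z.edge.inner_left) ((real_inner_comm _ _).trans h0)
      exact hpar c hc
    rw [real_inner_comm] at hwx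
    rcases lt_or_gt_of_ne hne with hlt | hgt
    · exact ⟨w, hw0, hw, hwx, hlt⟩
    · refine ⟨-w, neg_ne_zero.2 hw0, by simp [hw], ?_, ?_⟩
      · rw [inner_neg_left, hwx, neg_zero]
      · rw [inner_neg_left]
        exact neg_neg_of_pos hgt
  have e1 : ⟪w, p₁⟫_ℝ = ⟪w, p⟫_ℝ := by
    rw [inner_sub_right] at hwx
    linarith
  have e2 : ⟪w, q⟫_ℝ ≤ ⟪w, p⟫_ℝ := by
    rw [inner_sub_right] at hwd
    linarith
  have e3 : ⟪w, q₁⟫_ℝ ≤ ⟪w, p⟫_ℝ := by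
    have h1 : ⟪w, q₁ - p₁⟫_ℝ = c₁ * ⟪w, q - p⟫_ℝ := by rw [z.sub₁, inner_smul_right]
    have h2 := mul_neg_of_pos_of_neg z.pos₁ hwd
    rw [inner_sub_right] at h1
    linarith
  refine hH.exists_isEdge_of_max z.edge.left_mem hw0 hw
    (mem_faceVerts.2 ⟨z.edge.fst_mem, z.edge.left_fst⟩)
    (mem_faceVerts.2 ⟨z.edge₁.fst_mem, z.edge₁.left_fst⟩) hpp (fun v hv => ?_) e1
  rcases z.eq_of_mem_faceVerts hH hk hv with rfl | rfl | rfl | rfl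
  exacts [le_rfl, e2, e1.le, e3]

/-- If there are only five silhouette vertices and no parallel faces, then the face `h` is a
parallelogram, and its other two edges belong to a zone as well. -/
theorem exists_parallelogram (z : IsZone H h G g p q p₁ q₁ p₂ q₂ c₁ c₂) (hH : Irredundant H)
    (hk : ConstSil 5 H) (hU : ∀ h ∈ H, ∀ g ∈ H, g ≠ h → NonParallel h g) :
    q₁ - p₁ = q - p ∧ ∃ f f' a b a' b' b₁ b₂, IsZone H h f f' p p₁ a b a' b' b₁ b₂ ∧
      Tight f' q := by
  obtain ⟨f, ef⟩ := z.exists_isEdge_fst hH hk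
  obtain ⟨f', a, b, a', b', b₁, b₂, zf⟩ :=
    (ef.exists_isZone hH hk hU).resolve_right (by norm_num)
  have hf'd := (zf.edge₁.inner_eq_zero_of_smul zf.pos₁ zf.sub₁).2
  have hf'p : ¬ Tight f' p := (zf.not_tight_of_face hH).2.1
  have hf'p₁ : ¬ Tight f' p₁ := fun h0 => hf'p (h0.of_inner_sub (by
    rw [← neg_sub, inner_neg_right, hf'd, neg_zero]))
  have hends : ∀ v, v ∈ verts H → Tight h v → Tight f' v → v = q ∨ v = q₁ := by
    intro v hv h1 h2
    rcases z.eq_of_mem_faceVerts hH hk (mem_faceVerts.2 ⟨hv, h1⟩) with rfl | rfl | rfl | rfl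
    exacts [absurd h2 hf'p, Or.inl rfl, absurd h2 hf'p₁, Or.inr rfl]
  have e1 := zf.edge₁
  have hqq : Tight f' q ∧ Tight f' q₁ ∧ q ≠ q₁ := by
    rcases hends a e1.fst_mem e1.left_fst e1.right_fst with ha | ha <;>
    rcases hends b e1.snd_mem e1.left_snd e1.right_snd with hb | hb
    · exact absurd (ha.trans hb.symm) e1.fst_ne
    · subst ha hb
      exact ⟨e1.right_fst, e1.right_snd, e1.fst_ne⟩
    · subst ha hb
      exact ⟨e1.right_snd, e1.right_fst, e1.fst_ne.symm⟩
    · exact absurd (ha.trans hb.symm) e1.fst_ne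
  obtain ⟨t1, t2, hne⟩ := hqq
  refine ⟨?_, f, f', a, b, a', b', b₁, b₂, zf, t1⟩
  have eq : IsEdge H h f' q q₁ := ⟨e1.left_mem, e1.right_mem, e1.ne, z.edge.snd_mem,
    z.edge₁.snd_mem, hne, z.edge.left_snd, z.edge₁.left_snd, t1, t2⟩
  obtain ⟨s, hs⟩ := eq.exists_smul hH (ef.left_fst.inner_sub ef.left_snd) hf'd
  have hrel : (1 - s) • (p₁ - p) = (s * (c₁ - 1)) • (q - p) := by
    have h1 : q₁ - q = (p₁ - p) + (c₁ - 1) • (q - p) := by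
      rw [sub_smul, ← z.sub₁, one_smul]
      abel
    rw [sub_smul, one_smul]
    nth_rw 1 [hs]
    rw [h1, smul_add, smul_smul]
    abel
  have hGp : ⟪G.1, p₁ - p⟫_ℝ ≠ 0 := fun h0 =>
    (z.not_tight_of_face hH).1 (z.edge.right_fst.of_inner_sub h0)
  have hs1 : 1 - s = 0 := by
    have h1 := congrArg (fun x => ⟪G.1, x⟫_ℝ) hrel
    have h2 : ⟪G.1, q - p⟫_ℝ = 0 := z.edge.inner_right
    simp only [inner_smul_right, h2, mul_zero] at h1
    exact (mul_eq_zero.1 h1).resolve_right hGp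
  have hs1' : s = 1 := by linarith
  rw [hs1, zero_smul, hs1', one_mul, eq_comm, smul_eq_zero] at hrel
  have hc1 : c₁ = 1 := by
    have := hrel.resolve_right z.edge.sub_ne_zero
    linarith
  rw [z.sub₁, hc1, one_smul]

end IsZone

/-- A polyhedron with five silhouette vertices in every direction has two parallel faces.
Otherwise all faces are parallelograms, and the shadow along an edge of a face `h` is a triangle
one of whose sides is the image of `h`. But the image contains a second translate of this side,
which no triangle does. -/
theorem exists_parallel_faces (hH : Irredundant H) (hk : ConstSil 5 H) :
    ∃ h ∈ H, ∃ g ∈ H, g ≠ h ∧ ∃ c : ℝ, g.1 = c • h.1 := by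
  by_contra! hU
  obtain ⟨h, hh⟩ := hH.nonempty
  obtain ⟨G, p, q, e⟩ := hH.exists_isEdge_of_face hh
  obtain ⟨g, p₁, q₁, p₂, q₂, c₁, c₂, z⟩ :=
    (e.exists_isZone hH hk hU).resolve_right (by norm_num)
  obtain ⟨-, f, f', a, b, a', b', b₁, b₂, zf, hf'q⟩ := z.exists_parallelogram hH hk hU
  obtain ⟨hy, -⟩ := z.symm.exists_parallelogram hH hk hU
  have ha'P := mem_poly_of_mem_verts zf.edge₂.fst_mem
  have hqP := mem_poly_of_mem_verts e.snd_mem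
  have hpP := mem_poly_of_mem_verts e.fst_mem
  have hf'x := (zf.edge₁.inner_eq_zero_of_smul zf.pos₁ zf.sub₁).2
  obtain ⟨α, β, hαβ⟩ := exists_combination_of_orthogonal (zf.edge.linearIndependent hH)
    zf.edge.sub_ne_zero zf.edge.inner_left zf.edge.inner_right hf'x
  have hval : ∀ x, ⟪f'.1, x⟫_ℝ = α * ⟪h.1, x⟫_ℝ + β * ⟪f.1, x⟫_ℝ := fun x => by
    rw [hαβ, inner_add_left, real_inner_smul_left, real_inner_smul_left]
  have v1 := hval (q - p)
  have v2 := hval (a' - p)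
  have v3 := hval (p₂ - p)
  have hfq : ¬ Tight f q := by
    intro h0
    rcases e.eq_or_eq hH zf.edge.right_mem zf.edge.right_fst h0 with h | h
    · exact zf.edge.ne h
    · exact (z.not_tight_of_face hH).1 (h ▸ zf.edge.right_snd)
  have hfd := inner_sub_neg_of_tight zf.edge.right_mem zf.edge.right_fst hqP hfq
  have hf'd := inner_sub_neg_of_tight zf.edge₁.right_mem hf'q hpP (zf.not_tight_of_face hH).2.1
  rw [← neg_sub, inner_neg_right] at hf'd
  have hhz := inner_sub_neg_of_tight hh e.left_fst ha'P (zf.not_tight_of_face hH).2.2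
  have hfz := zf.edge.right_fst.inner_sub zf.edge₂.left_fst
  have hf'z : ⟪f'.1, a' - p⟫_ℝ = ⟪f'.1, q - p⟫_ℝ := by
    have h1 := hf'q.inner_sub zf.edge₂.right_fst
    rw [inner_sub_right] at h1 ⊢
    rw [inner_sub_right]
    linarith
  have hhy := inner_sub_neg_of_tight hh e.left_fst (mem_poly_of_mem_verts z.edge₂.fst_mem)
    (z.not_tight_of_face hH).2.2
  have hfy := inner_sub_nonpos_of_tight zf.edge.right_mem zf.edge.right_fst
    (mem_poly_of_mem_verts z.edge₂.fst_mem)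
  have hf'y := inner_sub_nonpos_of_tight zf.edge₁.right_mem hf'q
    (mem_poly_of_mem_verts z.edge₂.snd_mem)
  have hyy : q₂ - q = p₂ - p := by
    rw [sub_eq_sub_iff_add_eq_add] at hy ⊢
    rw [hy]
    abel
  rw [hyy] at hf'y
  have hhd : ⟪h.1, q - p⟫_ℝ = 0 := e.inner_left
  rw [hhd, mul_zero, zero_add] at v1
  rw [hfz, mul_zero, add_zero, hf'z] at v2
  have hβ : β < 0 := by
    by_contra! hb
    have := mul_nonpos_of_nonneg_of_nonpos hb hfd.le
    linarith
  have hα : α < 0 := by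
    by_contra! hb
    have := mul_nonpos_of_nonneg_of_nonpos hb hhz.le
    linarith
  have := mul_pos_of_neg_of_neg hα hhy
  have := mul_nonneg_of_nonpos_of_nonpos hβ.le hfy
  linarith

/-- A polyhedron without parallel faces has at least five silhouette vertices. -/
theorem five_le_of_nonParallel {k : ℕ} (hH : Irredundant H) (hk : ConstSil k H)
    (hU : ∀ h ∈ H, ∀ g ∈ H, g ≠ h → NonParallel h g) : 5 ≤ k := by
  obtain ⟨h, hh⟩ := hH.nonempty
  obtain ⟨G, p, q, e⟩ := hH.exists_isEdge_of_face hh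
  rcases e.exists_isZone hH hk hU with ⟨g, p₁, q₁, p₂, q₂, c₁, c₂, z⟩ | h6
  · exact z.five_le_of_constSil hH hk
  · omega

/-! ### Polyhedra with two parallel faces -/

theorem Irredundant.exists_tight_ne (hH : Irredundant H) {h : E3 × ℝ} (hh : h ∈ H) {v : E3}
    (hv : v ∈ faceVerts H h) : ∃ g ∈ H, g ≠ h ∧ Tight g v := by
  by_contra! hcon
  obtain ⟨w, hw, hwv, -⟩ := hH.exists_inner_ne hh v v
  refine hwv (eq_of_mem_verts (mem_faceVerts.1 hv).1
    (mem_poly_of_mem_verts (mem_faceVerts.1 hw).1) fun g hg hgv => ?_)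
  rcases eq_or_ne g h with rfl | hgh
  · exact (mem_faceVerts.1 hw).2
  · exact absurd hgv (hcon g hg hgh)

/-- In a generic direction `u` of its plane, each vertex of a face is on the side where `u` points
out of the face or on the opposite side, and at least two vertices are on both. -/
theorem Irredundant.card_faceVerts_add_two_le (hH : Irredundant H) {h : E3 × ℝ} (hh : h ∈ H)
    {u : E3} (hu : ⟪h.1, u⟫_ℝ = 0) (hgen : ∀ g ∈ H, NonParallel h g → ⟪g.1, u⟫_ℝ ≠ 0) :
    (faceVerts H h).card + 2 ≤ (up H h (dir u)).card + (up H h (-dir u)).card := by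
  classical
  rw [← Finset.card_union_add_card_inter]
  refine add_le_add (Finset.card_le_card fun v hv => ?_) ?_
  · obtain ⟨g, hg, hgh, hgv⟩ := hH.exists_tight_ne hh hv
    have hne := hgen g hg (hH.nonParallel hh hg hgh (mem_faceVerts.1 hv).2 hgv)
    rw [Finset.mem_union, mem_up, mem_up]
    rcases lt_or_gt_of_ne hne with hlt | hgt
    · exact Or.inr ⟨hv, g, hg, hgh, hgv, neg_pos.2 hlt⟩
    · exact Or.inl ⟨hv, g, hg, hgh, hgv, hgt⟩
  · obtain ⟨p, -, q, -, hpq, h1, h2, h3, h4⟩ := hH.exists_two_mem_up hh hu hgen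
    exact Finset.one_lt_card.2 ⟨p, Finset.mem_inter.2 ⟨h1, h2⟩, q, Finset.mem_inter.2 ⟨h3, h4⟩, hpq⟩

/-- `h` and `h'` are parallel faces. -/
structure IsParallelPair (H : Finset (E3 × ℝ)) (h h' : E3 × ℝ) : Prop where
  left_mem : h ∈ H
  right_mem : h' ∈ H
  ne : h' ≠ h
  parallel : ∃ c : ℝ, h'.1 = c • h.1

namespace IsParallelPair
variable {h h' : E3 × ℝ}

theorem symm (w : IsParallelPair H h h') (hH : Irredundant H) : IsParallelPair H h' h := by
  obtain ⟨c, hc⟩ := w.parallel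
  have hneg := hH.neg_of_parallel w.left_mem w.right_mem w.ne hc
  exact ⟨w.right_mem, w.left_mem, w.ne.symm, c⁻¹, by
    rw [hc, smul_smul, inv_mul_cancel₀ hneg.ne, one_smul]⟩

theorem inner_eq_zero (w : IsParallelPair H h h') {u : E3} (hu : ⟪h.1, u⟫_ℝ = 0) :
    ⟪h'.1, u⟫_ℝ = 0 := by
  obtain ⟨c, hc⟩ := w.parallel
  rw [hc, real_inner_smul_left, hu, mul_zero]

theorem nonParallel_of (w : IsParallelPair H h h') {g : E3 × ℝ}
    (hg : NonParallel h g) : NonParallel h' g := by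
  obtain ⟨c, hc⟩ := w.parallel
  intro b hb
  exact hg (b * c) (by rw [hb, hc, smul_smul])

theorem not_tight (w : IsParallelPair H h h') (hH : Irredundant H) {v : E3} (hv : Tight h v) :
    ¬ Tight h' v := fun h0 => by
  obtain ⟨c, hc⟩ := w.parallel
  exact hH.nonParallel w.left_mem w.right_mem w.ne hv h0 c hc

open scoped Classical in
theorem card_eq (w : IsParallelPair H h h') {k : ℕ} (hH : Irredundant H) (hk : ConstSil k H)
    {σ : E3 × ℝ → ℝ} (hσ : Realizable H σ) (hσh : σ h = 0)
    (hgen : ∀ g ∈ H, NonParallel h g → σ g ≠ 0) :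
    k = (up H h (-σ)).card + (up H h' σ).card +
      ((sil H σ).filter fun v => ¬ Tight h v ∧ ¬ Tight h' v).card ∧
    k = (up H h σ).card + (up H h' (-σ)).card +
      ((sil H σ).filter fun v => ¬ Tight h v ∧ ¬ Tight h' v).card := by
  obtain ⟨c, hc⟩ := w.parallel
  refine ⟨card_sil_of_partnered hH hk hσ w.left_mem w.right_mem w.ne hc hσh hgen, ?_⟩
  have := card_sil_of_partnered hH hk hσ.neg w.left_mem w.right_mem w.ne hc (by simpa using hσh)
    fun g hg hp => neg_ne_zero.2 (hgen g hg hp)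
  rwa [neg_neg, sil_neg] at this

open scoped Classical in
/-- The silhouette counts on both sides of the common plane direction of two parallel faces,
added up. -/
theorem card_add_card_le (w : IsParallelPair H h h') {k : ℕ} (hH : Irredundant H)
    (hk : ConstSil k H) {u : E3} (hu : ⟪h.1, u⟫_ℝ = 0)
    (hgen : ∀ g ∈ H, NonParallel h g → ⟪g.1, u⟫_ℝ ≠ 0) :
    (faceVerts H h).card + (faceVerts H h').card + 4 +
      2 * ((sil H (dir u)).filter fun v => ¬ Tight h v ∧ ¬ Tight h' v).card ≤ 2 * k := by
  obtain ⟨h1, h2⟩ := w.card_eq hH hk (realizable_dir u) hu hgen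
  have h3 := hH.card_faceVerts_add_two_le w.left_mem hu hgen
  have h4 := hH.card_faceVerts_add_two_le w.right_mem (w.inner_eq_zero hu)
    fun g hg hp => hgen g hg ((w.symm hH).nonParallel_of hp)
  omega

/-- A polyhedron with two parallel faces has at least five silhouette vertices, since each of the
two faces has at least three vertices. -/
theorem five_le (w : IsParallelPair H h h') {k : ℕ} (hH : Irredundant H) (hk : ConstSil k H) :
    5 ≤ k := by
  classical
  obtain ⟨u, hu, hgen⟩ := exists_generic (H := H) (hH.ne_zero w.left_mem)
  have h1 := w.card_add_card_le hH hk hu hgen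
  have h2 := hH.three_le_card_faceVerts w.left_mem
  have h3 := hH.three_le_card_faceVerts w.right_mem
  omega

/-- With five silhouette vertices, parallel faces are triangles. -/
theorem card_faceVerts (w : IsParallelPair H h h') (hH : Irredundant H) (hk : ConstSil 5 H) :
    (faceVerts H h).card = 3 := by
  classical
  obtain ⟨u, hu, hgen⟩ := exists_generic (H := H) (hH.ne_zero w.left_mem)
  have h1 := w.card_add_card_le hH hk hu hgen
  have h2 := hH.three_le_card_faceVerts w.left_mem
  have h3 := hH.three_le_card_faceVerts w.right_mem
  omega

/-- With five silhouette vertices, for directions close to the plane of the two parallel faces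
all silhouette vertices lie on these two faces. -/
theorem tight_of_mem_sil (w : IsParallelPair H h h') (hH : Irredundant H) (hk : ConstSil 5 H)
    {σ : E3 × ℝ → ℝ} (hσ : Realizable H σ) (hσh : σ h = 0)
    (hgen : ∀ g ∈ H, NonParallel h g → σ g ≠ 0) {v : E3} (hv : v ∈ sil H σ) :
    Tight h v ∨ Tight h' v := by
  classical
  obtain ⟨u, hu⟩ := hσ
  have hu0 : ⟪h.1, u⟫_ℝ = 0 := by
    rw [← sign_eq_zero_iff, ← hu h w.left_mem, hσh, sign_zero]
  have hgen' : ∀ g ∈ H, NonParallel h g → ⟪g.1, u⟫_ℝ ≠ 0 := fun g hg hp h0 => hgen g hg hp (by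
    rw [← sign_eq_zero_iff, hu g hg, h0, sign_zero])
  have h1 := w.card_add_card_le hH hk hu0 hgen'
  have h2 := hH.three_le_card_faceVerts w.left_mem
  have h3 := hH.three_le_card_faceVerts w.right_mem
  have h4 : ((sil H (dir u)).filter fun v => ¬ Tight h v ∧ ¬ Tight h' v).card = 0 := by omega
  rw [Finset.card_eq_zero] at h4
  by_contra! hcon
  have : v ∈ (sil H (dir u)).filter fun v => ¬ Tight h v ∧ ¬ Tight h' v :=
    Finset.mem_filter.2 ⟨by rwa [← sil_congr (τ := dir u) hu], hcon⟩
  rw [h4] at this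
  exact Finset.notMem_empty v this

/-- The silhouette counts on both sides of the common plane direction of two parallel faces
agree. -/
theorem card_up_add_card_up (w : IsParallelPair H h h') (hH : Irredundant H) (hk : ConstSil 5 H)
    {σ : E3 × ℝ → ℝ} (hσ : Realizable H σ) (hσh : σ h = 0)
    (hgen : ∀ g ∈ H, NonParallel h g → σ g ≠ 0) :
    (up H h (-σ)).card + (up H h' σ).card = (up H h σ).card + (up H h' (-σ)).card := by
  classical
  obtain ⟨h1, h2⟩ := w.card_eq hH hk hσ hσh hgen
  omega

/-- A polyhedron with five silhouette vertices and two parallel faces has no vertices outside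
these faces: any vertex is on the silhouette for some direction in the plane of the faces. -/
theorem tight_of_mem_verts (w : IsParallelPair H h h') (hH : Irredundant H) (hk : ConstSil 5 H)
    {v : E3} (hv : v ∈ verts H) : Tight h v ∨ Tight h' v := by
  classical
  -- a functional that attains its maximum only at `v`
  set l : E3 := ∑ g ∈ H.filter fun g => Tight g v, g.1 with hl
  have hlx : ∀ x, ⟪l, x⟫_ℝ = ∑ g ∈ H.filter fun g => Tight g v, ⟪g.1, x⟫_ℝ := fun x => by
    rw [hl, sum_inner]
  obtain ⟨u, hu0, hu, hul⟩ := exists_ne_zero_orthogonal h.1 l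
  have hvs : v ∈ sil H (dir u) := by
    refine mem_sil_dir_iff.2 ⟨hv, fun t ht => ?_⟩
    have hle : ∀ g ∈ H.filter fun g => Tight g v, ⟪g.1, t • u⟫_ℝ ≤ 0 := by
      intro g hg
      obtain ⟨hg, hgv⟩ := Finset.mem_filter.1 hg
      have := ht g hg
      rw [inner_add_right, hgv] at this
      linarith
    have hsum := hlx (t • u)
    rw [inner_smul_right, hul, mul_zero] at hsum
    have hall := (Finset.sum_eq_zero_iff_of_nonpos hle).1 hsum.symm
    have := eq_of_mem_verts hv ht fun g hg hgv =>
      hgv.add (hall g (Finset.mem_filter.2 ⟨hg, hgv⟩))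
    rw [add_eq_left, smul_eq_zero] at this
    exact this.resolve_right hu0
  obtain ⟨u', hu', hgen⟩ := exists_generic (H := H) (hH.ne_zero w.left_mem)
  refine w.tight_of_mem_sil hH hk (σ := lex (dir u) (dir u'))
    ((realizable_dir u).lex (realizable_dir u')) ?_ ?_ ?_
  · rw [lex_of_eq hu]
    exact hu'
  · intro g hg hp h0
    by_cases hgu : dir u g = 0
    · rw [lex_of_eq hgu] at h0
      exact hgen g hg hp h0
    · rw [lex_of_ne hgu] at h0
      exact hgu h0
  · obtain ⟨-, ⟨g, hg, hgv, hpos⟩, f, hf, hfv, hneg⟩ := mem_sil.1 hvs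
    exact mem_sil.2 ⟨hv, ⟨g, hg, hgv, by rwa [lex_of_ne hpos.ne']⟩, f, hf, hfv, by
      rwa [lex_of_ne hneg.ne]⟩

end IsParallelPair

/-! ### Two parallel triangles -/

theorem up_lex_smul {h : E3 × ℝ} {d : E3} {c : ℝ} (hc : 0 < c) (τ : E3 × ℝ → ℝ) :
    up H h (lex (dir (c • d)) τ) = up H h (lex (dir d) τ) := by
  have key : ∀ g, 0 < lex (dir (c • d)) τ g ↔ 0 < lex (dir d) τ g := by
    intro g
    have h1 : dir (c • d) g = c * dir d g := inner_smul_right _ _ _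
    by_cases h0 : dir d g = 0
    · rw [lex_of_eq h0, lex_of_eq (by rw [h1, h0, mul_zero])]
    · rw [lex_of_ne h0, lex_of_ne (by rw [h1]; exact mul_ne_zero hc.ne' h0), h1,
        mul_pos_iff_of_pos_left hc]
  ext v
  simp only [mem_up, key]

/-- The vertices of the face `h` are the three different points `a`, `b`, `c`. -/
structure IsTriangle (H : Finset (E3 × ℝ)) (h : E3 × ℝ) (a b c : E3) : Prop where
  mem : h ∈ H
  ab : a ≠ b
  ac : a ≠ c
  bc : b ≠ c
  mem_iff : ∀ v, v ∈ faceVerts H h ↔ v = a ∨ v = b ∨ v = c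

theorem exists_isTriangle {h : E3 × ℝ} (hh : h ∈ H) (hc : (faceVerts H h).card = 3) :
    ∃ a b c, IsTriangle H h a b c := by
  classical
  obtain ⟨a, b, c, hab, hac, hbc, heq⟩ := Finset.card_eq_three.1 hc
  exact ⟨a, b, c, hh, hab, hac, hbc, by simp [heq]⟩

namespace IsTriangle
variable {h : E3 × ℝ} {a b c : E3}

theorem rotate (t : IsTriangle H h a b c) : IsTriangle H h b c a :=
  ⟨t.mem, t.bc, t.ab.symm, t.ac.symm, fun v => by rw [t.mem_iff]; tauto⟩

theorem mem_fst (t : IsTriangle H h a b c) : a ∈ verts H ∧ Tight h a :=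
  mem_faceVerts.1 ((t.mem_iff a).2 (Or.inl rfl))

theorem linearIndependent (t : IsTriangle H h a b c) :
    LinearIndependent ℝ ![b - a, c - a] := by
  refine (LinearIndependent.pair_iff' (sub_ne_zero.2 t.ab.symm)).2 fun s hs => ?_
  rcases not_collinear_verts t.mem_fst.1 t.rotate.mem_fst.1 t.rotate.rotate.mem_fst.1 t.ab
    hs.symm with h | h
  exacts [t.ac h.symm, t.bc h.symm]

theorem exists_isEdge (t : IsTriangle H h a b c) (hH : Irredundant H) :
    ∃ g, IsEdge H h g a b ∧ ¬ Tight g c := by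
  have ha := t.mem_fst
  have hb := t.rotate.mem_fst
  have hc := t.rotate.rotate.mem_fst
  obtain ⟨w, hw0, hw, hwd, hwc⟩ : ∃ w : E3, w ≠ 0 ∧ ⟪h.1, w⟫_ℝ = 0 ∧ ⟪w, b⟫_ℝ = ⟪w, a⟫_ℝ ∧
      ⟪w, c⟫_ℝ < ⟪w, a⟫_ℝ := by
    obtain ⟨w, hw0, hw, hwd⟩ := exists_ne_zero_orthogonal h.1 (b - a)
    rw [real_inner_comm, inner_sub_right, sub_eq_zero] at hwd
    have hne : ⟪w, c⟫_ℝ ≠ ⟪w, a⟫_ℝ := by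
      intro h0
      have hall : ∀ v ∈ faceVerts H h, ⟪w, v⟫_ℝ = ⟪w, a⟫_ℝ := by
        intro v hv
        rcases (t.mem_iff v).1 hv with rfl | rfl | rfl
        exacts [rfl, hwd, h0]
      obtain ⟨x, hx, y, hy, hhx, hhy, hlt, -, -⟩ := hH.exists_inner_lt t.mem hw0 hw
      rw [hall x (mem_faceVerts.2 ⟨hx, hhx⟩), hall y (mem_faceVerts.2 ⟨hy, hhy⟩)] at hlt
      exact hlt.false
    rcases lt_or_gt_of_ne hne with hlt | hgt
    · exact ⟨w, hw0, hw, hwd, hlt⟩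
    · exact ⟨-w, neg_ne_zero.2 hw0, by simp [hw], by simp [hwd], by simpa using hgt⟩
  obtain ⟨g, e⟩ := hH.exists_isEdge_of_max t.mem hw0 hw (mem_faceVerts.2 ha) (mem_faceVerts.2 hb)
    t.ab (fun v hv => by
      rcases (t.mem_iff v).1 hv with rfl | rfl | rfl
      exacts [le_rfl, hwd.le, hwc.le]) hwd
  refine ⟨g, e, fun h0 => ?_⟩
  rcases e.eq_of_tight hH hc.1 hc.2 h0 with h | h
  exacts [t.ac h.symm, t.bc h.symm]

/-- A triangle has only one edge in the direction of a given edge. -/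
theorem eq_of_parallel (t : IsTriangle H h a b c) (hH : Irredundant H) {g g' : E3 × ℝ}
    (e : IsEdge H h g a b) {p q : E3} (e' : IsEdge H h g' p q) (h0 : ⟪g'.1, b - a⟫_ℝ = 0) :
    g' = g := by
  by_contra hne
  have hna : ¬ Tight g' a := fun h1 => by
    rcases e.eq_or_eq_of_inner hH e'.right_mem h1 h0 with h | h
    exacts [e'.ne h, hne h]
  have hnb : ¬ Tight g' b := fun h1 =>
    hna (h1.of_inner_sub (by rw [← neg_sub, inner_neg_right, h0, neg_zero]))
  have key : ∀ v ∈ verts H, Tight h v → Tight g' v → v = c := by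
    intro v hv h1 h2
    rcases (t.mem_iff v).1 (mem_faceVerts.2 ⟨hv, h1⟩) with rfl | rfl | rfl
    exacts [absurd h2 hna, absurd h2 hnb, rfl]
  exact e'.fst_ne ((key p e'.fst_mem e'.left_fst e'.right_fst).trans
    (key q e'.snd_mem e'.left_snd e'.right_snd).symm)

end IsTriangle

/-- A vector in the plane of `h` on which the outer normal of the edge `[p, q]` is negative lies
on the inner side of this edge. -/
theorem inner_neg_of_inner_neg {h g : E3 × ℝ} {d r x : E3} (hh : h.1 ≠ 0) (hd0 : d ≠ 0)
    (hr0 : r ≠ 0) (hd : ⟪h.1, d⟫_ℝ = 0) (hr : ⟪h.1, r⟫_ℝ = 0) (hdr : ⟪d, r⟫_ℝ = 0)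
    (hx : ⟪h.1, x⟫_ℝ = 0) (hgd : ⟪g.1, d⟫_ℝ = 0) (hgr : 0 < ⟪g.1, r⟫_ℝ)
    (hgx : ⟪g.1, x⟫_ℝ < 0) : ⟪r, x⟫_ℝ < 0 := by
  have hrr : 0 < ⟪r, r⟫_ℝ := real_inner_self_pos.2 hr0
  set β := ⟪r, x⟫_ℝ / ⟪r, r⟫_ℝ with hβ
  obtain ⟨c, hc⟩ := exists_smul_of_orthogonal (a := x - β • r) hd0 hh hr0
    ((real_inner_comm _ _).trans hd) hdr hr
    (by rw [real_inner_comm, inner_sub_right, inner_smul_right, hx, hr, mul_zero, sub_zero])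
    (by
      rw [real_inner_comm, inner_sub_right, inner_smul_right, hβ, div_mul_cancel₀ _ hrr.ne',
        sub_self])
  have hx' : x = c • d + β • r := by rw [← hc, sub_add_cancel]
  rw [hx', inner_add_right, inner_smul_right, inner_smul_right, hgd, mul_zero, zero_add] at hgx
  have hβneg : β < 0 := by
    by_contra! h0
    have := mul_nonneg h0 hgr.le
    linarith
  by_contra! h0
  exact absurd (div_nonneg h0 hrr.le) (not_le.2 hβneg)

/-- Every edge of one of two parallel triangles is parallel to an edge of the other one, and the
two triangles lie on the same side of these edges. -/
theorem IsTriangle.exists_parallel_edge {h h' : E3 × ℝ} {b₁ b₂ b₃ : E3}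
    (t : IsTriangle H h' b₁ b₂ b₃) (w : IsParallelPair H h h') (hH : Irredundant H)
    (hk : ConstSil 5 H) :
    ∃ p q m, IsTriangle H h p q m ∧ (∃ c > (0 : ℝ), q - p = c • (b₂ - b₁)) ∧
      ∃ r : E3, ⟪r, b₂ - b₁⟫_ℝ = 0 ∧ ⟪r, b₃ - b₁⟫_ℝ < 0 ∧ ⟪r, m - p⟫_ℝ < 0 := by
  classical
  obtain ⟨G, e, hGb⟩ := t.exists_isEdge hH
  obtain ⟨r, hr0, hr', hdr, hGr⟩ := e.exists_normal hH
  have w' := w.symm hH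
  have hd0 := e.sub_ne_zero
  have hhd : ⟪h.1, b₂ - b₁⟫_ℝ = 0 := w'.inner_eq_zero e.inner_left
  have hr : ⟪h.1, r⟫_ℝ = 0 := w'.inner_eq_zero hr'
  have hh0 := hH.ne_zero w.left_mem
  -- the balance of the two faces on both sides of the direction of the edge
  have bal : ∀ r : E3, r ≠ 0 → ⟪h.1, r⟫_ℝ = 0 → ⟪b₂ - b₁, r⟫_ℝ = 0 →
      (up H h (-lex (dir (b₂ - b₁)) (dir r))).card + (up H h' (lex (dir (b₂ - b₁)) (dir r))).card
      = (up H h (lex (dir (b₂ - b₁)) (dir r))).card +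
        (up H h' (-lex (dir (b₂ - b₁)) (dir r))).card := by
    intro r hr0 hr hdr
    refine w.card_up_add_card_up hH hk ((realizable_dir _).lex (realizable_dir _)) ?_
      (fun g hg hp => lex_dir_dir_ne_zero hh0 hd0 hr0 hhd hr hdr hp)
    rw [lex_of_eq hhd]
    exact hr
  have B1 := bal r hr0 hr hdr
  have B2 := bal (-r) (neg_ne_zero.2 hr0) (by simp [hr]) (by rw [inner_neg_right, hdr, neg_zero])
  rw [dir_neg] at B2
  obtain ⟨i1, i2⟩ := e.imbalance hH (fun g p q e' => t.eq_of_parallel hH e e') hGr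
  -- without an edge of `h` in this direction, only the imbalance of `h'` would change
  obtain ⟨g, x, y, ex, hgd⟩ : ∃ g x y, IsEdge H h g x y ∧ ⟪g.1, b₂ - b₁⟫_ℝ = 0 := by
    by_contra! hno
    have h1 := up_lex_eq_of_no_edge hH w.left_mem hd0 hhd hno (dir r) (-dir r)
    have h2 := up_lex_eq_of_no_edge hH w.left_mem (neg_ne_zero.2 hd0)
      (by rw [inner_neg_right, hhd, neg_zero]) (fun g p q e' => by
        rw [inner_neg_right]
        exact neg_ne_zero.2 (hno g p q e')) (dir r) (-dir r)
    simp only [neg_lex, neg_neg, dir_neg] at h2 B1 B2 i2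
    rw [h1, ← h2] at B1
    omega
  obtain ⟨p, q, c, hc, ep, hpq⟩ := ex.exists_oriented hH hd0 hhd hgd
  obtain ⟨m, hm, hmp, hmq⟩ := hH.exists_inner_ne w.left_mem p q
  have tri : IsTriangle H h p q m := by
    refine ⟨w.left_mem, ep.fst_ne, hmp.symm, hmq.symm, ?_⟩
    have hsub : ({p, q, m} : Finset E3) ⊆ faceVerts H h := by
      intro v hv
      simp only [Finset.mem_insert, Finset.mem_singleton] at hv
      rcases hv with rfl | rfl | rfl
      exacts [mem_faceVerts.2 ⟨ep.fst_mem, ep.left_fst⟩, mem_faceVerts.2 ⟨ep.snd_mem, ep.left_snd⟩,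
        hm]
    have heq := Finset.eq_of_subset_of_card_le hsub (by
      rw [w.card_faceVerts hH hk, Finset.card_eq_three.2 ⟨p, q, m, ep.fst_ne, hmp.symm, hmq.symm,
        rfl⟩])
    intro v
    rw [← heq]
    simp
  have huniq : ∀ g' p' q', IsEdge H h g' p' q' → ⟪g'.1, q - p⟫_ℝ = 0 → g' = g :=
    fun g' p' q' e' => tri.eq_of_parallel hH ep e'
  -- with outer normals on different sides, the imbalances would change in different senses
  have hgr : 0 < ⟪g.1, r⟫_ℝ := by
    by_contra! hle
    have hne : ⟪g.1, r⟫_ℝ ≠ 0 := fun h0 => by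
      obtain ⟨s, hs⟩ := exists_smul_of_orthogonal hh0 hd0 hr0 hhd hr hdr hgd h0
      exact hH.nonParallel w.left_mem ep.right_mem ep.ne ep.left_fst ep.right_fst s hs
    have hlt : 0 < ⟪g.1, -r⟫_ℝ := by
      rw [inner_neg_right]
      exact neg_pos.2 (lt_of_le_of_ne hle hne)
    obtain ⟨j1, j2⟩ := ep.imbalance hH huniq hlt
    rw [hpq] at j1 j2
    rw [up_lex_smul hc, up_lex_smul hc] at j1
    rw [neg_lex, neg_lex, ← dir_neg (c • _), ← smul_neg, up_lex_smul hc, up_lex_smul hc] at j2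
    simp only [neg_lex, neg_neg, dir_neg] at j1 j2 B1 B2 i2
    omega
  refine ⟨p, q, m, tri, ⟨c, hc, hpq⟩, r, (real_inner_comm _ _).trans hdr, ?_, ?_⟩
  · have hb := t.rotate.rotate.mem_fst
    exact inner_neg_of_inner_neg (hH.ne_zero w.right_mem) hd0 hr0 e.inner_left hr' hdr
      (e.left_fst.inner_sub hb.2) e.inner_right hGr
      (inner_sub_neg_of_tight e.right_mem e.right_fst (mem_poly_of_mem_verts hb.1) hGb)
  · have hm' := mem_faceVerts.1 hm
    refine inner_neg_of_inner_neg hh0 hd0 hr0 hhd hr hdr (ep.left_fst.inner_sub hm'.2) hgd hgr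
      (inner_sub_neg_of_tight ep.right_mem ep.right_fst (mem_poly_of_mem_verts hm'.1) fun h0 => ?_)
    rcases ep.eq_of_tight hH hm'.1 hm'.2 h0 with h | h
    exacts [hmp h, hmq h]

theorem IsTriangle.exists_mem_of_edge {h : E3 × ℝ} {a₁ a₂ a₃ p q m : E3}
    (t : IsTriangle H h a₁ a₂ a₃) (s : IsTriangle H h p q m) :
    (p = a₁ ∨ p = a₂ ∨ p = a₃) ∧ (q = a₁ ∨ q = a₂ ∨ q = a₃) :=
  ⟨(t.mem_iff p).1 (mem_faceVerts.2 s.mem_fst), (t.mem_iff q).1 (mem_faceVerts.2 s.rotate.mem_fst)⟩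

/-- Two parallel triangular faces of a polyhedron with five silhouette vertices are positively
homothetic. -/
theorem IsTriangle.exists_homothety {h h' : E3 × ℝ} {b₁ b₂ b₃ : E3}
    (t : IsTriangle H h' b₁ b₂ b₃) (w : IsParallelPair H h h') (hH : Irredundant H)
    (hk : ConstSil 5 H) :
    ∃ a₁ a₂ a₃, IsTriangle H h a₁ a₂ a₃ ∧ ∃ c > (0 : ℝ), a₂ - a₁ = c • (b₂ - b₁) ∧
      a₃ - a₁ = c • (b₃ - b₁) := by
  obtain ⟨a₁, a₂, a₃, s, ⟨c, hc, hA⟩, r, hr2, hr3, hrm⟩ := t.exists_parallel_edge w hH hk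
  obtain ⟨p, q, m, s₁, ⟨c₁, hc₁, h₁⟩, -⟩ := t.rotate.exists_parallel_edge w hH hk
  obtain ⟨p', q', m', s₂, ⟨c₂, hc₂, h₂⟩, -⟩ := t.rotate.rotate.exists_parallel_edge w hH hk
  refine ⟨a₁, a₂, a₃, s, c, hc, hA, ?_⟩
  -- coordinates with respect to the sides `b₂ - b₁` and `b₃ - b₁`
  have hli := t.linearIndependent
  obtain ⟨x, y, hxy⟩ : ∃ x y : ℝ, a₃ - a₁ = x • (b₂ - b₁) + y • (b₃ - b₁) := by
    have w' := w.symm hH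
    have hb := t.mem_fst
    exact exists_combination_of_orthogonal hli (hH.ne_zero w.right_mem)
      ((real_inner_comm _ _).trans (hb.2.inner_sub t.rotate.mem_fst.2))
      ((real_inner_comm _ _).trans (hb.2.inner_sub t.rotate.rotate.mem_fst.2))
      ((real_inner_comm _ _).trans (w.inner_eq_zero
        (s.mem_fst.2.inner_sub s.rotate.rotate.mem_fst.2)))
  have hy : 0 < y := by
    rw [hxy, inner_add_right, inner_smul_right, inner_smul_right, hr2, mul_zero, zero_add] at hrm
    by_contra! h0
    have := mul_nonneg_of_nonpos_of_nonpos h0 hr3.le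
    linarith
  have coord : ∀ α β γ δ : ℝ, α • (b₂ - b₁) + β • (b₃ - b₁) = γ • (b₂ - b₁) + δ • (b₃ - b₁) →
      α = γ ∧ β = δ := by
    intro α β γ δ heq
    have h0 : (α - γ) • (b₂ - b₁) + (β - δ) • (b₃ - b₁) = 0 := by
      rw [sub_smul, sub_smul, ← sub_eq_zero.2 heq]
      abel
    obtain ⟨z1, z2⟩ := LinearIndependent.pair_iff.1 hli _ _ h0
    exact ⟨sub_eq_zero.1 z1, sub_eq_zero.1 z2⟩
  have pos : ∀ v, v = a₁ ∨ v = a₂ ∨ v = a₃ → ∃ ξ η : ℝ,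
      v = a₁ + (ξ • (b₂ - b₁) + η • (b₃ - b₁)) ∧
      (ξ = 0 ∧ η = 0 ∨ ξ = c ∧ η = 0 ∨ ξ = x ∧ η = y) := by
    rintro v (rfl | rfl | rfl)
    · exact ⟨0, 0, by simp, Or.inl ⟨rfl, rfl⟩⟩
    · exact ⟨c, 0, by rw [zero_smul, add_zero, ← hA]; abel, Or.inr (Or.inl ⟨rfl, rfl⟩)⟩
    · exact ⟨x, y, by rw [← hxy]; abel, Or.inr (Or.inr ⟨rfl, rfl⟩)⟩
  obtain ⟨ξp, ηp, hp, cp⟩ := pos p (s.exists_mem_of_edge s₁).1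
  obtain ⟨ξq, ηq, hq, cq⟩ := pos q (s.exists_mem_of_edge s₁).2
  obtain ⟨ξp', ηp', hp', cp'⟩ := pos p' (s.exists_mem_of_edge s₂).1
  obtain ⟨ξq', ηq', hq', cq'⟩ := pos q' (s.exists_mem_of_edge s₂).2
  obtain ⟨k1, k2⟩ := coord (ξq - ξp) (ηq - ηp) (-c₁) c₁ (by
    have : q - p = (-c₁) • (b₂ - b₁) + c₁ • (b₃ - b₁) := by
      rw [h₁]
      match_scalars <;> ring
    rw [← this, hp, hq]
    match_scalars <;> ring)
  obtain ⟨k3, k4⟩ := coord (ξq' - ξp') (ηq' - ηp') 0 (-c₂) (by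
    have : q' - p' = (0 : ℝ) • (b₂ - b₁) + (-c₂) • (b₃ - b₁) := by
      rw [h₂]
      match_scalars <;> ring
    rw [← this, hp', hq']
    match_scalars <;> ring)
  -- which side of the triangle is parallel to `b₃ - b₂`, and which one to `b₁ - b₃`
  have first : x = -y ∨ x = c - y := by
    rcases cp with ⟨e1, e2⟩ | ⟨e1, e2⟩ | ⟨e1, e2⟩ <;> rcases cq with ⟨e3, e4⟩ | ⟨e3, e4⟩ | ⟨e3, e4⟩
    all_goals
      first
      | (exfalso; linarith)
      | (left; linarith)
      | (right; linarith)
  have second : x = 0 ∨ x = c := by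
    rcases cp' with ⟨e1, e2⟩ | ⟨e1, e2⟩ | ⟨e1, e2⟩ <;>
    rcases cq' with ⟨e3, e4⟩ | ⟨e3, e4⟩ | ⟨e3, e4⟩
    all_goals
      first
      | (exfalso; linarith)
      | (left; linarith)
      | (right; linarith)
  have hxy' : x = 0 ∧ y = c := by
    rcases first with f | f <;> rcases second with g | g
    all_goals
      first
      | (exfalso; linarith)
      | (constructor <;> linarith)
  rw [hxy, hxy'.1, hxy'.2, zero_smul, zero_add]

/-- If the triangular face `h'` is smaller than the parallel triangular face `h`, then in the
direction joining their centroids `h` hides the vertices of `h'`. -/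
theorem IsTriangle.not_smaller {h h' : E3 × ℝ} {a₁ a₂ a₃ b₁ b₂ b₃ : E3}
    (s : IsTriangle H h a₁ a₂ a₃) (t : IsTriangle H h' b₁ b₂ b₃) (w : IsParallelPair H h h')
    (hH : Irredundant H) (hk : ConstSil 5 H) {μ : ℝ} (h0 : 0 < μ) (h1 : μ < 1)
    (e2 : b₂ - b₁ = μ • (a₂ - a₁)) (e3 : b₃ - b₁ = μ • (a₃ - a₁)) : False := by
  classical
  set u : E3 := (1 / 3 : ℝ) • (b₁ + b₂ + b₃) - (1 / 3 : ℝ) • (a₁ + a₂ + a₃) with hu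
  have hb2 : b₂ = b₁ + μ • (a₂ - a₁) := by rw [← e2]; abel
  have hb3 : b₃ = b₁ + μ • (a₃ - a₁) := by rw [← e3]; abel
  -- the vertices of `h'` are moved by `-u` into the interior of the face `h`
  have hconv : ∀ v, v = b₁ ∨ v = b₂ ∨ v = b₃ → ∃ x y z : ℝ, 0 < x ∧ 0 < y ∧ 0 < z ∧
      x + y + z = 1 ∧ v - u = x • a₁ + y • a₂ + z • a₃ := by
    rintro v (rfl | rfl | rfl)
    · refine ⟨(1 - μ) / 3 + μ, (1 - μ) / 3, (1 - μ) / 3, by linarith, by linarith, by linarith,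
        by ring, ?_⟩
      rw [hu, hb2, hb3]
      match_scalars <;> ring
    · refine ⟨(1 - μ) / 3, (1 - μ) / 3 + μ, (1 - μ) / 3, by linarith, by linarith, by linarith,
        by ring, ?_⟩
      rw [hu, hb3, hb2]
      match_scalars <;> ring
    · refine ⟨(1 - μ) / 3, (1 - μ) / 3, (1 - μ) / 3 + μ, by linarith, by linarith, by linarith,
        by ring, ?_⟩
      rw [hu, hb2, hb3]
      match_scalars <;> ring
  have ha1 := s.mem_fst
  have ha2 := s.rotate.mem_fst
  have ha3 := s.rotate.rotate.mem_fst
  have hpos : ∀ v, v ∈ faceVerts H h' → ∀ g ∈ H, Tight g v → 0 < ⟪g.1, u⟫_ℝ := by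
    intro v hv g hg hgv
    obtain ⟨x, y, z, hx, hy, hz, hsum, hvu⟩ := hconv v ((t.mem_iff v).1 hv)
    have m1 := mem_poly_of_mem_verts ha1.1 g hg
    have m2 := mem_poly_of_mem_verts ha2.1 g hg
    have m3 := mem_poly_of_mem_verts ha3.1 g hg
    have hval : ⟪g.1, u⟫_ℝ = x * (g.2 - ⟪g.1, a₁⟫_ℝ) + y * (g.2 - ⟪g.1, a₂⟫_ℝ) +
        z * (g.2 - ⟪g.1, a₃⟫_ℝ) := by
      have h1 : ⟪g.1, v - u⟫_ℝ = x * ⟪g.1, a₁⟫_ℝ + y * ⟪g.1, a₂⟫_ℝ + z * ⟪g.1, a₃⟫_ℝ := by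
        rw [hvu, inner_add_right, inner_add_right, inner_smul_right, inner_smul_right,
          inner_smul_right]
      have h2 : ⟪g.1, v⟫_ℝ = g.2 := hgv
      rw [inner_sub_right, h2] at h1
      have hz' : z = 1 - x - y := by linarith
      rw [hz'] at h1 ⊢
      linarith
    have n1 := mul_nonneg hx.le (sub_nonneg.2 m1)
    have n2 := mul_nonneg hy.le (sub_nonneg.2 m2)
    have n3 := mul_nonneg hz.le (sub_nonneg.2 m3)
    refine lt_of_le_of_ne (by rw [hval]; positivity) fun hzero => ?_
    rw [hval] at hzero
    have t1 : x * (g.2 - ⟪g.1, a₁⟫_ℝ) = 0 := by linarith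
    have t2 : y * (g.2 - ⟪g.1, a₂⟫_ℝ) = 0 := by linarith
    have t3 : z * (g.2 - ⟪g.1, a₃⟫_ℝ) = 0 := by linarith
    have t1' : Tight g a₁ := (sub_eq_zero.1 ((mul_eq_zero.1 t1).resolve_left hx.ne')).symm
    have t2' : Tight g a₂ := (sub_eq_zero.1 ((mul_eq_zero.1 t2).resolve_left hy.ne')).symm
    have t3' : Tight g a₃ := (sub_eq_zero.1 ((mul_eq_zero.1 t3).resolve_left hz.ne')).symm
    have hgh : g ≠ h := by
      rintro rfl
      exact w.not_tight hH hgv (mem_faceVerts.1 hv).2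
    have e : IsEdge H h g a₁ a₂ := ⟨w.left_mem, hg, hgh, ha1.1, ha2.1, s.ab, ha1.2, ha2.2, t1', t2'⟩
    rcases e.eq_of_tight hH ha3.1 ha3.2 t3' with h | h
    exacts [s.ac h.symm, s.bc h.symm]
  obtain ⟨u', -, hgen⟩ := exists_generic (H := H) (hH.ne_zero w.left_mem)
  have hcard := hk.card_eq
    ((realizable_dir u).lex ((realizable_dir u').lex (realizable_dir h.1)))
    (lex_ne_zero fun g hg _ => lex_dir_ne_zero hH w.left_mem hgen g hg)
  have hsub : sil H (lex (dir u) (lex (dir u') (dir h.1))) ⊆ faceVerts H h := by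
    intro v hv
    obtain ⟨hvV, -, g, hg, hgv, hneg⟩ := mem_sil.1 hv
    refine mem_faceVerts.2 ⟨hvV, (w.tight_of_mem_verts hH hk hvV).resolve_right fun h'v => ?_⟩
    have hp := hpos v (mem_faceVerts.2 ⟨hvV, h'v⟩) g hg hgv
    rw [lex_of_ne (show dir u g ≠ 0 from hp.ne')] at hneg
    exact lt_asymm hneg hp
  have := Finset.card_le_card hsub
  rw [hcard, w.card_faceVerts hH hk] at this
  omega

theorem vectorSpan_convexHull_triple (a b c : E3) :
    vectorSpan ℝ (convexHull ℝ ({a, b, c} : Set E3)) =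
      Submodule.span ℝ (Set.range ![b - a, c - a]) := by
  rw [← direction_affineSpan, affineSpan_convexHull, direction_affineSpan,
    vectorSpan_eq_span_vsub_set_right ℝ (p := a) (by simp)]
  simp only [vsub_eq_sub, Set.image_insert_eq, Set.image_singleton, sub_self,
    Submodule.span_insert_zero, Matrix.range_cons, Matrix.range_empty, Set.union_empty,
    Set.singleton_union]

theorem finrank_vectorSpan_triangle {a b c : E3} (h : LinearIndependent ℝ ![b - a, c - a]) :
    Module.finrank ℝ (vectorSpan ℝ (convexHull ℝ ({a, b, c} : Set E3))) = 2 := by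
  rw [vectorSpan_convexHull_triple]
  simpa using finrank_span_eq_card h

/-- A polyhedron with five silhouette vertices in every direction is a triangular prism. -/
theorem isPrism_of_constSil (hH : Irredundant H) (hk : ConstSil 5 H) :
    IsPrism 3 (poly H) := by
  classical
  obtain ⟨h, hh, h', hh', hne', hpar⟩ := exists_parallel_faces hH hk
  have w : IsParallelPair H h h' := ⟨hh, hh', hne', hpar⟩
  have w' := w.symm hH
  obtain ⟨b₁, b₂, b₃, t⟩ := exists_isTriangle hh' (w'.card_faceVerts hH hk)
  obtain ⟨a₁, a₂, a₃, s, c, hc, h2, h3⟩ := t.exists_homothety w hH hk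
  have hc1 : c = 1 := by
    rcases lt_trichotomy c 1 with hlt | heq | hgt
    · exact (t.not_smaller s w' hH hk hc hlt h2 h3).elim
    · exact heq
    · refine (s.not_smaller t w hH hk (inv_pos.2 hc) (inv_lt_one_of_one_lt₀ hgt) ?_ ?_).elim
      · rw [h2, smul_smul, inv_mul_cancel₀ hc.ne', one_smul]
      · rw [h3, smul_smul, inv_mul_cancel₀ hc.ne', one_smul]
  rw [hc1, one_smul] at h2 h3
  have ha1 := s.mem_fst
  have ha2 := s.rotate.mem_fst
  have ha3 := s.rotate.rotate.mem_fst
  have hb1 := t.mem_fst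
  have hb2 := t.rotate.mem_fst
  have hb3 := t.rotate.rotate.mem_fst
  have hset : ((({a₁, a₂, a₃} : Finset E3)) : Set E3) = {a₁, a₂, a₃} := by simp
  refine ⟨convexHull ℝ {a₁, a₂, a₃}, b₁ - a₁, ⟨{a₁, a₂, a₃}, ?_, ?_, ?_, ?_⟩, ?_, ?_⟩
  · exact Finset.card_eq_three.2 ⟨a₁, a₂, a₃, s.ab, s.ac, s.bc, rfl⟩
  · have hsub : ((({a₁, a₂, a₃} : Finset E3)) : Set E3) ⊆ (poly H).extremePoints ℝ := by
      rw [hset]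
      rintro v (rfl | rfl | rfl)
      exacts [mem_verts.1 ha1.1, mem_verts.1 ha2.1, mem_verts.1 ha3.1]
    exact (convex_poly.convexIndependent_extremePoints).mono hsub
  · rw [hset]
  · exact finrank_vectorSpan_triangle s.linearIndependent
  · have hle : vectorSpan ℝ (convexHull ℝ ({a₁, a₂, a₃} : Set E3)) ≤ (ℝ ∙ h.1)ᗮ := by
      rw [← direction_affineSpan, affineSpan_convexHull, direction_affineSpan, vectorSpan_def,
        Submodule.span_le]
      have hT : ∀ v ∈ ({a₁, a₂, a₃} : Set E3), Tight h v := by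
        rintro v (rfl | rfl | rfl)
        exacts [ha1.2, ha2.2, ha3.2]
      rintro _ ⟨y, hy, z, hz, rfl⟩
      rw [SetLike.mem_coe, Submodule.mem_orthogonal_singleton_iff_inner_right]
      exact (hT z hz).inner_sub (hT y hy)
    intro hmem
    have h0 := Submodule.mem_orthogonal_singleton_iff_inner_right.1 (hle hmem)
    exact w.not_tight hH (ha1.2.of_inner_sub h0) hb1.2
  · have e2 : b₁ - a₁ + a₂ = b₂ := by
      rw [sub_eq_sub_iff_add_eq_add] at h2
      rw [sub_add_eq_add_sub, sub_eq_iff_eq_add, add_comm b₁, h2]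
    have e3 : b₁ - a₁ + a₃ = b₃ := by
      rw [sub_eq_sub_iff_add_eq_add] at h3
      rw [sub_add_eq_add_sub, sub_eq_iff_eq_add, add_comm b₁, h3]
    have himg : (fun x => b₁ - a₁ + x) '' convexHull ℝ {a₁, a₂, a₃} =
        convexHull ℝ {b₁, b₂, b₃} := by
      have := (AffineEquiv.constVAdd ℝ E3 (b₁ - a₁)).toAffineMap.image_convexHull {a₁, a₂, a₃}
      have h1 : (fun x => b₁ - a₁ + x) '' ({a₁, a₂, a₃} : Set E3) = {b₁, b₂, b₃} := by
        rw [Set.image_insert_eq, Set.image_insert_eq, Set.image_singleton, sub_add_cancel, e2, e3]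
      rw [← h1]
      exact this
    rw [himg, convexHull_convexHull_union_left, convexHull_convexHull_union_right,
      hH.poly_eq_convexHull]
    congr 1
    ext v
    simp only [Finset.mem_coe, Set.mem_union, Set.mem_insert_iff, Set.mem_singleton_iff]
    rw [← s.mem_iff, ← t.mem_iff, mem_faceVerts, mem_faceVerts]
    have := fun hv => w.tight_of_mem_verts hH hk (v := v) hv
    tauto

/-! ### Triangular prisms are equiprojective -/

/-- A triangular prism with base triangle `a` and translation vector `t`, together with affine
coordinates of space: the barycentric coordinates `⟪m i, x⟫ + β i` along the triangle and the
height `⟪n, x⟫ + γ` in the direction of `t`. -/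
structure PrismFrame where
  /-- The vertices of the base triangle. -/
  a : Fin 3 → E3
  /-- The translation vector. -/
  t : E3
  /-- The linear parts of the barycentric coordinates. -/
  m : Fin 3 → E3
  /-- The constant parts of the barycentric coordinates. -/
  β : Fin 3 → ℝ
  /-- The linear part of the height. -/
  n : E3
  /-- The constant part of the height. -/
  γ : ℝ
  m_a : ∀ i j, ⟪m i, a j⟫_ℝ + β i = if j = i then 1 else 0
  m_t : ∀ i, ⟪m i, t⟫_ℝ = 0
  n_a : ∀ i, ⟪n, a i⟫_ℝ + γ = 0
  n_t : ⟪n, t⟫_ℝ = 1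
  sum_m : m 0 + m 1 + m 2 = 0
  sum_β : β 0 + β 1 + β 2 = 1
  eq_sum : ∀ x, x = ∑ i, (⟪m i, x⟫_ℝ + β i) • a i + (⟪n, x⟫_ℝ + γ) • t

/-- The coordinates come from the dual of the basis `t, a₁ - a₀, a₂ - a₀`, represented by inner
products. -/
theorem exists_prismFrame {a₀ a₁ a₂ t : E3} (hli : LinearIndependent ℝ ![t, a₁ - a₀, a₂ - a₀]) :
    ∃ F : PrismFrame, F.a = ![a₀, a₁, a₂] ∧ F.t = t := by
  set b := basisOfLinearIndependentOfCardEqFinrank hli (by simp) with hb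
  have hb0 : b 0 = t := by simp [hb]
  have hb1 : b 1 = a₁ - a₀ := by simp [hb]
  have hb2 : b 2 = a₂ - a₀ := by simp [hb]
  set d : Fin 3 → E3 := fun i =>
    (InnerProductSpace.toDual ℝ E3).symm (LinearMap.toContinuousLinearMap (b.coord i)) with hd
  have hdx : ∀ i x, ⟪d i, x⟫_ℝ = b.repr x i := fun i x => by simp [hd]
  have hdb : ∀ i j, ⟪d i, b j⟫_ℝ = if j = i then 1 else 0 := fun i j => by
    rw [hdx, b.repr_self, Finsupp.single_apply]
  have hrepr : ∀ x, x = ⟪d 0, x⟫_ℝ • t + ⟪d 1, x⟫_ℝ • (a₁ - a₀) + ⟪d 2, x⟫_ℝ • (a₂ - a₀) := by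
    intro x
    have h := b.sum_repr x
    rw [Fin.sum_univ_three, hb0, hb1, hb2] at h
    rw [hdx, hdx, hdx, h]
  have ht : ∀ i, ⟪d i, t⟫_ℝ = if (0 : Fin 3) = i then 1 else 0 := fun i => by rw [← hb0, hdb]
  have h1 : ∀ i, ⟪d i, a₁⟫_ℝ = ⟪d i, a₀⟫_ℝ + if (1 : Fin 3) = i then 1 else 0 := fun i => by
    rw [← hdb, hb1, inner_sub_right]; ring
  have h2 : ∀ i, ⟪d i, a₂⟫_ℝ = ⟪d i, a₀⟫_ℝ + if (2 : Fin 3) = i then 1 else 0 := fun i => by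
    rw [← hdb, hb2, inner_sub_right]; ring
  refine ⟨⟨![a₀, a₁, a₂], t, ![-(d 1 + d 2), d 1, d 2],
    ![1 + ⟪d 1, a₀⟫_ℝ + ⟪d 2, a₀⟫_ℝ, -⟪d 1, a₀⟫_ℝ, -⟪d 2, a₀⟫_ℝ], d 0, -⟪d 0, a₀⟫_ℝ,
    ?_, ?_, ?_, ?_, ?_, ?_, ?_⟩, rfl, rfl⟩
  · intro i j
    fin_cases i <;> fin_cases j <;>
      simp [h1, h2, inner_neg_left, inner_add_left] <;> ring
  · intro i
    fin_cases i <;> simp [ht, inner_neg_left, inner_add_left]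
  · intro i
    fin_cases i <;> simp [h1, h2]
  · simp [ht]
  · simp
  · simp
    ring
  · intro x
    have h := hrepr (x - a₀)
    rw [sub_eq_iff_eq_add] at h
    simp only [inner_sub_right] at h
    conv_lhs => rw [h]
    simp only [Fin.sum_univ_three, Matrix.cons_val_zero, Matrix.cons_val_one, Matrix.cons_val,
      inner_neg_left, inner_add_left]
    match_scalars <;> ring

namespace PrismFrame

variable (F : PrismFrame)

/-- The five half-spaces of a triangular prism: the lateral faces, the base (`false`) and the
top (`true`). -/
noncomputable def cut : Fin 3 ⊕ Bool → E3 × ℝ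
  | .inl i => (-F.m i, F.β i)
  | .inr false => (-F.n, F.γ)
  | .inr true => (F.n, 1 - F.γ)

open scoped Classical in
/-- The system of half-spaces of a triangular prism. -/
noncomputable def cuts : Finset (E3 × ℝ) := Finset.univ.image F.cut

/-- The six vertices of a triangular prism. -/
noncomputable def vertex (p : Fin 3 × Bool) : E3 := F.a p.1 + if p.2 then F.t else 0

/-- The point with barycentric coordinates `l` and height `s`. -/
noncomputable def point (l : Fin 3 → ℝ) (s : ℝ) : E3 := ∑ i, l i • F.a i + s • F.t

theorem forall_mem_cuts {p : E3 × ℝ → Prop} : (∀ g ∈ F.cuts, p g) ↔ ∀ k, p (F.cut k) := by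
  simp only [cuts, Finset.forall_mem_image, Finset.mem_univ, true_imp_iff]

theorem exists_mem_cuts {p : E3 × ℝ → Prop} : (∃ g ∈ F.cuts, p g) ↔ ∃ k, p (F.cut k) := by
  simp only [cuts, Finset.exists_mem_image, Finset.mem_univ, true_and]

theorem sum_coord (x : E3) : ∑ i, (⟪F.m i, x⟫_ℝ + F.β i) = 1 := by
  have h := F.sum_β
  have h2 : ⟪F.m 0 + F.m 1 + F.m 2, x⟫_ℝ = 0 := by rw [F.sum_m, inner_zero_left]
  rw [inner_add_left, inner_add_left] at h2
  rw [Fin.sum_univ_three]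
  linarith

theorem coord_point {l : Fin 3 → ℝ} (hl : ∑ i, l i = 1) (s : ℝ) (i : Fin 3) :
    ⟪F.m i, F.point l s⟫_ℝ + F.β i = l i := by
  have h : ∀ j, ⟪F.m i, F.a j⟫_ℝ = (if j = i then 1 else 0) - F.β i := fun j => by
    rw [← F.m_a i j]; ring
  rw [point, inner_add_right, inner_sum, inner_smul_right, F.m_t]
  simp only [inner_smul_right, h, mul_sub, Finset.sum_sub_distrib, ← Finset.sum_mul, hl]
  simp

theorem height_point {l : Fin 3 → ℝ} (hl : ∑ i, l i = 1) (s : ℝ) :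
    ⟪F.n, F.point l s⟫_ℝ + F.γ = s := by
  have h : ∀ j, ⟪F.n, F.a j⟫_ℝ = - F.γ := fun j => by
    rw [eq_neg_iff_add_eq_zero, F.n_a j]
  rw [point, inner_add_right, inner_sum, inner_smul_right, F.n_t]
  simp only [inner_smul_right, h, ← Finset.sum_mul, hl]
  ring

theorem vertex_eq_point (p : Fin 3 × Bool) :
    F.vertex p = F.point (Pi.single p.1 1) (if p.2 then 1 else 0) := by
  obtain ⟨i, s⟩ := p
  cases s <;> simp [vertex, point, Pi.single_apply]

theorem coord_vertex (p : Fin 3 × Bool) (i : Fin 3) :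
    ⟪F.m i, F.vertex p⟫_ℝ + F.β i = if i = p.1 then 1 else 0 := by
  rw [vertex_eq_point, coord_point _ (by simp), Pi.single_apply]

theorem height_vertex (p : Fin 3 × Bool) :
    ⟪F.n, F.vertex p⟫_ℝ + F.γ = if p.2 then 1 else 0 := by
  rw [vertex_eq_point, height_point _ (by simp)]

theorem eq_of_coord_eq {x y : E3} (h : ∀ i, ⟪F.m i, x⟫_ℝ = ⟪F.m i, y⟫_ℝ)
    (hn : ⟪F.n, x⟫_ℝ = ⟪F.n, y⟫_ℝ) : x = y := by
  rw [F.eq_sum x, F.eq_sum y]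
  simp only [h, hn]

theorem vertex_injective : Function.Injective F.vertex := by
  intro p q hpq
  have h1 := F.coord_vertex p p.1
  have h2 := F.height_vertex p
  rw [hpq, coord_vertex, if_pos rfl] at h1
  rw [hpq, height_vertex] at h2
  refine Prod.ext ?_ ?_
  · by_contra hne
    rw [if_neg hne] at h1
    exact zero_ne_one h1
  · obtain ⟨i, s⟩ := p
    obtain ⟨j, r⟩ := q
    cases s <;> cases r <;> simp_all

theorem tight_lateral_iff {i : Fin 3} {x : E3} :
    Tight (F.cut (.inl i)) x ↔ ⟪F.m i, x⟫_ℝ + F.β i = 0 := by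
  rw [Tight, cut, inner_neg_left, neg_eq_iff_add_eq_zero]

theorem tight_cap_iff {s : Bool} {x : E3} :
    Tight (F.cut (.inr s)) x ↔ ⟪F.n, x⟫_ℝ + F.γ = if s then 1 else 0 := by
  cases s
  · simp [Tight, cut, inner_neg_left, neg_eq_iff_add_eq_zero]
  · simp [Tight, cut, eq_sub_iff_add_eq]

theorem tight_lateral_vertex {i : Fin 3} {p : Fin 3 × Bool} :
    Tight (F.cut (.inl i)) (F.vertex p) ↔ i ≠ p.1 := by
  rw [tight_lateral_iff, coord_vertex]
  simp

theorem tight_cap_vertex {s : Bool} {p : Fin 3 × Bool} :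
    Tight (F.cut (.inr s)) (F.vertex p) ↔ s = p.2 := by
  rw [tight_cap_iff, height_vertex]
  obtain ⟨i, r⟩ := p
  cases s <;> cases r <;> simp

theorem mem_poly_iff {x : E3} : x ∈ poly F.cuts ↔ (∀ i, 0 ≤ ⟪F.m i, x⟫_ℝ + F.β i) ∧
    0 ≤ ⟪F.n, x⟫_ℝ + F.γ ∧ ⟪F.n, x⟫_ℝ + F.γ ≤ 1 := by
  rw [poly, Set.mem_ofPred_eq, forall_mem_cuts, Sum.forall, Bool.forall_bool]
  simp only [cut, inner_neg_left, neg_le_iff_add_nonneg', le_sub_iff_add_le]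

theorem strict_point {l : Fin 3 → ℝ} {s : ℝ} (hl : ∑ i, l i = 1) :
    (∀ i, 0 < l i → ⟪(F.cut (.inl i)).1, F.point l s⟫_ℝ < (F.cut (.inl i)).2) ∧
    (0 < s → ⟪(F.cut (.inr false)).1, F.point l s⟫_ℝ < (F.cut (.inr false)).2) ∧
    (s < 1 → ⟪(F.cut (.inr true)).1, F.point l s⟫_ℝ < (F.cut (.inr true)).2) := by
  have h2 := F.height_point hl s
  simp only [cut, inner_neg_left]
  refine ⟨fun i hi => ?_, fun hs => ?_, fun hs => ?_⟩
  · have h1 := F.coord_point hl s i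
    linarith
  · linarith
  · linarith

theorem poly_eq_convexHull : poly F.cuts =
    convexHull ℝ (convexHull ℝ (Set.range F.a) ∪
      (fun x => F.t + x) '' convexHull ℝ (Set.range F.a)) := by
  apply Set.Subset.antisymm
  · intro x hx
    obtain ⟨h1, h2, h3⟩ := F.mem_poly_iff.1 hx
    set l : Fin 3 → ℝ := fun i => ⟪F.m i, x⟫_ℝ + F.β i with hl
    set s : ℝ := ⟪F.n, x⟫_ℝ + F.γ with hs
    have hq : ∑ i, l i • F.a i ∈ convexHull ℝ (Set.range F.a) :=
      (convex_convexHull ℝ _).sum_mem (fun i _ => h1 i) (F.sum_coord x)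
        fun i _ => subset_convexHull ℝ _ ⟨i, rfl⟩
    rw [F.eq_sum x]
    have hmem := convex_convexHull ℝ (convexHull ℝ (Set.range F.a) ∪
      (fun x => F.t + x) '' convexHull ℝ (Set.range F.a))
      (subset_convexHull ℝ _ (Or.inl hq))
      (subset_convexHull ℝ _ (Or.inr ⟨_, hq, rfl⟩)) (sub_nonneg.2 h3) h2 (sub_add_cancel 1 s)
    convert hmem using 1
    simp only [hl, hs]
    module
  · apply convexHull_min _ convex_poly
    have hbase : ∀ x ∈ convexHull ℝ (Set.range F.a),
        (∀ i, 0 ≤ ⟪F.m i, x⟫_ℝ + F.β i) ∧ ⟪F.n, x⟫_ℝ + F.γ = 0 := by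
      intro x hx
      rw [convexHull_range_eq_exists_affineCombination] at hx
      obtain ⟨s, w, hw0, hw1, rfl⟩ := hx
      set l : Fin 3 → ℝ := fun i => if i ∈ s then w i else 0 with hl
      have hsum : ∑ i, l i = 1 := by rw [hl, Finset.sum_ite_mem, Finset.univ_inter, hw1]
      have hpt : s.affineCombination ℝ F.a w = F.point l 0 := by
        rw [s.affineCombination_eq_linear_combination _ _ hw1, point, zero_smul, add_zero]
        simp [hl, ite_smul, Finset.sum_ite_mem]
      rw [hpt]
      refine ⟨fun i => ?_, F.height_point hsum 0⟩
      rw [F.coord_point hsum]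
      simp only [hl]
      split_ifs with hi
      exacts [hw0 i hi, le_rfl]
    rintro x (hx | ⟨y, hy, rfl⟩)
    · obtain ⟨h1, h2⟩ := hbase x hx
      exact F.mem_poly_iff.2 ⟨h1, h2.ge, h2.le.trans zero_le_one⟩
    · obtain ⟨h1, h2⟩ := hbase y hy
      refine F.mem_poly_iff.2 ⟨fun i => ?_, ?_, ?_⟩
      · simpa only [inner_add_right, F.m_t, zero_add] using h1 i
      · rw [inner_add_right, F.n_t, add_assoc, h2, add_zero]
        exact zero_le_one
      · rw [inner_add_right, F.n_t, add_assoc, h2, add_zero]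

theorem poly_eq_convexHull_vertex : poly F.cuts = convexHull ℝ (Set.range F.vertex) := by
  have himg : (fun x => F.t + x) '' convexHull ℝ (Set.range F.a) =
      convexHull ℝ ((fun x => F.t + x) '' Set.range F.a) :=
    (AffineEquiv.constVAdd ℝ E3 F.t).toAffineMap.image_convexHull (Set.range F.a)
  rw [poly_eq_convexHull, himg, convexHull_convexHull_union_left,
    convexHull_convexHull_union_right]
  congr 1
  ext v
  simp only [Set.mem_union, Set.mem_image, Set.mem_range, exists_exists_eq_and, Prod.exists,
    vertex, Bool.exists_bool, Bool.false_eq_true, if_false, if_true, add_zero, exists_or,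
    add_comm F.t]

theorem irredundant : Irredundant F.cuts := by
  refine ⟨?_, ⟨F.point (fun _ => 1 / 3) (1 / 2), ?_⟩, ?_⟩
  · rw [poly_eq_convexHull_vertex]
    exact ((Set.finite_range _).isCompact_convexHull ℝ).isBounded
  · obtain ⟨h1, h2, h3⟩ := F.strict_point (l := fun _ => 1 / 3) (s := 1 / 2) (by simp)
    rw [forall_mem_cuts, Sum.forall, Bool.forall_bool]
    exact ⟨fun i => h1 i (by norm_num), h2 (by norm_num), h3 (by norm_num)⟩
  · rw [forall_mem_cuts]
    rintro (j | s)
    · have hl : ∑ i : Fin 3, (if i = j then (0 : ℝ) else 1 / 2) = 1 := by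
        fin_cases j <;> simp [Fin.sum_univ_three] <;> norm_num
      refine ⟨F.point (fun i => if i = j then 0 else 1 / 2) (1 / 2), ?_, ?_⟩
      · rw [tight_lateral_iff, coord_point _ hl, if_pos rfl]
      · obtain ⟨h1, h2, h3⟩ := F.strict_point (s := 1 / 2) hl
        rw [forall_mem_cuts, Sum.forall, Bool.forall_bool]
        refine ⟨fun i hi => h1 i ?_, fun _ => h2 (by norm_num), fun _ => h3 (by norm_num)⟩
        rw [if_neg (by rintro rfl; exact hi rfl)]
        norm_num
    · have hl : ∑ _i : Fin 3, (1 / 3 : ℝ) = 1 := by simp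
      refine ⟨F.point (fun _ => 1 / 3) (if s then 1 else 0), ?_, ?_⟩
      · rw [tight_cap_iff, height_point _ hl]
      · obtain ⟨h1, h2, h3⟩ := F.strict_point (s := if s then 1 else 0) hl
        rw [forall_mem_cuts, Sum.forall, Bool.forall_bool]
        refine ⟨fun i _ => h1 i (by norm_num), fun hs => h2 ?_, fun hs => h3 ?_⟩
        · cases s
          · exact absurd rfl hs
          · simp
        · cases s
          · simp
          · exact absurd rfl hs

open scoped Classical in
theorem verts_cuts : verts F.cuts = Finset.univ.image F.vertex := by
  ext v
  rw [mem_verts, Finset.mem_image]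
  constructor
  · intro hv
    rw [poly_eq_convexHull_vertex] at hv
    obtain ⟨p, rfl⟩ := extremePoints_convexHull_subset hv
    exact ⟨p, Finset.mem_univ _, rfl⟩
  · rintro ⟨p, -, rfl⟩
    refine mem_extremePoints_of_tight ?_ fun x _ hx => ?_
    · rw [poly_eq_convexHull_vertex]
      exact subset_convexHull ℝ _ ⟨p, rfl⟩
    · rw [forall_mem_cuts] at hx
      have hlat : ∀ i ≠ p.1, ⟪F.m i, x⟫_ℝ + F.β i = 0 := fun i hi =>
        F.tight_lateral_iff.1 (hx _ (F.tight_lateral_vertex.2 hi))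
      have hcap := F.tight_cap_iff.1 (hx (.inr p.2) (F.tight_cap_vertex.2 rfl))
      have hsum := F.sum_coord x
      rw [Finset.sum_eq_single_of_mem p.1 (Finset.mem_univ _) fun i _ hi => hlat i hi] at hsum
      refine F.eq_of_coord_eq (fun i => ?_) ?_
      · have h := F.coord_vertex p i
        by_cases hi : i = p.1
        · subst hi
          rw [if_pos rfl] at h
          linarith
        · have h' := hlat i hi
          rw [if_neg hi] at h
          linarith
      · have h := F.height_vertex p
        linarith

end PrismFrame

theorem mem_sil_iff_exists_mul_neg {H : Finset (E3 × ℝ)} {σ : E3 × ℝ → ℝ} {v : E3} :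
    v ∈ sil H σ ↔ v ∈ verts H ∧
      ∃ f ∈ H, ∃ g ∈ H, Tight f v ∧ Tight g v ∧ σ f * σ g < 0 := by
  rw [mem_sil]
  refine and_congr_right fun _ => ⟨?_, ?_⟩
  · rintro ⟨⟨f, hf, hfv, hpos⟩, g, hg, hgv, hneg⟩
    exact ⟨f, hf, g, hg, hfv, hgv, mul_neg_of_pos_of_neg hpos hneg⟩
  · rintro ⟨f, hf, g, hg, hfv, hgv, h⟩
    rcases mul_neg_iff.1 h with ⟨h1, h2⟩ | ⟨h1, h2⟩
    · exact ⟨⟨f, hf, hfv, h1⟩, g, hg, hgv, h2⟩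
    · exact ⟨⟨g, hg, hgv, h2⟩, f, hf, hfv, h1⟩

/-- Of three nonzero numbers with sum zero, exactly one has the sign opposite to the others. -/
theorem exists_opposite_sign {c : Fin 3 → ℝ} (h0 : ∀ i, c i ≠ 0) (hsum : c 0 + c 1 + c 2 = 0) :
    ∃ i, ∀ j ≠ i, c i * c j < 0 := by
  have key : ∀ x y z : ℝ, x ≠ 0 → y ≠ 0 → z ≠ 0 → x + y + z = 0 →
      (x * y < 0 ∧ x * z < 0) ∨ (y * x < 0 ∧ y * z < 0) ∨ (z * x < 0 ∧ z * y < 0) := by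
    intro x y z hx hy hz h
    rcases lt_or_gt_of_ne hx with hx | hx <;> rcases lt_or_gt_of_ne hy with hy | hy <;>
      rcases lt_or_gt_of_ne hz with hz | hz <;> simp only [mul_neg_iff] <;>
      first | (exfalso; linarith) | tauto
  rcases key _ _ _ (h0 0) (h0 1) (h0 2) hsum with h | h | h
  · exact ⟨0, fun j hj => by fin_cases j <;> simp_all⟩
  · exact ⟨1, fun j hj => by fin_cases j <;> simp_all⟩
  · exact ⟨2, fun j hj => by fin_cases j <;> simp_all⟩

theorem mul_pos_of_mul_neg {x y z : ℝ} (hy : x * y < 0) (hz : x * z < 0) : 0 < y * z := by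
  rcases mul_neg_iff.1 hy with ⟨h1, h2⟩ | ⟨h1, h2⟩ <;>
    rcases mul_neg_iff.1 hz with ⟨h3, h4⟩ | ⟨h3, h4⟩
  · exact mul_pos_of_neg_of_neg h2 h4
  · exact absurd h1 h3.not_gt
  · exact absurd h1 h3.not_gt
  · exact mul_pos h2 h4

namespace PrismFrame

variable (F : PrismFrame)

/-- In every direction that is not parallel to a face, a triangular prism has exactly one vertex
off the silhouette: among the lateral faces one looks to the other side than the two others, and
the vertex is the one opposite to it on the base or the top, whichever looks to the same side as
these two. -/
theorem constSil : ConstSil 5 F.cuts := by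
  classical
  intro u hu
  rw [forall_mem_cuts] at hu
  have hmem : ∀ p, F.vertex p ∈ sil F.cuts (dir u) ↔ ∃ k l, Tight (F.cut k) (F.vertex p) ∧
      Tight (F.cut l) (F.vertex p) ∧ dir u (F.cut k) * dir u (F.cut l) < 0 := by
    intro p
    rw [mem_sil_iff_exists_mul_neg, exists_mem_cuts]
    simp only [exists_mem_cuts, verts_cuts, Finset.mem_image_of_mem _ (Finset.mem_univ p),
      true_and]
  obtain ⟨i, hi⟩ := exists_opposite_sign (c := fun i => dir u (F.cut (.inl i)))
    (fun i => hu _) (by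
      have h : ⟪F.m 0 + F.m 1 + F.m 2, u⟫_ℝ = 0 := by rw [F.sum_m, inner_zero_left]
      rw [inner_add_left, inner_add_left] at h
      simp only [dir, cut, inner_neg_left]
      linarith)
  obtain ⟨s, hs⟩ : ∃ s, dir u (F.cut (.inl i)) * dir u (F.cut (.inr s)) < 0 := by
    have h1 : dir u (F.cut (.inr true)) = -dir u (F.cut (.inr false)) := by
      simp [dir, cut, inner_neg_left]
    rcases lt_or_gt_of_ne (mul_ne_zero (hu (.inl i)) (hu (.inr false))) with h | h
    · exact ⟨false, h⟩
    · exact ⟨true, by rw [h1, mul_neg]; exact neg_neg_of_pos h⟩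
  have hopp : ∀ k, Tight (F.cut k) (F.vertex (i, s)) →
      dir u (F.cut (.inl i)) * dir u (F.cut k) < 0 := by
    rintro (j | r) hk
    · exact hi j (F.tight_lateral_vertex.1 hk)
    · rw [F.tight_cap_vertex.1 hk]
      exact hs
  have hsil : sil F.cuts (dir u) = (verts F.cuts).erase (F.vertex (i, s)) := by
    ext v
    rw [Finset.mem_erase]
    constructor
    · refine fun hv => ⟨?_, (mem_sil.1 hv).1⟩
      rintro rfl
      obtain ⟨k, l, hk, hl, hneg⟩ := (hmem _).1 hv
      exact hneg.not_gt (mul_pos_of_mul_neg (hopp k hk) (hopp l hl))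
    · rintro ⟨hne, hv⟩
      rw [verts_cuts] at hv
      obtain ⟨⟨j, r⟩, -, rfl⟩ := Finset.mem_image.1 hv
      rw [hmem]
      by_cases hji : j = i
      · -- the other end of the same lateral edge: the cap there looks to the side of face `i`
        subst hji
        have hrs : r ≠ s := fun h => hne (by rw [h])
        obtain ⟨l, hl⟩ : ∃ l, l ≠ j := exists_ne j
        refine ⟨.inl l, .inr r, F.tight_lateral_vertex.2 hl, F.tight_cap_vertex.2 rfl, ?_⟩
        have h1 : dir u (F.cut (.inr r)) = -dir u (F.cut (.inr s)) := by
          cases r <;> cases s <;> simp_all [dir, cut, inner_neg_left]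
        rw [h1, mul_neg]
        exact neg_neg_of_pos (mul_pos_of_mul_neg (hi l hl) hs)
      · have hthird : ∀ i j : Fin 3, ∃ l, l ≠ i ∧ l ≠ j := by decide
        obtain ⟨l, hli, hlj⟩ := hthird i j
        exact ⟨.inl i, .inl l, F.tight_lateral_vertex.2 (Ne.symm hji),
          F.tight_lateral_vertex.2 hlj, hi l hli⟩
  have hcard : (verts F.cuts).card = 6 := by
    rw [verts_cuts, Finset.card_image_of_injective _ F.vertex_injective]
    rfl
  rw [hsil, Finset.card_erase_of_mem, hcard]
  rw [verts_cuts]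
  exact Finset.mem_image_of_mem _ (Finset.mem_univ _)

theorem isEquiprojective : IsEquiprojective 5 (poly F.cuts) :=
  F.irredundant.isEquiprojective F.constSil

end PrismFrame

theorem IsPrism.isEquiprojective {P : Set E3} (hP : IsPrism 3 P) : IsEquiprojective 5 P := by
  classical
  obtain ⟨Q, t, ⟨V, hcard, -, rfl, hdim⟩, ht, rfl⟩ := hP
  obtain ⟨a₀, a₁, a₂, -, -, -, rfl⟩ := Finset.card_eq_three.1 hcard
  have hset : ((({a₀, a₁, a₂} : Finset E3)) : Set E3) = {a₀, a₁, a₂} := by simp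
  rw [hset, vectorSpan_convexHull_triple] at hdim ht
  have hli : LinearIndependent ℝ ![a₁ - a₀, a₂ - a₀] := by
    rw [linearIndependent_iff_card_eq_finrank_span, Set.finrank, hdim, Fintype.card_fin]
  obtain ⟨F, hF, rfl⟩ := exists_prismFrame (linearIndependent_finCons.2 ⟨hli, ht⟩)
  have h := F.isEquiprojective
  rw [F.poly_eq_convexHull, hF] at h
  have hr : Set.range ![a₀, a₁, a₂] = {a₀, a₁, a₂} := by
    simp only [Matrix.range_cons, Matrix.range_empty, Set.union_empty, Set.singleton_union]
  rwa [hset, ← hr]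

theorem exists_isEquiprojective_five : ∃ P : Set E3, IsEquiprojective 5 P := by
  have hli : LinearIndependent ℝ ![EuclideanSpace.basisFun (Fin 3) ℝ 0,
      EuclideanSpace.basisFun (Fin 3) ℝ 1 - 0, EuclideanSpace.basisFun (Fin 3) ℝ 2 - 0] := by
    have h : ![EuclideanSpace.basisFun (Fin 3) ℝ 0, EuclideanSpace.basisFun (Fin 3) ℝ 1,
        EuclideanSpace.basisFun (Fin 3) ℝ 2] = EuclideanSpace.basisFun (Fin 3) ℝ := by
      funext i
      fin_cases i <;> rfl
    rw [sub_zero, sub_zero, h]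
    exact (EuclideanSpace.basisFun (Fin 3) ℝ).orthonormal.linearIndependent
  obtain ⟨F, -⟩ := exists_prismFrame hli
  exact ⟨_, F.isEquiprojective⟩

/-! ### The least number of vertices -/

theorem IsEquiprojective.five_le {k : ℕ} {P : Set E3} (hP : IsEquiprojective k P) : 5 ≤ k := by
  obtain ⟨H, hH, -, hk⟩ := hP.exists_irredundant
  by_cases hU : ∀ h ∈ H, ∀ g ∈ H, g ≠ h → NonParallel h g
  · exact five_le_of_nonParallel hH hk hU
  · simp only [NonParallel] at hU
    push Not at hU
    obtain ⟨h, hh, g, hg, hne, hpar⟩ := hU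
    exact (IsParallelPair.mk hh hg hne hpar).five_le hH hk

theorem IsEquiprojective.isPrism {P : Set E3} (hP : IsEquiprojective 5 P) : IsPrism 3 P := by
  obtain ⟨H, hH, rfl, hk⟩ := hP.exists_irredundant
  exact isPrism_of_constSil hH hk

end Equiprojective

theorem mainTheorem1 :
    (∀ P : Set Equiprojective.E3, ¬ Equiprojective.IsEquiprojective 3 P) ∧
    (∀ P : Set Equiprojective.E3, ¬ Equiprojective.IsEquiprojective 4 P) ∧
    (∀ P : Set Equiprojective.E3,
      Equiprojective.IsEquiprojective 5 P ↔ Equiprojective.IsPrism 3 P) ∧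
    IsLeast {k : ℕ | ∃ P : Set Equiprojective.E3, Equiprojective.IsEquiprojective k P} 5 := by
  refine ⟨fun P hP => ?_, fun P hP => ?_, fun P => ⟨fun hP => hP.isPrism, fun hP =>
    hP.isEquiprojective⟩, Equiprojective.exists_isEquiprojective_five, ?_⟩
  · have := hP.five_le
    omega
  · have := hP.five_le
    omega
  · rintro k ⟨P, hP⟩
    exact hP.five_le
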